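/- Let $m,n$ be coprime positive integers and let $$\mathbb{H}_{m/n}=\{(z_1,z_2)\in\mathbb{C}^2 : |z_1|^{m/n}<|z_2|<1\},$$ equipped with Lebesgue measure $dV$. For real $p>0$ let $L^p(\mathbb{H}_{m/n})$ be the space of measurable functions $f$ with $\|f\|_p=\left(\int_{\mathbb{H}_{m/n}}|f|^p\,dV\right)^{1/p}<\infty$, and let $A^p(\mathbb{H}_{m/n})$ be the space of holomorphic functions on $\mathbb{H}_{m/n}$ that lie in $L^p(\mathbb{H}_{m/n})$. Let $\mathbb{B}_{m/n}(z,w)$ be the Bergman kernel of $\mathbb{H}_{m/n}$, that is, the kernel, conjugate-holomorphic and square integrable in $w$, that represents the orthogonal projection $L^2(\mathbb{H}_{m/n})\to A^2(\mathbb{H}_{m/n})$. The Bergman projection is the integral operator $$\mathbf{B}_{m/n}f(z)=\int_{\mathbb{H}_{m/n}}\mathbb{B}_{m/n}(z,w)\,f(w)\,dV(w).$$ Let $p>0$ be real. Then $\mathbf{B}_{m/n}$ is a bounded operator from $L^p(\mathbb{H}_{m/n})$ to $A^p(\mathbb{H}_{m/n})$, meaning that there is a constant $C$ such that for every $f\in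 L^p(\mathbb{H}_{m/n})$ the integral $\mathbf{B}_{m/n}f(z)$ converges absolutely for every $z\in\mathbb{H}_{m/n}$, $\mathbf{B}_{m/n}f\in A^p(\mathbb{H}_{m/n})$ and $\|\mathbf{B}_{m/n}f\|_p\le C\|f\|_p$, if and only if $$p\in\left(\frac{2m+2n}{m+n+1},\ \frac{2m+2n}{m+n-1}\right).$$ -/

import Mathlib

open MeasureTheory
open scoped NNReal ENNReal

/-- The power-generalized Hartogs triangle of exponent `γ`, as a subset of `ℂ²`. -/
def hartogsTriangle (γ : ℝ) : Set (ℂ × ℂ) :=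
  {z | ‖z.1‖ ^ γ < ‖z.2‖ ∧ ‖z.2‖ < 1}

/-- `f` belongs to the Bergman space `A^p(Ω)`: it is holomorphic on `Ω` and `p`-th power
integrable on `Ω` for Lebesgue measure on `ℂ²`. Values outside `Ω` play no role. -/
def MemBergman (Ω : Set (ℂ × ℂ)) (p : ℝ≥0∞) (f : ℂ × ℂ → ℂ) : Prop :=
  DifferentiableOn ℂ f Ω ∧ MemLp f p (volume.restrict Ω)

/-- `g` is the orthogonal projection of `f` to `A^2(Ω)`, for the inner product
`⟨f, h⟩ = ∫_Ω f * conj h` of `L^2(Ω)`. -/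
def IsBergmanProjection (Ω : Set (ℂ × ℂ)) (f g : ℂ × ℂ → ℂ) : Prop :=
  MemBergman Ω 2 g ∧
    ∀ h, MemBergman Ω 2 h → ∫ w in Ω, (f w - g w) * starRingEnd ℂ (h w) = 0

/-- `K` is the Bergman kernel of `Ω`: the integral kernel, conjugate-holomorphic and square
integrable in the second variable, that represents the orthogonal projection
`L^2(Ω) → A^2(Ω)`. -/
structure IsBergmanKernel (Ω : Set (ℂ × ℂ)) (K : ℂ × ℂ → ℂ × ℂ → ℂ) : Prop where
  memBergman : ∀ z ∈ Ω, MemBergman Ω 2 (fun w => starRingEnd ℂ (K z w))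
  isBergmanProjection : ∀ f, MemLp f 2 (volume.restrict Ω) →
    IsBergmanProjection Ω f (fun z => ∫ w in Ω, K z w * f w)

/-- Functions continuous on an open set at zero `L^2` distance agree there. -/
theorem eqOn_of_sq_zero {Ω : Set (ℂ × ℂ)} (hΩ : IsOpen Ω) {f g : ℂ × ℂ → ℂ}
    (hf : ContinuousOn f Ω) (hg : ContinuousOn g Ω)
    (hd : MemLp (fun u => f u - g u) 2 (volume.restrict Ω))
    (h : ∫ u in Ω, (((‖f u - g u‖ ^ 2 : ℝ)) : ℂ) = 0) : ∀ u ∈ Ω, f u = g u := by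
  rw [integral_complex_ofReal, Complex.ofReal_eq_zero, integral_eq_zero_iff_of_nonneg
    (fun u => by positivity) (hd.integrable_norm_pow (by norm_num))] at h
  have h2 : f =ᵐ[volume.restrict Ω] g := by
    filter_upwards [h] with u hu
    simpa [sub_eq_zero] using hu
  exact Measure.eqOn_open_of_ae_eq h2 hΩ hf hg

/-- The Bergman kernel is unique on `Ω × Ω`. -/
theorem IsBergmanKernel.unique {Ω : Set (ℂ × ℂ)} (hΩ : IsOpen Ω)
    {K L : ℂ × ℂ → ℂ × ℂ → ℂ} (hK : IsBergmanKernel Ω K) (hL : IsBergmanKernel Ω L)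
    {z w : ℂ × ℂ} (hz : z ∈ Ω) (hw : w ∈ Ω) : K z w = L z w := by
  have hD : MemBergman Ω 2 (fun u => starRingEnd ℂ (K z u) - starRingEnd ℂ (L z u)) :=
    ⟨(hK.memBergman z hz).1.sub (hL.memBergman z hz).1,
      (hK.memBergman z hz).2.sub (hL.memBergman z hz).2⟩
  set D : ℂ × ℂ → ℂ := fun u => starRingEnd ℂ (K z u) - starRingEnd ℂ (L z u) with hDdef
  -- two orthogonal projections of the same function agree on `Ω`
  have key : ∀ f g g', MemLp f 2 (volume.restrict Ω) → IsBergmanProjection Ω f g →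
      IsBergmanProjection Ω f g' → ∀ u ∈ Ω, g u = g' u := by
    intro f g g' hf hg hg'
    have hd : MemBergman Ω 2 (fun u => g u - g' u) :=
      ⟨hg.1.1.sub hg'.1.1, hg.1.2.sub hg'.1.2⟩
    have hds : MemLp (fun u => starRingEnd ℂ (g u - g' u)) 2 (volume.restrict Ω) := hd.2.star
    have e1 := hg.2 _ hd
    have e2 := hg'.2 _ hd
    have i1 : Integrable (fun u => (f u - g u) * starRingEnd ℂ (g u - g' u))
        (volume.restrict Ω) := (hf.sub hg.1.2).integrable_mul hds
    have i2 : Integrable (fun u => (f u - g' u) * starRingEnd ℂ (g u - g' u))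
        (volume.restrict Ω) := (hf.sub hg'.1.2).integrable_mul hds
    have e3 : ∫ u in Ω, (((‖g u - g' u‖ ^ 2 : ℝ)) : ℂ) = 0 := by
      have := integral_sub i2 i1
      rw [e1, e2, sub_zero] at this
      rw [← this]
      congr 1
      ext u
      rw [← sub_mul, sub_sub_sub_cancel_left, Complex.mul_conj, Complex.normSq_eq_norm_sq]
    exact eqOn_of_sq_zero hΩ hg.1.1.continuousOn hg'.1.1.continuousOn hd.2 e3
  have hDs : MemLp (fun u => D u) 2 (volume.restrict Ω) := hD.2
  have e := key D _ _ hDs (hK.isBergmanProjection D hDs) (hL.isBergmanProjection D hDs) z hz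
  have iK : Integrable (fun u => K z u * D u) (volume.restrict Ω) := by
    have : MemLp (fun u => K z u) 2 (volume.restrict Ω) := by
      simpa [Function.comp_def, Pi.star_def] using (hK.memBergman z hz).2.star
    exact this.integrable_mul hDs
  have iL : Integrable (fun u => L z u * D u) (volume.restrict Ω) := by
    have : MemLp (fun u => L z u) 2 (volume.restrict Ω) := by
      simpa [Function.comp_def, Pi.star_def] using (hL.memBergman z hz).2.star
    exact this.integrable_mul hDs
  have e3 : ∫ u in Ω,
      (((‖starRingEnd ℂ (K z u) - starRingEnd ℂ (L z u)‖ ^ 2 : ℝ)) : ℂ) = 0 := by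
    have := integral_sub iK iL
    rw [e, sub_self] at this
    rw [← this]
    congr 1
    ext u
    simp only [hDdef]
    rw [← sub_mul, ← map_sub, Complex.mul_conj, Complex.normSq_eq_norm_sq, Complex.norm_conj]
  exact (starRingEnd ℂ).injective (eqOn_of_sq_zero hΩ (hK.memBergman z hz).1.continuousOn
    (hL.memBergman z hz).1.continuousOn hD.2 e3 w hw)

open Classical in
/-- The Bergman kernel of `Ω`. -/
noncomputable def bergmanKernel (Ω : Set (ℂ × ℂ)) : ℂ × ℂ → ℂ × ℂ → ℂ :=
  if h : ∃ K, IsBergmanKernel Ω K then h.choose else 0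

/-- The Bergman projection of `Ω` as an integral operator. On `L^2(Ω)` it is the orthogonal
projection to `A^2(Ω)`. -/
noncomputable def bergmanProjection (Ω : Set (ℂ × ℂ)) (f : ℂ × ℂ → ℂ) (z : ℂ × ℂ) : ℂ :=
  ∫ w in Ω, bergmanKernel Ω z w * f w

/-- The Bergman projection is a bounded operator from `L^p(Ω)` to `A^p(Ω)`: for every `f` in
`L^p(Ω)` the defining integral converges absolutely at every point of `Ω`, the resulting
function lies in `A^p(Ω)`, and its norm is at most a constant times that of `f`. -/
def BergmanProjectionBounded (Ω : Set (ℂ × ℂ)) (p : ℝ≥0∞) : Prop :=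
  ∃ C : ℝ≥0, ∀ f : ℂ × ℂ → ℂ, MemLp f p (volume.restrict Ω) →
    (∀ z ∈ Ω, IntegrableOn (fun w => bergmanKernel Ω z w * f w) Ω) ∧
    MemBergman Ω p (bergmanProjection Ω f) ∧
    eLpNorm (bergmanProjection Ω f) p (volume.restrict Ω) ≤
      C * eLpNorm f p (volume.restrict Ω)

/-!
# Boundedness of the Bergman projection on rational power-generalized Hartogs triangles

The map `Φ(v, τ) = (v τ^n, τ^m)` (`hartogsCover`) is an `m`-sheeted covering of the Hartogs triangle
of exponent `m / n` by the product of the disc and the punctured disc. It turns Lebesgue measure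
into `m |τ|^{2L}` times Lebesgue measure, where `L = m + n - 1` (`map_hartogsCover`). Pulling a
square integrable holomorphic function back and multiplying by `τ^L` therefore gives a square
integrable holomorphic function of `v` and `τ`, whose singularity at `τ = 0` is removable, and the
Bergman kernels of the two discs reproduce it. Summing over the sheets, one obtains an explicit
Bergman kernel of the Hartogs triangle (`hartogsKernel`): for `z = Φ(v, τ)` and `w = Φ(v', τ')` it
is the sum, over the `m`-th roots of unity acting on `(v, τ)`, of
`(1 - v v'^*)^{-2} (1 - τ τ'^*)^{-2} (τ τ'^*)^{-L} / (π m)²`, the star denoting conjugation.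
Self-adjointness and the reproducing property show that it represents the orthogonal projection
(`isBergmanKernel_hartogsKernel`), and the Bergman kernel is unique.

*Sufficiency.* After the lift to the covering space the Schur test applies with the weight
`|τ|^{-α} (1 - |v|²)^{-ε} (1 - |τ|²)^{-ε}`. The Forelli–Rudin estimate on the disc bounds the two
integrals of the test as soon as `α p` and `α q` lie in `[L, L + 2)`, where `q` is the exponent
conjugate to `p`, and `α = max (L / p) (L / q)` satisfies this if and only if
`(2 L + 2) / (L + 2) < p < (2 L + 2) / L` (`exists_lintegral_liftedKernel_rpow_le`).

*Necessity.* As `m` and `n` are coprime, there is a monomial `M = z₁^a / z₂^b` whose pullback is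
`v^a / τ^L`, of the lowest order in `τ` that square integrability permits. The projection maps
`M |z₂|^{(s - 2) / m}` to `(2 / s) M` for every `s > 0` (`hartogsOperator_radialMonomial`). For
`s = L + 2` the function is bounded, so `M` has to be in `L^p`, which gives the upper bound on `p`.
At the lower endpoint `p = (2 L + 2) / (L + 2)` the norm of the function grows only like
`s^{-1 / p}` as `s → 0`, while that of its projection grows like `1 / s`; smaller exponents are
compared with the endpoint by Hölder's inequality on the finite measure space.
-/

/-! ### Polar coordinates and Cauchy integrals on the unit disc -/

theorem polarCoord_symm_eq_circleMap (q : ℝ × ℝ) :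
    Complex.polarCoord.symm q = circleMap 0 q.1 q.2 := by
  simp [circleMap, Complex.exp_mul_I]

theorem lintegral_eq_lintegral_circleMap {F : ℂ → ℝ≥0∞} (hF : Measurable F) :
    ∫⁻ w, F w = ∫⁻ r in Set.Ioi (0 : ℝ), ENNReal.ofReal r *
      ∫⁻ θ in Set.Ioo (-Real.pi) Real.pi, F (circleMap 0 r θ) := by
  have hm : Measurable fun q : ℝ × ℝ => F (circleMap 0 q.1 q.2) :=
    hF.comp (by unfold circleMap; fun_prop)
  rw [← Complex.lintegral_comp_polarCoord_symm, polarCoord_target,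
    Measure.volume_eq_prod, ← Measure.prod_restrict, lintegral_prod]
  · refine lintegral_congr fun r => ?_
    rw [← lintegral_const_mul]
    · simp only [polarCoord_symm_eq_circleMap, smul_eq_mul]
    · exact hm.comp (measurable_const.prodMk measurable_id)
  · simp only [polarCoord_symm_eq_circleMap, smul_eq_mul]
    exact ((ENNReal.measurable_ofReal.comp measurable_fst).mul hm).aemeasurable

theorem integral_eq_integral_circleMap {F : ℂ → ℂ} (hF : Measurable F) (hi : Integrable F) :
    ∫ w, F w = ∫ r in Set.Ioi (0 : ℝ), (r : ℂ) *
      ∫ θ in (0 : ℝ)..2 * Real.pi, F (circleMap 0 r θ) := by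
  have hm : Measurable fun q : ℝ × ℝ => F (circleMap 0 q.1 q.2) :=
    hF.comp (by unfold circleMap; fun_prop)
  rw [← Complex.integral_comp_polarCoord_symm, polarCoord_target,
    Measure.volume_eq_prod, ← Measure.prod_restrict, integral_prod]
  · refine integral_congr_ae (.of_forall fun r => ?_)
    simp only [polarCoord_symm_eq_circleMap, Complex.real_smul]
    rw [integral_const_mul]
    congr 1
    have hper : Function.Periodic (fun θ => F (circleMap 0 r θ)) (2 * Real.pi) :=
      (periodic_circleMap 0 r).comp F
    have := hper.intervalIntegral_add_eq (-Real.pi) 0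
    rw [zero_add, show -Real.pi + 2 * Real.pi = Real.pi by ring,
      intervalIntegral.integral_of_le (by linarith [Real.pi_pos]),
      integral_Ioc_eq_integral_Ioo] at this
    exact this
  · simp only [polarCoord_symm_eq_circleMap, Complex.real_smul]
    refine ⟨((Complex.measurable_ofReal.comp measurable_fst).mul hm).aestronglyMeasurable, ?_⟩
    have h2 := hi.2
    rw [hasFiniteIntegral_iff_enorm, ← Complex.lintegral_comp_polarCoord_symm,
      polarCoord_target, Measure.volume_eq_prod, ← Measure.prod_restrict] at h2
    rw [hasFiniteIntegral_iff_enorm, Measure.prod_restrict]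
    rw [Measure.prod_restrict] at h2
    refine lt_of_eq_of_lt (setLIntegral_congr_fun (measurableSet_Ioi.prod measurableSet_Ioo) ?_) h2
    intro q hq
    have h0 : (0 : ℝ) ≤ q.1 := le_of_lt hq.1
    simp only [enorm_mul, smul_eq_mul, polarCoord_symm_eq_circleMap]
    congr 1
    rw [← ofReal_norm, Complex.norm_real, Real.norm_of_nonneg h0]

theorem measurableSet_puncturedDisc : MeasurableSet (Metric.ball (0 : ℂ) 1 \ {0}) :=
  Metric.isOpen_ball.measurableSet.diff (measurableSet_singleton 0)

theorem puncturedDisc_ae_eq : (Metric.ball (0 : ℂ) 1 \ {0} : Set ℂ) =ᵐ[volume] Metric.ball 0 1 :=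
  sdiff_null_ae_eq_self (measure_singleton 0)

theorem norm_circleMap_zero_of_nonneg {r : ℝ} (hr : 0 ≤ r) (θ : ℝ) :
    ‖circleMap 0 r θ‖ = r := by simp [abs_of_nonneg hr]

theorem setIntegral_disc_eq_integral_circleMap {F : ℂ → ℂ}
    (hF : ContinuousOn F (Metric.ball 0 1 \ {0})) (hi : IntegrableOn F (Metric.ball 0 1)) :
    ∫ w in Metric.ball (0 : ℂ) 1, F w = ∫ r in Set.Ioo (0 : ℝ) 1, (r : ℂ) *
      ∫ θ in (0 : ℝ)..2 * Real.pi, F (circleMap 0 r θ) := by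
  set G : ℂ → ℂ := (Metric.ball (0 : ℂ) 1 \ {0}).indicator F with hG
  have hGm : Measurable G := by
    classical
    rw [hG, ← Set.piecewise_eq_indicator]
    exact hF.measurable_piecewise continuousOn_const measurableSet_puncturedDisc
  have hGi : Integrable G := by
    rw [hG, integrable_indicator_iff measurableSet_puncturedDisc]
    exact hi.mono_set Set.sdiff_subset
  rw [← setIntegral_congr_set puncturedDisc_ae_eq, ← integral_indicator measurableSet_puncturedDisc,
    integral_eq_integral_circleMap hGm hGi, ← integral_indicator measurableSet_Ioo,
    ← integral_indicator measurableSet_Ioi]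
  refine integral_congr_ae (.of_forall fun r => ?_)
  by_cases h0 : 0 < r
  · by_cases h1 : r < 1
    · rw [Set.indicator_of_mem (show r ∈ Set.Ioi 0 from h0),
        Set.indicator_of_mem (show r ∈ Set.Ioo 0 1 from ⟨h0, h1⟩)]
      congr 1
      refine intervalIntegral.integral_congr fun θ _ => ?_
      exact Set.indicator_of_mem (by simp [abs_of_pos h0, h1, h0.ne']) _
    · rw [Set.indicator_of_mem (show r ∈ Set.Ioi 0 from h0),
        Set.indicator_of_notMem (fun h => h1 h.2)]
      rw [intervalIntegral.integral_congr (g := fun _ => 0)]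
      · simp
      · intro θ _
        exact Set.indicator_of_notMem (by simp [abs_of_pos h0, h1]) _
  · rw [Set.indicator_of_notMem (show r ∉ Set.Ioi 0 from h0),
      Set.indicator_of_notMem (fun h => h0 h.1)]

theorem setLIntegral_disc_eq_lintegral_circleMap {F : ℂ → ℝ≥0∞} (hF : Measurable F) :
    ∫⁻ w in Metric.ball (0 : ℂ) 1, F w = ∫⁻ r in Set.Ioo (0 : ℝ) 1, ENNReal.ofReal r *
      ∫⁻ θ in Set.Ioo (-Real.pi) Real.pi, F (circleMap 0 r θ) := by
  rw [← lintegral_indicator Metric.isOpen_ball.measurableSet,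
    lintegral_eq_lintegral_circleMap (hF.indicator Metric.isOpen_ball.measurableSet),
    ← lintegral_indicator measurableSet_Ioo, ← lintegral_indicator measurableSet_Ioi]
  refine lintegral_congr fun r => ?_
  by_cases h0 : 0 < r
  · by_cases h1 : r < 1
    · rw [Set.indicator_of_mem (show r ∈ Set.Ioi 0 from h0),
        Set.indicator_of_mem (show r ∈ Set.Ioo 0 1 from ⟨h0, h1⟩)]
      congr 1
      refine lintegral_congr fun θ => ?_
      exact Set.indicator_of_mem (by simp [abs_of_pos h0, h1]) _
    · rw [Set.indicator_of_mem (show r ∈ Set.Ioi 0 from h0),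
        Set.indicator_of_notMem (fun h => h1 h.2)]
      rw [lintegral_congr (g := fun _ => 0)]
      · simp
      · intro θ
        exact Set.indicator_of_notMem (by simp [abs_of_pos h0, h1]) _
  · rw [Set.indicator_of_notMem (show r ∉ Set.Ioi 0 from h0),
      Set.indicator_of_notMem (fun h => h0 h.1)]

theorem setLIntegral_disc_radial {φ : ℝ → ℝ≥0∞} (hφ : Measurable φ) :
    ∫⁻ w in Metric.ball (0 : ℂ) 1, φ ‖w‖ =
      ENNReal.ofReal (2 * Real.pi) * ∫⁻ r in Set.Ioo (0 : ℝ) 1, ENNReal.ofReal r * φ r := by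
  rw [setLIntegral_disc_eq_lintegral_circleMap (F := fun w => φ ‖w‖) (hφ.comp measurable_norm),
    ← lintegral_const_mul _ (by fun_prop)]
  refine setLIntegral_congr_fun measurableSet_Ioo fun r hr => ?_
  simp only [norm_circleMap_zero_of_nonneg hr.1.le, lintegral_const,
    Measure.restrict_apply MeasurableSet.univ, Set.univ_inter, Real.volume_Ioo]
  rw [show Real.pi - -Real.pi = 2 * Real.pi by ring]
  ring

/-- The angular integral of a holomorphic function against the Bergman kernel of the disc, from
Cauchy's formula for the derivative of `w ↦ w h(w)` at `z r²`: on `|w| = r` one has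
`conj w = r² / w`. -/
theorem intervalIntegral_circleMap_mul_bergman {h : ℂ → ℂ}
    (hh : DifferentiableOn ℂ h (Metric.ball 0 1)) {z : ℂ} (hz : ‖z‖ < 1) {r : ℝ} (hr : 0 < r)
    (hr1 : r < 1) :
    ∫ θ in (0 : ℝ)..2 * Real.pi, h (circleMap 0 r θ) *
        (1 / (1 - z * starRingEnd ℂ (circleMap 0 r θ)) ^ 2) =
      2 * Real.pi * (h (z * r ^ 2) + z * r ^ 2 * deriv h (z * r ^ 2)) := by
  have hzr : ‖z * (r : ℂ) ^ 2‖ < r := by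
    simp only [norm_mul, norm_pow, Complex.norm_real, Real.norm_of_nonneg hr.le]
    nlinarith [norm_nonneg z, mul_pos hr hr, mul_pos (mul_pos hr hr) hr]
  have hzr1 : ‖z * (r : ℂ) ^ 2‖ < 1 := hzr.trans hr1
  have hd : DifferentiableOn ℂ (fun w => w * h w) (Metric.ball 0 1) := differentiableOn_id.mul hh
  have key := Complex.two_pi_I_inv_smul_circleIntegral_sub_sq_inv_smul_of_differentiable
    Metric.isOpen_ball (Metric.closedBall_subset_ball hr1 : Metric.closedBall (0 : ℂ) r ⊆ _) hd
    (w₀ := z * (r : ℂ) ^ 2) (by simpa using hzr)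
  have hda : DifferentiableAt ℂ h (z * r ^ 2) :=
    hh.differentiableAt (Metric.isOpen_ball.mem_nhds (by simpa using hzr1))
  have hder : deriv (fun w => w * h w) (z * r ^ 2) =
      h (z * r ^ 2) + z * r ^ 2 * deriv h (z * r ^ 2) := by
    simpa using ((hasDerivAt_id' (z * (r : ℂ) ^ 2)).fun_mul hda.hasDerivAt).deriv
  rw [hder] at key
  rw [← key, circleIntegral, smul_eq_mul, ← mul_assoc, ← intervalIntegral.integral_const_mul]
  refine intervalIntegral.integral_congr fun θ _ => ?_
  simp only [deriv_circleMap, smul_eq_mul]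
  set w := circleMap 0 r θ with hw
  have hwn : ‖w‖ = r := norm_circleMap_zero_of_nonneg hr.le θ
  have hw0 : w ≠ 0 := by rw [← norm_pos_iff, hwn]; exact hr
  have hconj : w * starRingEnd ℂ w = (r : ℂ) ^ 2 := by
    rw [Complex.mul_conj, Complex.normSq_eq_norm_sq, hwn]; norm_cast
  have hne : w - z * (r : ℂ) ^ 2 ≠ 0 := by
    intro h0
    rw [sub_eq_zero] at h0
    rw [← h0, hwn] at hzr
    exact lt_irrefl _ hzr
  have hfac : w - z * (r : ℂ) ^ 2 = w * (1 - z * starRingEnd ℂ w) := by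
    rw [← hconj]; ring
  have hne2 : 1 - z * starRingEnd ℂ w ≠ 0 := fun h0 => hne (by rw [hfac, h0, mul_zero])
  have hpi : (Real.pi : ℂ) ≠ 0 := by exact_mod_cast Real.pi_ne_zero
  rw [hfac]
  field_simp [Complex.I_ne_zero]

/-- The Poisson integral `∫ dθ / |1 - z r e^{-iθ}|² = 2π / (1 - |z|² r²)`. -/
theorem intervalIntegral_circleMap_poisson {z : ℂ} (hz : ‖z‖ < 1) {r : ℝ} (hr : 0 < r)
    (hr1 : r < 1) :
    ∫ θ in (0 : ℝ)..2 * Real.pi, 1 / ‖1 - z * starRingEnd ℂ (circleMap 0 r θ)‖ ^ 2 =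
      2 * Real.pi / (1 - ‖z‖ ^ 2 * r ^ 2) := by
  have hzr : ‖z * (r : ℂ) ^ 2‖ < r := by
    simp only [norm_mul, norm_pow, Complex.norm_real, Real.norm_of_nonneg hr.le]
    nlinarith [norm_nonneg z, mul_pos hr hr, mul_pos (mul_pos hr hr) hr]
  have hne1 : ∀ w : ℂ, ‖w‖ ≤ r → 1 - starRingEnd ℂ z * w ≠ 0 := by
    intro w hw h0
    have : ‖starRingEnd ℂ z * w‖ = 1 := by
      rw [sub_eq_zero] at h0; rw [← h0]; simp
    rw [norm_mul, Complex.norm_conj] at this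
    nlinarith [norm_nonneg z, norm_nonneg w]
  have hd : DifferentiableOn ℂ (fun w => (1 - starRingEnd ℂ z * w)⁻¹) (Metric.closedBall 0 r) := by
    intro w hw
    have h1 : DifferentiableAt ℂ (fun w => 1 - starRingEnd ℂ z * w) w := by fun_prop
    exact (h1.fun_inv (hne1 w (by simpa using hw))).differentiableWithinAt
  have key := hd.circleIntegral_sub_inv_smul (w := z * (r : ℂ) ^ 2) (by simpa using hzr)
  have hI : (2 * Real.pi * Complex.I : ℂ) ≠ 0 := by simp [Real.pi_ne_zero]
  have hcast : ((∫ θ in (0 : ℝ)..2 * Real.pi,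
      1 / ‖1 - z * starRingEnd ℂ (circleMap 0 r θ)‖ ^ 2 : ℝ) : ℂ) =
      ((2 * Real.pi / (1 - ‖z‖ ^ 2 * r ^ 2) : ℝ) : ℂ) := by
    rw [← intervalIntegral.integral_ofReal]
    have hval : (1 - starRingEnd ℂ z * (z * (r : ℂ) ^ 2)) = ((1 - ‖z‖ ^ 2 * r ^ 2 : ℝ) : ℂ) := by
      rw [← mul_assoc, mul_comm (starRingEnd ℂ z) z, Complex.mul_conj,
        Complex.normSq_eq_norm_sq]
      push_cast; ring
    rw [hval, circleIntegral, smul_eq_mul] at key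
    have h2 : (∫ θ in (0 : ℝ)..2 * Real.pi,
        ((1 / ‖1 - z * starRingEnd ℂ (circleMap 0 r θ)‖ ^ 2 : ℝ) : ℂ)) =
        Complex.I⁻¹ * ∫ θ in (0 : ℝ)..2 * Real.pi, deriv (circleMap 0 r) θ •
          ((circleMap 0 r θ - z * (r : ℂ) ^ 2)⁻¹ •
            (1 - starRingEnd ℂ z * circleMap 0 r θ)⁻¹) := by
      rw [← intervalIntegral.integral_const_mul]
      refine intervalIntegral.integral_congr fun θ _ => ?_
      simp only [deriv_circleMap, smul_eq_mul]
      set w := circleMap 0 r θ with hw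
      have hwn : ‖w‖ = r := norm_circleMap_zero_of_nonneg hr.le θ
      have hw0 : w ≠ 0 := by rw [← norm_pos_iff, hwn]; exact hr
      have hconj : w * starRingEnd ℂ w = (r : ℂ) ^ 2 := by
        rw [Complex.mul_conj, Complex.normSq_eq_norm_sq, hwn]; norm_cast
      have hfac : w - z * (r : ℂ) ^ 2 = w * (1 - z * starRingEnd ℂ w) := by
        rw [← hconj]; ring
      have hn : ((‖1 - z * starRingEnd ℂ w‖ ^ 2 : ℝ) : ℂ) =
          (1 - z * starRingEnd ℂ w) * (1 - starRingEnd ℂ z * w) := by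
        rw [← Complex.normSq_eq_norm_sq, ← Complex.mul_conj]
        simp
      have hne2 := hne1 w hwn.le
      have hne3 : 1 - z * starRingEnd ℂ w ≠ 0 := by
        intro h0
        apply hne2
        have := congrArg (starRingEnd ℂ) h0
        simpa using this
      rw [Complex.ofReal_div, hn, hfac, Complex.ofReal_one]
      field_simp [Complex.I_ne_zero]
    rw [h2, key]
    push_cast
    field_simp [Complex.I_ne_zero]
  exact_mod_cast hcast

/-! ### The Bergman kernel of the disc -/

theorem one_sub_norm_le_norm_one_sub_mul_conj (z : ℂ) {w : ℂ} (hw : ‖w‖ ≤ 1) :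
    1 - ‖z‖ ≤ ‖1 - z * starRingEnd ℂ w‖ := by
  have h1 := norm_sub_norm_le (1 : ℂ) (z * starRingEnd ℂ w)
  rw [norm_one, norm_mul, Complex.norm_conj] at h1
  nlinarith [norm_nonneg z, norm_nonneg w]

theorem one_sub_mul_conj_ne_zero {z w : ℂ} (hz : ‖z‖ < 1) (hw : ‖w‖ ≤ 1) :
    1 - z * starRingEnd ℂ w ≠ 0 := by
  rw [← norm_pos_iff]
  linarith [one_sub_norm_le_norm_one_sub_mul_conj z hw]

theorem norm_discBergman_le {z w : ℂ} (hz : ‖z‖ < 1) (hw : ‖w‖ ≤ 1) :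
    ‖1 / (1 - z * starRingEnd ℂ w) ^ 2‖ ≤ 1 / (1 - ‖z‖) ^ 2 := by
  rw [norm_div, norm_one, norm_pow]
  have h := one_sub_norm_le_norm_one_sub_mul_conj z hw
  have h0 : 0 < 1 - ‖z‖ := by linarith
  gcongr

@[fun_prop]
theorem measurable_discBergman (z : ℂ) :
    Measurable fun w : ℂ => 1 / (1 - z * starRingEnd ℂ w) ^ 2 := by
  have := Complex.continuous_conj.measurable
  fun_prop

theorem integrable_mul_discBergman {μ : Measure ℂ} (hμ : ∀ᵐ w ∂μ, ‖w‖ ≤ 1) {h : ℂ → ℂ}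
    (hi : Integrable h μ) {z : ℂ} (hz : ‖z‖ < 1) :
    Integrable (fun w => h w * (1 / (1 - z * starRingEnd ℂ w) ^ 2)) μ := by
  refine hi.mul_bdd (c := 1 / (1 - ‖z‖) ^ 2) (measurable_discBergman z).aestronglyMeasurable ?_
  filter_upwards [hμ] with w hw using norm_discBergman_le hz hw

theorem ae_norm_le_one_disc : ∀ᵐ w ∂volume.restrict (Metric.ball (0 : ℂ) 1), ‖w‖ ≤ 1 := by
  filter_upwards [ae_restrict_mem Metric.isOpen_ball.measurableSet] with w hw
  exact (mem_ball_zero_iff.1 hw).le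

/-- The Bergman kernel of the unit disc reproduces integrable holomorphic functions. -/
theorem setIntegral_disc_mul_bergman {h : ℂ → ℂ}
    (hh : DifferentiableOn ℂ h (Metric.ball 0 1)) (hi : IntegrableOn h (Metric.ball 0 1))
    {z : ℂ} (hz : ‖z‖ < 1) :
    ∫ w in Metric.ball (0 : ℂ) 1, h w * (1 / (1 - z * starRingEnd ℂ w) ^ 2) =
      Real.pi * h z := by
  have hcont : ContinuousOn (fun w => h w * (1 / (1 - z * starRingEnd ℂ w) ^ 2))
      (Metric.ball 0 1 \ {0}) := by
    refine (hh.continuousOn.mul ?_).mono Set.sdiff_subset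
    refine continuousOn_const.div ?_ fun w hw =>
      pow_ne_zero 2 (one_sub_mul_conj_ne_zero hz (mem_ball_zero_iff.1 hw).le)
    exact ((continuous_const.sub (continuous_const.mul Complex.continuous_conj)).pow 2).continuousOn
  rw [setIntegral_disc_eq_integral_circleMap hcont
    (integrable_mul_discBergman ae_norm_le_one_disc hi hz)]
  have hstep : ∫ r in Set.Ioo (0 : ℝ) 1, (r : ℂ) * ∫ θ in (0 : ℝ)..2 * Real.pi,
      h (circleMap 0 r θ) * (1 / (1 - z * starRingEnd ℂ (circleMap 0 r θ)) ^ 2) =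
      ∫ r in (0 : ℝ)..1, (r : ℂ) *
        (2 * Real.pi * (h (z * r ^ 2) + z * r ^ 2 * deriv h (z * r ^ 2))) := by
    rw [intervalIntegral.integral_of_le zero_le_one, integral_Ioc_eq_integral_Ioo]
    refine setIntegral_congr_fun measurableSet_Ioo fun r hr => ?_
    simp only [intervalIntegral_circleMap_mul_bergman hh hz hr.1 hr.2]
  rw [hstep]
  have hmem : ∀ r ∈ Set.uIcc (0 : ℝ) 1, z * (r : ℂ) ^ 2 ∈ Metric.ball (0 : ℂ) 1 := by
    intro r hr
    rw [Set.uIcc_of_le zero_le_one] at hr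
    simp only [mem_ball_zero_iff, norm_mul, norm_pow, Complex.norm_real,
      Real.norm_of_nonneg hr.1]
    have : r ^ 2 ≤ 1 := pow_le_one₀ hr.1 hr.2
    nlinarith [norm_nonneg z]
  rw [intervalIntegral.integral_eq_sub_of_hasDerivAt
    (f := fun r : ℝ => (Real.pi : ℂ) * ((r : ℂ) ^ 2 * h (z * (r : ℂ) ^ 2)))]
  · simp
  · intro r hr
    have hda := (hh.differentiableAt (Metric.isOpen_ball.mem_nhds (hmem r hr))).hasDerivAt
    have hq : HasDerivAt (fun x : ℂ => z * x ^ 2) (z * (2 * (r : ℂ))) (r : ℂ) := by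
      simpa using (hasDerivAt_pow 2 (r : ℂ)).const_mul z
    have h1 := (((hasDerivAt_pow 2 (r : ℂ)).fun_mul (HasDerivAt.comp (r : ℂ) hda hq)).const_mul
      (Real.pi : ℂ)).comp_ofReal
    simp only [Function.comp_def] at h1
    convert! h1 using 1
    push_cast
    ring
  · refine ContinuousOn.intervalIntegrable ?_
    have hγ : ContinuousOn (fun r : ℝ => z * (r : ℂ) ^ 2) (Set.uIcc 0 1) := by fun_prop
    have c1 := hh.continuousOn.comp hγ hmem
    have c2 := (hh.deriv Metric.isOpen_ball).continuousOn.comp hγ hmem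
    have c3 : ContinuousOn (fun r : ℝ => (r : ℂ)) (Set.uIcc 0 1) := by fun_prop
    exact c3.mul (continuousOn_const.mul (c1.add (hγ.mul c2)))

/-- Evaluation at a point is bounded on integrable holomorphic functions of the disc. -/
theorem norm_le_setIntegral_disc {h : ℂ → ℂ}
    (hh : DifferentiableOn ℂ h (Metric.ball 0 1)) (hi : IntegrableOn h (Metric.ball 0 1))
    {z : ℂ} (hz : ‖z‖ < 1) :
    ‖h z‖ ≤ 1 / (1 - ‖z‖) ^ 2 * ∫ w in Metric.ball (0 : ℂ) 1, ‖h w‖ := by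
  have h1 : Real.pi * ‖h z‖ ≤ 1 / (1 - ‖z‖) ^ 2 * ∫ w in Metric.ball (0 : ℂ) 1, ‖h w‖ := by
    rw [← integral_const_mul]
    have h2 : Real.pi * ‖h z‖ = ‖∫ w in Metric.ball (0 : ℂ) 1,
        h w * (1 / (1 - z * starRingEnd ℂ w) ^ 2)‖ := by
      rw [setIntegral_disc_mul_bergman hh hi hz, norm_mul, Complex.norm_real,
        Real.norm_of_nonneg Real.pi_pos.le]
    rw [h2]
    refine norm_integral_le_of_norm_le (hi.norm.const_mul _) ?_
    filter_upwards [ae_norm_le_one_disc] with w hw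
    rw [norm_mul, mul_comm]
    gcongr
    exact norm_discBergman_le hz hw
  have h3 := Real.two_le_pi
  nlinarith [norm_nonneg (h z)]

/-- A square integrable holomorphic function on the punctured disc is `o(1/z)` at `0`: the value
of `h²` at `z` is at most a multiple of its mean over the disc of radius `|z|` about `z`. -/
theorem tendsto_sq_norm_mul_of_integrableOn_sq {h : ℂ → ℂ}
    (hh : DifferentiableOn ℂ h (Metric.ball 0 1 \ {0}))
    (hi : IntegrableOn (fun w => h w ^ 2) (Metric.ball 0 1)) :
    Filter.Tendsto (fun z => ‖z‖ ^ 2 * ‖h z‖ ^ 2) (nhdsWithin 0 {0}ᶜ) (nhds 0) := by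
  have hin : IntegrableOn (fun w => ‖h w ^ 2‖) (Metric.ball 0 1) := hi.norm
  have hlim : Filter.Tendsto (fun z : ℂ => ∫ w in Metric.ball (0 : ℂ) (2 * ‖z‖),
      ‖h w ^ 2‖ ∂volume.restrict (Metric.ball 0 1)) (nhdsWithin 0 {0}ᶜ) (nhds 0) := by
    refine hi.norm.tendsto_setIntegral_nhds_zero ?_
    have hv : Filter.Tendsto (fun z : ℂ => ENNReal.ofReal (2 * ‖z‖) ^ 2 * NNReal.pi)
        (nhds 0) (nhds 0) := by
      have : Continuous fun z : ℂ => ENNReal.ofReal (2 * ‖z‖) ^ 2 * NNReal.pi :=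
        ENNReal.continuous_mul_const ENNReal.coe_ne_top |>.comp
          ((ENNReal.continuous_pow 2).comp (ENNReal.continuous_ofReal.comp (by fun_prop)))
      simpa using this.tendsto 0
    refine tendsto_of_tendsto_of_tendsto_of_le_of_le tendsto_const_nhds
      (hv.mono_left nhdsWithin_le_nhds) (fun _ => zero_le) fun z => ?_
    exact (Measure.restrict_apply_le _ _).trans (Complex.volume_ball _ _).le
  refine tendsto_of_tendsto_of_tendsto_of_le_of_le' tendsto_const_nhds hlim
    (.of_forall fun z => by positivity) ?_
  have hev : ∀ᶠ z : ℂ in nhdsWithin 0 {0}ᶜ, z ∈ Metric.ball (0 : ℂ) (1 / 2) ∧ z ≠ 0 :=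
    Filter.Eventually.and (mem_nhdsWithin_of_mem_nhds (Metric.ball_mem_nhds 0 (by norm_num)))
      self_mem_nhdsWithin
  filter_upwards [hev] with z hz
  obtain ⟨hz1, hz0⟩ := hz
  rw [mem_ball_zero_iff] at hz1
  have hzp : 0 < ‖z‖ := norm_pos_iff.mpr hz0
  set g : ℂ → ℂ := fun ξ => h (z + ‖z‖ • ξ) ^ 2 with hg
  have hmaps : ∀ ξ ∈ Metric.ball (0 : ℂ) 1, z + ‖z‖ • ξ ∈ Metric.ball (0 : ℂ) (2 * ‖z‖) ∧
      z + ‖z‖ • ξ ≠ 0 := by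
    intro ξ hξ
    rw [mem_ball_zero_iff] at hξ
    have h1 : ‖‖z‖ • ξ‖ < ‖z‖ := by rw [norm_smul, norm_norm]; nlinarith
    refine ⟨?_, fun h0 => ?_⟩
    · rw [mem_ball_zero_iff]
      linarith [norm_add_le z (‖z‖ • ξ)]
    · have : z = -(‖z‖ • ξ) := eq_neg_of_add_eq_zero_left h0
      have h2 := congrArg norm this
      rw [norm_neg] at h2
      exact absurd h2 h1.ne'
  have hsub : Metric.ball (0 : ℂ) (2 * ‖z‖) ⊆ Metric.ball 0 1 :=
    Metric.ball_subset_ball (by linarith)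
  have hgd : DifferentiableOn ℂ g (Metric.ball 0 1) := by
    refine DifferentiableOn.pow (hh.comp (t := Metric.ball 0 1 \ {0})
      (f := fun ξ : ℂ => z + ‖z‖ • ξ) ?_ ?_) 2
    · have : Differentiable ℂ fun ξ : ℂ => z + ‖z‖ • ξ := by
        simp only [Complex.real_smul]; fun_prop
      exact this.differentiableOn
    · exact fun ξ hξ => ⟨hsub (hmaps ξ hξ).1, (hmaps ξ hξ).2⟩
  set S := (fun ξ : ℂ => z + ‖z‖ • ξ) with hS
  -- the affine substitution, for functions cut off to the disc of radius `|z|` about `z`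
  have hpre : ∀ (F : ℂ → ℝ) ξ, (Metric.ball (0 : ℂ) 1).indicator (fun ξ => F (S ξ)) ξ =
      (Metric.ball z ‖z‖).indicator F (z + ‖z‖ • ξ) := by
    intro F ξ
    have hiff : ξ ∈ Metric.ball (0 : ℂ) 1 ↔ z + ‖z‖ • ξ ∈ Metric.ball z ‖z‖ := by
      rw [mem_ball_zero_iff, mem_ball_iff_norm, add_sub_cancel_left, norm_smul, norm_norm]
      constructor
      · intro h; nlinarith
      · intro h; by_contra hc; nlinarith
    by_cases hξ : ξ ∈ Metric.ball (0 : ℂ) 1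
    · rw [Set.indicator_of_mem hξ, Set.indicator_of_mem (hiff.1 hξ)]
    · rw [Set.indicator_of_notMem hξ, Set.indicator_of_notMem (fun h => hξ (hiff.2 h))]
  have hbz : Metric.ball z ‖z‖ ⊆ Metric.ball 0 (2 * ‖z‖) := by
    intro w hw
    rw [mem_ball_iff_norm] at hw
    rw [mem_ball_zero_iff]
    have := norm_add_le (w - z) z
    rw [sub_add_cancel] at this
    linarith
  have hFi : Integrable ((Metric.ball z ‖z‖).indicator fun w => ‖h w ^ 2‖) := by
    rw [integrable_indicator_iff Metric.isOpen_ball.measurableSet]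
    exact hin.mono_set (hbz.trans hsub)
  have hgi : IntegrableOn g (Metric.ball 0 1) := by
    have h2 : IntegrableOn (fun ξ => ‖g ξ‖) (Metric.ball 0 1) := by
      rw [← integrable_indicator_iff Metric.isOpen_ball.measurableSet]
      have := (hFi.comp_add_left z).comp_smul hzp.ne'
      exact this.congr (.of_forall fun ξ => (hpre (fun w => ‖h w ^ 2‖) ξ).symm)
    refine (integrable_norm_iff ?_).1 h2
    exact hgd.continuousOn.aestronglyMeasurable Metric.isOpen_ball.measurableSet
  have h3 := norm_le_setIntegral_disc hgd hgi (z := 0) (by simp)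
  have h4 : ∫ ξ in Metric.ball (0 : ℂ) 1, ‖g ξ‖ =
      (‖z‖ ^ 2)⁻¹ * ∫ w in Metric.ball z ‖z‖, ‖h w ^ 2‖ := by
    rw [← integral_indicator Metric.isOpen_ball.measurableSet,
      ← integral_indicator Metric.isOpen_ball.measurableSet]
    rw [integral_congr_ae (.of_forall fun ξ => hpre (fun w => ‖h w ^ 2‖) ξ)]
    rw [Measure.integral_comp_smul volume
      (fun ξ => (Metric.ball z ‖z‖).indicator (fun w => ‖h w ^ 2‖) (z + ξ)) ‖z‖]
    rw [integral_add_left_eq_self (μ := volume)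
      (fun ξ => (Metric.ball z ‖z‖).indicator (fun w => ‖h w ^ 2‖) ξ) z]
    simp [Complex.finrank_real_complex]
  have h5 : ∫ w in Metric.ball z ‖z‖, ‖h w ^ 2‖ ≤ ∫ w in Metric.ball (0 : ℂ) (2 * ‖z‖),
      ‖h w ^ 2‖ ∂volume.restrict (Metric.ball 0 1) := by
    rw [Measure.restrict_restrict Metric.isOpen_ball.measurableSet,
      Set.inter_eq_self_of_subset_left hsub]
    exact setIntegral_mono_set (hin.mono_set hsub) (.of_forall fun w => norm_nonneg _)
      (.of_forall hbz)
  refine le_trans ?_ h5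
  rw [h4] at h3
  simp only [hg, norm_zero, sub_zero, one_pow, div_one, one_mul, smul_zero, add_zero] at h3
  rw [norm_pow] at h3
  calc ‖z‖ ^ 2 * ‖h z‖ ^ 2 ≤ ‖z‖ ^ 2 * ((‖z‖ ^ 2)⁻¹ * ∫ w in Metric.ball z ‖z‖, ‖h w ^ 2‖) := by
        gcongr
    _ = _ := by field_simp

/-- The Bergman kernel of the disc also reproduces square integrable holomorphic functions on the
punctured disc, since their singularity at the puncture is removable. -/
theorem setIntegral_puncturedDisc_mul_bergman {h : ℂ → ℂ}
    (hh : DifferentiableOn ℂ h (Metric.ball 0 1 \ {0}))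
    (hi : IntegrableOn (fun w => h w ^ 2) (Metric.ball 0 1))
    {z : ℂ} (hz : ‖z‖ < 1) (hz0 : z ≠ 0) :
    ∫ w in Metric.ball (0 : ℂ) 1, h w * (1 / (1 - z * starRingEnd ℂ w) ^ 2) =
      Real.pi * h z := by
  classical
  have hlim := tendsto_sq_norm_mul_of_integrableOn_sq hh hi
  set F := Function.update h 0 ((nhdsWithin 0 {0}ᶜ).limUnder h) with hF
  have hFd : DifferentiableOn ℂ F (Metric.ball 0 1) := by
    refine Complex.differentiableOn_update_limUnder_of_isLittleO
      (Metric.ball_mem_nhds 0 one_pos) hh ?_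
    have h1 : h =o[nhdsWithin 0 {0}ᶜ] fun z : ℂ => (z - 0)⁻¹ := by
      rw [Asymptotics.isLittleO_iff_tendsto']
      · rw [tendsto_zero_iff_norm_tendsto_zero]
        have h2 := (Real.continuous_sqrt.tendsto 0).comp hlim
        rw [Real.sqrt_zero] at h2
        refine h2.congr fun w => ?_
        simp only [Function.comp_def, ← mul_pow, sub_zero, div_inv_eq_mul, norm_mul]
        rw [Real.sqrt_sq (by positivity), mul_comm]
      · filter_upwards [self_mem_nhdsWithin] with w hw h0
        simp at h0
        exact absurd h0 hw
    refine h1.sub ?_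
    rw [Asymptotics.isLittleO_const_left]
    right
    simp only [sub_zero, Function.comp_def, norm_inv]
    exact tendsto_norm_nhdsNE_zero.inv_tendsto_nhdsGT_zero
  have hae : F =ᵐ[volume.restrict (Metric.ball 0 1)] h := by
    have : ∀ᵐ w ∂volume.restrict (Metric.ball (0 : ℂ) 1), w ≠ 0 :=
      ae_restrict_of_ae (by simp [ae_iff])
    filter_upwards [this] with w hw
    simp [hF, hw]
  have hFi : IntegrableOn F (Metric.ball 0 1) := by
    have hm : AEStronglyMeasurable F (volume.restrict (Metric.ball 0 1)) :=
      (hFd.continuousOn).aestronglyMeasurable Metric.isOpen_ball.measurableSet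
    have hb : IntegrableOn (fun w => 1 + ‖h w ^ 2‖) (Metric.ball 0 1) :=
      (integrableOn_const (by simp [Complex.volume_ball])).add hi.norm
    refine Integrable.mono' hb hm ?_
    filter_upwards [hae] with w hw
    rw [hw, norm_pow]
    nlinarith [sq_nonneg (‖h w‖ - 1)]
  have h1 := setIntegral_disc_mul_bergman hFd hFi hz
  rw [show F z = h z by simp [hF, hz0]] at h1
  rw [← h1]
  refine integral_congr_ae ?_
  filter_upwards [hae] with w hw
  rw [hw]

/-! ### Power weights and Forelli–Rudin integrals on the disc -/

theorem setLIntegral_disc_rpow (s : ℝ) :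
    ∫⁻ w in Metric.ball (0 : ℂ) 1, ENNReal.ofReal (‖w‖ ^ s) =
      ENNReal.ofReal (2 * Real.pi) *
        ∫⁻ r in Set.Ioo (0 : ℝ) 1, ENNReal.ofReal (r ^ (s + 1)) := by
  rw [setLIntegral_disc_radial (φ := fun r => ENNReal.ofReal (r ^ s)) (by fun_prop)]
  congr 1
  refine setLIntegral_congr_fun measurableSet_Ioo fun r hr => ?_
  rw [← ENNReal.ofReal_mul hr.1.le, Real.rpow_add_one hr.1.ne', mul_comm]

theorem setLIntegral_Ioo_rpow_lt_top_iff {s : ℝ} :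
    ∫⁻ r in Set.Ioo (0 : ℝ) 1, ENNReal.ofReal (r ^ s) < ⊤ ↔ -1 < s := by
  rw [← intervalIntegral.integrableOn_Ioo_rpow_iff one_pos, IntegrableOn,
    lt_top_iff_ne_top, lintegral_ofReal_ne_top_iff_integrable]
  · exact (Measurable.aestronglyMeasurable (by fun_prop))
  · filter_upwards [ae_restrict_mem measurableSet_Ioo] with r hr using Real.rpow_nonneg hr.1.le s

theorem setLIntegral_disc_rpow_lt_top_iff {s : ℝ} :
    ∫⁻ w in Metric.ball (0 : ℂ) 1, ENNReal.ofReal (‖w‖ ^ s) < ⊤ ↔ -2 < s := by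
  have hpi : (0 : ℝ) < 2 * Real.pi := by positivity
  rw [setLIntegral_disc_rpow, ENNReal.mul_lt_top_iff, setLIntegral_Ioo_rpow_lt_top_iff]
  constructor
  · rintro (h | h | h)
    · linarith [h.2]
    · exact absurd (ENNReal.ofReal_eq_zero.1 h) (not_le.2 hpi)
    · have h1 := setLIntegral_Ioo_rpow_lt_top_iff.1 (h.trans_lt ENNReal.zero_lt_top)
      linarith
  · intro h
    exact Or.inl ⟨ENNReal.ofReal_lt_top, by linarith⟩

/-- The model integral behind the Forelli–Rudin estimate. The two ranges `y < δ` and `δ ≤ y`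
contribute `δ^{-ε} / (1 - ε)` and `δ^{-ε} / ε`. -/
theorem setLIntegral_Ioo_rpow_div_max_le {ε : ℝ} (h0 : 0 < ε) (h1 : ε < 1) {δ : ℝ} (hδ : 0 < δ) :
    ∫⁻ y in Set.Ioo (0 : ℝ) 1, ENNReal.ofReal (y ^ (-ε) / max y δ) ≤
      ENNReal.ofReal ((1 / (1 - ε) + 1 / ε) * δ ^ (-ε)) := by
  have hsub : Set.Ioo (0 : ℝ) 1 ⊆ Set.Ioc 0 δ ∪ Set.Ioi δ := by
    intro y hy
    rcases le_or_gt y δ with h | h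
    · exact Or.inl ⟨hy.1, h⟩
    · exact Or.inr h
  refine (lintegral_mono_set hsub).trans ((lintegral_union_le _ _ _).trans ?_)
  have e1 : ∫⁻ y in Set.Ioc 0 δ, ENNReal.ofReal (y ^ (-ε) / max y δ) ≤
      ENNReal.ofReal (1 / (1 - ε) * δ ^ (-ε)) := by
    have hint : IntegrableOn (fun y : ℝ => y ^ (-ε) / δ) (Set.Ioc 0 δ) := by
      rw [← intervalIntegrable_iff_integrableOn_Ioc_of_le hδ.le]
      exact (intervalIntegral.intervalIntegrable_rpow' (by linarith)).div_const δ
    have hval : ∫ y in Set.Ioc 0 δ, y ^ (-ε) / δ = 1 / (1 - ε) * δ ^ (-ε) := by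
      rw [← intervalIntegral.integral_of_le hδ.le, intervalIntegral.integral_div,
        integral_rpow (Or.inl (by linarith)), Real.zero_rpow (by linarith),
        Real.rpow_add_one hδ.ne']
      have : (-ε + 1) ≠ 0 := by linarith
      have h3 : 1 - ε ≠ 0 := by linarith
      field_simp
      ring
    rw [← hval, ofReal_integral_eq_lintegral_ofReal hint]
    · refine setLIntegral_mono (by fun_prop) fun y hy => ?_
      refine ENNReal.ofReal_le_ofReal ?_
      have : 0 ≤ y ^ (-ε) := Real.rpow_nonneg hy.1.le _
      gcongr
      exact le_max_right _ _
    · filter_upwards [ae_restrict_mem measurableSet_Ioc] with y hy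
      exact div_nonneg (Real.rpow_nonneg hy.1.le _) hδ.le
  have e2 : ∫⁻ y in Set.Ioi δ, ENNReal.ofReal (y ^ (-ε) / max y δ) ≤
      ENNReal.ofReal (1 / ε * δ ^ (-ε)) := by
    have hint := integrableOn_Ioi_rpow_of_lt (show -ε - 1 < -1 by linarith) hδ
    have hval := integral_Ioi_rpow_of_lt (show -ε - 1 < -1 by linarith) hδ
    have hval' : ∫ y in Set.Ioi δ, y ^ (-ε - 1) = 1 / ε * δ ^ (-ε) := by
      rw [hval, sub_add_cancel]
      field_simp
    rw [← hval', ofReal_integral_eq_lintegral_ofReal hint]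
    · refine setLIntegral_mono (by fun_prop) fun y hy => ?_
      have hy' : δ < y := hy
      have hy0 : 0 < y := hδ.trans hy'
      rw [max_eq_left hy'.le, Real.rpow_sub_one hy0.ne']
    · filter_upwards [ae_restrict_mem measurableSet_Ioi] with y hy
      exact Real.rpow_nonneg (hδ.trans hy).le _
  have h2 : 0 ≤ 1 / (1 - ε) * δ ^ (-ε) := by
    have : 0 < 1 - ε := by linarith
    positivity
  rw [add_mul, ENNReal.ofReal_add h2 (by positivity)]
  exact add_le_add e1 e2

theorem setLIntegral_Ioo_one_sub (g : ℝ → ℝ≥0∞) :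
    ∫⁻ r in Set.Ioo (0 : ℝ) 1, g (1 - r) = ∫⁻ r in Set.Ioo (0 : ℝ) 1, g r := by
  rw [← lintegral_indicator measurableSet_Ioo, ← lintegral_indicator measurableSet_Ioo,
    ← lintegral_sub_left_eq_self _ (1 : ℝ)]
  refine lintegral_congr fun r => ?_
  have hiff : r ∈ Set.Ioo (0 : ℝ) 1 ↔ 1 - r ∈ Set.Ioo (0 : ℝ) 1 := by
    simp only [Set.mem_Ioo]
    constructor <;> intro h <;> constructor <;> linarith [h.1, h.2]
  by_cases hr : r ∈ Set.Ioo (0 : ℝ) 1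
  · rw [Set.indicator_of_mem hr, Set.indicator_of_mem (hiff.1 hr), sub_sub_cancel]
  · rw [Set.indicator_of_notMem hr, Set.indicator_of_notMem (fun h => hr (hiff.2 h))]

/-- The pointwise estimate behind the Forelli–Rudin estimate: the weight is singular at `0` and at
`1`, and the two summands dominate it on the two halves of the interval. -/
theorem radial_weight_le {ε β : ℝ} (h0 : 0 < ε) (h1 : ε < 1) (hβ : β < 2) {c : ℝ}
    (hc0 : 0 ≤ c) (hc : c < 1) {r : ℝ} (hr : r ∈ Set.Ioo (0 : ℝ) 1) :
    r * (r ^ (-β) * (1 - r ^ 2) ^ (-ε) / (1 - c ^ 2 * r ^ 2)) ≤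
      4 * r ^ (1 - β) + 2 * ((1 - r) ^ (-ε) / max (1 - r) (1 - c)) := by
  obtain ⟨hr0, hr1⟩ := hr
  have hrr : r * r ^ (-β) = r ^ (1 - β) := by
    rw [sub_eq_add_neg, add_comm, Real.rpow_add_one hr0.ne', mul_comm]
  have hy : 0 < 1 - r := by linarith
  have hδ : 0 < 1 - c := by linarith
  have hden : max (1 - r) (1 - c) ≤ 1 - c ^ 2 * r ^ 2 := by
    refine max_le ?_ ?_
    · have : c ^ 2 * r ^ 2 ≤ 1 * r := by
        refine mul_le_mul (by nlinarith) (by nlinarith) (by positivity) zero_le_one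
      linarith
    · have : c ^ 2 * r ^ 2 ≤ c * 1 := by
        refine mul_le_mul (by nlinarith) (by nlinarith) (by positivity) hc0
      linarith
  have hmax : 0 < max (1 - r) (1 - c) := lt_of_lt_of_le hy (le_max_left _ _)
  have hwt : (1 - r ^ 2) ^ (-ε) ≤ (1 - r) ^ (-ε) :=
    Real.rpow_le_rpow_of_nonpos hy (by nlinarith) (by linarith)
  have hP : 0 < r ^ (1 - β) := Real.rpow_pos_of_pos hr0 _
  have hQ : 0 < (1 - r) ^ (-ε) := Real.rpow_pos_of_pos hy _
  have hmain : r * (r ^ (-β) * (1 - r ^ 2) ^ (-ε) / (1 - c ^ 2 * r ^ 2)) ≤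
      r ^ (1 - β) * ((1 - r) ^ (-ε) / max (1 - r) (1 - c)) := by
    rw [← hrr, mul_assoc, mul_div_assoc]
    gcongr
  refine hmain.trans ?_
  have hR : 0 < (1 - r) ^ (-ε) / max (1 - r) (1 - c) := by positivity
  rcases le_total r (1 / 2) with h | h
  · have hy2 : 1 / 2 ≤ 1 - r := by linarith
    have e1 : (1 - r) ^ (-ε) ≤ 2 := by
      calc (1 - r) ^ (-ε) ≤ (1 / 2 : ℝ) ^ (-ε) :=
            Real.rpow_le_rpow_of_nonpos (by norm_num) hy2 (by linarith)
        _ ≤ (1 / 2 : ℝ) ^ (-1 : ℝ) :=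
            Real.rpow_le_rpow_of_exponent_ge (by norm_num) (by norm_num) (by linarith)
        _ = 2 := by rw [Real.rpow_neg_one]; norm_num
    have e2 : (1 - r) ^ (-ε) / max (1 - r) (1 - c) ≤ 4 := by
      rw [div_le_iff₀ hmax]
      have := le_max_left (1 - r) (1 - c)
      linarith
    nlinarith
  · have e1 : r ^ (1 - β) ≤ 2 := by
      calc r ^ (1 - β) ≤ r ^ (-1 : ℝ) :=
            Real.rpow_le_rpow_of_exponent_ge hr0 hr1.le (by linarith)
        _ ≤ 2 := by
            rw [Real.rpow_neg_one, inv_le_comm₀ hr0 (by norm_num)]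
            linarith
    nlinarith

theorem setLIntegral_circleMap_poisson {z : ℂ} (hz : ‖z‖ < 1) {r : ℝ} (hr : 0 < r)
    (hr1 : r < 1) :
    ∫⁻ θ in Set.Ioo (-Real.pi) Real.pi,
      ENNReal.ofReal (1 / ‖1 - z * starRingEnd ℂ (circleMap 0 r θ)‖ ^ 2) =
      ENNReal.ofReal (2 * Real.pi / (1 - ‖z‖ ^ 2 * r ^ 2)) := by
  have hcont : Continuous fun θ => 1 / ‖1 - z * starRingEnd ℂ (circleMap 0 r θ)‖ ^ 2 := by
    have hc : Continuous fun θ => starRingEnd ℂ (circleMap 0 r θ) :=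
      Complex.continuous_conj.comp (continuous_circleMap 0 r)
    refine continuous_const.div ((continuous_const.sub (continuous_const.mul hc)).norm.pow 2)
      fun θ => pow_ne_zero 2 (norm_ne_zero_iff.2 (one_sub_mul_conj_ne_zero hz ?_))
    rw [norm_circleMap_zero_of_nonneg hr.le]
    exact hr1.le
  have hper : Function.Periodic (fun θ => 1 / ‖1 - z * starRingEnd ℂ (circleMap 0 r θ)‖ ^ 2)
      (2 * Real.pi) :=
    (periodic_circleMap 0 r).comp (fun w => 1 / ‖1 - z * starRingEnd ℂ w‖ ^ 2)
  have h1 := hper.intervalIntegral_add_eq (-Real.pi) 0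
  rw [zero_add, intervalIntegral_circleMap_poisson hz hr hr1,
    show -Real.pi + 2 * Real.pi = Real.pi by ring,
    intervalIntegral.integral_of_le (by linarith [Real.pi_pos]),
    integral_Ioc_eq_integral_Ioo] at h1
  rw [← h1, ofReal_integral_eq_lintegral_ofReal]
  · exact (hcont.integrableOn_Icc).mono_set Set.Ioo_subset_Icc_self
  · exact .of_forall fun θ => by positivity

/-- The **Forelli–Rudin estimate** on the unit disc with an additional power weight at the
origin. -/
theorem exists_setLIntegral_disc_forelliRudin_le {ε β : ℝ} (h0 : 0 < ε) (h1 : ε < 1) (hβ : β < 2) :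
    ∃ C : ℝ≥0, ∀ z : ℂ, ‖z‖ < 1 →
      ∫⁻ w in Metric.ball (0 : ℂ) 1, ENNReal.ofReal
        (‖w‖ ^ (-β) * (1 - ‖w‖ ^ 2) ^ (-ε) * (1 / ‖1 - z * starRingEnd ℂ w‖ ^ 2)) ≤
      C * ENNReal.ofReal ((1 - ‖z‖ ^ 2) ^ (-ε)) := by
  set I : ℝ≥0∞ := ∫⁻ r in Set.Ioo (0 : ℝ) 1, ENNReal.ofReal (r ^ (1 - β)) with hI
  have hItop : I ≠ ⊤ := (setLIntegral_Ioo_rpow_lt_top_iff.2 (by linarith)).ne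
  set A : ℝ := 1 / (1 - ε) + 1 / ε with hA
  have hA0 : 0 ≤ A := by
    have : 0 < 1 - ε := by linarith
    positivity
  refine ⟨(2 * Real.pi).toNNReal * (4 * I.toNNReal + 4 * A.toNNReal), fun z hz => ?_⟩
  set c := ‖z‖ with hc
  have hc0 : 0 ≤ c := norm_nonneg z
  have hδ : 0 < 1 - c := by linarith
  have hmeas : Measurable fun w : ℂ => ENNReal.ofReal
      (‖w‖ ^ (-β) * (1 - ‖w‖ ^ 2) ^ (-ε) * (1 / ‖1 - z * starRingEnd ℂ w‖ ^ 2)) := by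
    have := Complex.continuous_conj.measurable
    fun_prop
  rw [setLIntegral_disc_eq_lintegral_circleMap hmeas]
  have hstep : ∀ r ∈ Set.Ioo (0 : ℝ) 1, ENNReal.ofReal r *
      ∫⁻ θ in Set.Ioo (-Real.pi) Real.pi, ENNReal.ofReal (‖circleMap 0 r θ‖ ^ (-β) *
        (1 - ‖circleMap 0 r θ‖ ^ 2) ^ (-ε) *
          (1 / ‖1 - z * starRingEnd ℂ (circleMap 0 r θ)‖ ^ 2)) ≤
      ENNReal.ofReal (2 * Real.pi) * (4 * ENNReal.ofReal (r ^ (1 - β)) +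
        2 * ENNReal.ofReal ((1 - r) ^ (-ε) / max (1 - r) (1 - c))) := by
    intro r hr
    have hr0 := hr.1
    have hr1 := hr.2
    have hw : 0 ≤ r ^ (-β) * (1 - r ^ 2) ^ (-ε) :=
      mul_nonneg (Real.rpow_nonneg hr0.le _) (Real.rpow_nonneg (by nlinarith) _)
    have hM : 0 < max (1 - r) (1 - c) := lt_of_lt_of_le hδ (le_max_right _ _)
    simp only [norm_circleMap_zero_of_nonneg hr0.le, ENNReal.ofReal_mul hw]
    rw [lintegral_const_mul' _ _ ENNReal.ofReal_ne_top, setLIntegral_circleMap_poisson hz hr0 hr1,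
      ← ENNReal.ofReal_mul hw, ← ENNReal.ofReal_mul hr0.le]
    have hle := radial_weight_le h0 h1 hβ hc0 hz hr
    calc ENNReal.ofReal (r * (r ^ (-β) * (1 - r ^ 2) ^ (-ε) *
          (2 * Real.pi / (1 - ‖z‖ ^ 2 * r ^ 2))))
        ≤ ENNReal.ofReal (2 * Real.pi * (4 * r ^ (1 - β) +
            2 * ((1 - r) ^ (-ε) / max (1 - r) (1 - c)))) := by
          refine ENNReal.ofReal_le_ofReal ?_
          calc _ = 2 * Real.pi * (r * (r ^ (-β) * (1 - r ^ 2) ^ (-ε) / (1 - c ^ 2 * r ^ 2))) := by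
                rw [hc]; ring
            _ ≤ _ := by gcongr
      _ = _ := by
          have hy : 0 ≤ (1 - r) ^ (-ε) := Real.rpow_nonneg (by linarith) _
          rw [ENNReal.ofReal_mul (by positivity), ENNReal.ofReal_add
            (mul_nonneg (by norm_num) (Real.rpow_nonneg hr0.le _)) (by positivity),
            ENNReal.ofReal_mul (by norm_num), ENNReal.ofReal_mul (by norm_num)]
          norm_num
  refine (setLIntegral_mono' measurableSet_Ioo hstep).trans ?_
  rw [lintegral_const_mul' _ _ ENNReal.ofReal_ne_top, lintegral_add_left (by fun_prop),
    lintegral_const_mul' _ _ (by norm_num), lintegral_const_mul' _ _ (by norm_num), ← hI,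
    setLIntegral_Ioo_one_sub (fun y => ENNReal.ofReal (y ^ (-ε) / max y (1 - c)))]
  have hJ := setLIntegral_Ioo_rpow_div_max_le h0 h1 hδ
  rw [← hA] at hJ
  set T := (1 - c ^ 2) ^ (-ε) with hT
  have hpos : 0 < 1 - c ^ 2 := by nlinarith
  have hT1 : 1 ≤ T := Real.one_le_rpow_of_pos_of_le_one_of_nonpos hpos (by nlinarith) (by linarith)
  have hT2 : (1 - c) ^ (-ε) ≤ 2 * T := by
    have e1 : (1 - c) ^ (-ε) = 2 ^ ε * (2 * (1 - c)) ^ (-ε) := by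
      rw [Real.mul_rpow (by norm_num) hδ.le, ← mul_assoc, ← Real.rpow_add (by norm_num)]
      simp
    have e2 : (2 : ℝ) ^ ε ≤ 2 := by
      calc (2 : ℝ) ^ ε ≤ 2 ^ (1 : ℝ) := Real.rpow_le_rpow_of_exponent_le (by norm_num) h1.le
        _ = 2 := by simp
    have e3 : (2 * (1 - c)) ^ (-ε) ≤ T :=
      Real.rpow_le_rpow_of_nonpos hpos (by nlinarith) (by linarith)
    rw [e1]
    have := Real.rpow_nonneg (show (0 : ℝ) ≤ 2 * (1 - c) by linarith) (-ε)
    gcongr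
  have hT1' : (1 : ℝ≥0∞) ≤ ENNReal.ofReal T := by
    rw [← ENNReal.ofReal_one]; exact ENNReal.ofReal_le_ofReal hT1
  push_cast
  rw [mul_assoc]
  refine mul_le_mul_right ?_ _
  rw [add_mul, ENNReal.coe_toNNReal hItop]
  refine add_le_add (le_mul_of_one_le_right zero_le hT1') ?_
  calc 2 * ∫⁻ r in Set.Ioo (0 : ℝ) 1, ENNReal.ofReal (r ^ (-ε) / max r (1 - c))
      ≤ 2 * ENNReal.ofReal (A * (2 * T)) := by
        gcongr
        exact hJ.trans (ENNReal.ofReal_le_ofReal (by gcongr))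
    _ = 4 * ENNReal.ofReal A * ENNReal.ofReal T := by
        rw [ENNReal.ofReal_mul hA0, ENNReal.ofReal_mul (by norm_num : (0:ℝ) ≤ 2),
          ENNReal.ofReal_ofNat]
        ring
    _ = _ := rfl

/-! ### The branched covering of the Hartogs triangle by the bidisc -/

/-- On a circle, `θ ↦ m θ` preserves the mean. -/
theorem setLIntegral_circleMap_nat_mul {m : ℕ} (hm : 0 < m) {G : ℂ → ℝ≥0∞} (hG : Measurable G)
    (ρ : ℝ) :
    ∫⁻ θ in Set.Ioo (-Real.pi) Real.pi, G (circleMap 0 ρ (m * θ)) =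
      ∫⁻ θ in Set.Ioo (-Real.pi) Real.pi, G (circleMap 0 ρ θ) := by
  have : Fact (0 < 2 * Real.pi) := ⟨by positivity⟩
  set g : AddCircle (2 * Real.pi) → ℝ≥0∞ := fun b => G (ρ * (b.toCircle : ℂ)) with hg
  have hgm : Measurable g := by
    have : Continuous fun b : AddCircle (2 * Real.pi) => (ρ : ℂ) * (b.toCircle : ℂ) :=
      continuous_const.mul (continuous_subtype_val.comp AddCircle.continuous_toCircle)
    exact hG.comp this.measurable
  have hval : ∀ θ : ℝ, g (θ : AddCircle (2 * Real.pi)) = G (circleMap 0 ρ θ) := by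
    intro θ
    simp only [hg, AddCircle.toCircle_apply_mk, Circle.coe_exp, circleMap, zero_add]
    congr 4
    field_simp
  have hIoc : Set.Ioc (-Real.pi) (-Real.pi + 2 * Real.pi) = Set.Ioc (-Real.pi) Real.pi := by
    congr 1; ring
  have hp : MeasurePreserving (fun b : AddCircle (2 * Real.pi) => (m : ℤ) • b) :=
    Measure.measurePreserving_zsmul volume (by exact_mod_cast hm.ne')
  have e1 := AddCircle.lintegral_preimage (2 * Real.pi) (-Real.pi) g
  have e2 := AddCircle.lintegral_preimage (2 * Real.pi) (-Real.pi) fun b => g ((m : ℤ) • b)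
  rw [hp.lintegral_comp hgm, ← e1, hIoc, setLIntegral_congr Ioo_ae_eq_Ioc.symm,
    setLIntegral_congr Ioo_ae_eq_Ioc.symm] at e2
  simp only [hval] at e2
  rw [← e2]
  refine lintegral_congr fun θ => ?_
  rw [← hval]
  congr 1
  rw [natCast_zsmul, ← nsmul_eq_mul, AddCircle.coe_nsmul]

/-- The power map `τ ↦ τ^m` is `m`-to-one with Jacobian `m² |τ|^{2(m-1)}`. -/
theorem lintegral_pow_mul {m : ℕ} (hm : 0 < m) {G : ℂ → ℝ≥0∞} (hG : Measurable G) :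
    ∫⁻ τ, ENNReal.ofReal (m * ‖τ‖ ^ (2 * (m - 1))) * G (τ ^ m) = ∫⁻ t, G t := by
  rw [lintegral_eq_lintegral_circleMap hG, lintegral_eq_lintegral_circleMap
    (F := fun τ => ENNReal.ofReal (m * ‖τ‖ ^ (2 * (m - 1))) * G (τ ^ m)) (by fun_prop)]
  set A : ℝ → ℝ≥0∞ := fun ρ => ENNReal.ofReal ρ *
    ∫⁻ θ in Set.Ioo (-Real.pi) Real.pi, G (circleMap 0 ρ θ) with hA
  have himg : (fun r : ℝ => r ^ m) '' Set.Ioi 0 = Set.Ioi 0 := by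
    ext ρ
    constructor
    · rintro ⟨r, hr, rfl⟩
      exact pow_pos (Set.mem_Ioi.1 hr) m
    · intro hρ
      refine ⟨ρ ^ ((m : ℝ)⁻¹), Real.rpow_pos_of_pos hρ _, ?_⟩
      exact Real.rpow_inv_natCast_pow (le_of_lt hρ) hm.ne'
  have hinj : Set.InjOn (fun r : ℝ => r ^ m) (Set.Ioi 0) := by
    intro a ha b hb hab
    exact (pow_left_inj₀ (le_of_lt ha) (le_of_lt hb) hm.ne').1 hab
  have hcv := lintegral_image_eq_lintegral_abs_deriv_mul measurableSet_Ioi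
    (fun r _ => (hasDerivAt_pow m r).hasDerivWithinAt) hinj A
  rw [himg] at hcv
  rw [hcv]
  refine setLIntegral_congr_fun measurableSet_Ioi fun r hr => ?_
  have hr0 : 0 < r := hr
  have hpow : ∀ θ : ℝ, circleMap 0 r θ ^ m = circleMap 0 (r ^ m) (m * θ) := by
    intro θ
    simp only [circleMap, zero_add, mul_pow, ← Complex.exp_nat_mul]
    push_cast
    ring_nf
  simp only [norm_circleMap_zero_of_nonneg hr0.le, hpow, hA]
  rw [lintegral_const_mul' _ _ ENNReal.ofReal_ne_top, setLIntegral_circleMap_nat_mul hm hG,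
    ← mul_assoc, ← mul_assoc, ← ENNReal.ofReal_mul hr0.le, ← ENNReal.ofReal_mul (abs_nonneg _)]
  congr 2
  rw [abs_of_nonneg (by positivity)]
  obtain ⟨k, rfl⟩ : ∃ k, m = k + 1 := ⟨m - 1, by omega⟩
  simp only [Nat.add_sub_cancel]
  ring

theorem setLIntegral_disc_comp_mul {c : ℂ} (hc : c ≠ 0) {g : ℂ → ℝ≥0∞}
    (hg : Measurable g) :
    ENNReal.ofReal (‖c‖ ^ 2) * ∫⁻ v in Metric.ball (0 : ℂ) 1, g (v * c) =
      ∫⁻ w in Metric.ball (0 : ℂ) ‖c‖, g w := by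
  have hp : 0 < ‖c‖ := norm_pos_iff.2 hc
  set f : ℂ →ₗ[ℝ] ℂ := LinearMap.mulLeft ℝ c with hf
  have hdet : LinearMap.det f = ‖c‖ ^ 2 := by
    have := Algebra.norm_complex_apply c
    rw [Algebra.norm_apply, Complex.normSq_eq_norm_sq] at this
    exact this
  have hdet0 : LinearMap.det f ≠ 0 := by rw [hdet]; positivity
  have hmap := Measure.map_linearMap_addHaar_eq_smul_addHaar (μ := (volume : Measure ℂ)) hdet0
  have hgi : Measurable ((Metric.ball (0 : ℂ) ‖c‖).indicator g) :=
    hg.indicator Metric.isOpen_ball.measurableSet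
  have hfm : Measurable f := (measurable_const_mul c : Measurable fun v : ℂ => c * v)
  have h1 := lintegral_map (μ := volume) hgi hfm
  rw [hmap, lintegral_smul_measure, lintegral_indicator Metric.isOpen_ball.measurableSet] at h1
  have h2 : ∫⁻ v in Metric.ball (0 : ℂ) 1, g (v * c) =
      ∫⁻ v, (Metric.ball (0 : ℂ) ‖c‖).indicator g (f v) := by
    rw [← lintegral_indicator Metric.isOpen_ball.measurableSet]
    refine lintegral_congr fun v => ?_
    have hfv : f v = v * c := mul_comm c v
    have hiff : v ∈ Metric.ball (0 : ℂ) 1 ↔ v * c ∈ Metric.ball (0 : ℂ) ‖c‖ := by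
      rw [mem_ball_zero_iff, mem_ball_zero_iff, norm_mul, mul_lt_iff_lt_one_left hp]
    rw [hfv]
    by_cases hv : v ∈ Metric.ball (0 : ℂ) 1
    · rw [Set.indicator_of_mem hv, Set.indicator_of_mem (hiff.1 hv)]
    · rw [Set.indicator_of_notMem hv, Set.indicator_of_notMem (fun h => hv (hiff.2 h))]
  rw [h2, ← h1, hdet, smul_eq_mul, ← mul_assoc, ← ENNReal.ofReal_mul (by positivity),
    abs_of_nonneg (by positivity), mul_inv_cancel₀ (by positivity), ENNReal.ofReal_one, one_mul]

/-- The map `(v, τ) ↦ (v τ^n, τ^m)`, an `m`-sheeted covering of the Hartogs triangle of exponent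
`m / n` by the product of the disc and the punctured disc. -/
def hartogsCover (m n : ℕ) (x : ℂ × ℂ) : ℂ × ℂ := (x.1 * x.2 ^ n, x.2 ^ m)

/-- The product of the unit disc and the punctured unit disc. -/
def puncturedBidisc : Set (ℂ × ℂ) := Metric.ball 0 1 ×ˢ (Metric.ball 0 1 \ {0})

/-- The measure on the punctured unit disc with density `m |τ|^{2(m+n-1)}`. -/
noncomputable def weightedDisc (m n : ℕ) : Measure ℂ :=
  (volume.restrict (Metric.ball 0 1 \ {0})).withDensity
    fun τ => ENNReal.ofReal (m * ‖τ‖ ^ (2 * (m + n - 1)))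

/-- The measure on the punctured bidisc which the covering `hartogsCover m n` pushes forward to
Lebesgue measure: `1 / m` times the Jacobian of the covering. -/
noncomputable def bidiscMeasure (m n : ℕ) : Measure (ℂ × ℂ) :=
  (volume.restrict (Metric.ball 0 1)).prod (weightedDisc m n)

instance (m n : ℕ) : SFinite (weightedDisc m n) := by unfold weightedDisc; infer_instance
instance (m n : ℕ) : SFinite (bidiscMeasure m n) := by unfold bidiscMeasure; infer_instance

theorem mem_hartogsTriangle_div_iff {m n : ℕ} (hn : 0 < n) {z : ℂ × ℂ} :
    z ∈ hartogsTriangle ((m : ℝ) / n) ↔ ‖z.1‖ ^ m < ‖z.2‖ ^ n ∧ ‖z.2‖ < 1 := by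
  have hnR : (0 : ℝ) < n := by exact_mod_cast hn
  have h1 : (‖z.1‖ ^ ((m : ℝ) / n)) ^ n = ‖z.1‖ ^ m := by
    rw [← Real.rpow_natCast, ← Real.rpow_mul (norm_nonneg _), div_mul_cancel₀ _ hnR.ne',
      Real.rpow_natCast]
  unfold hartogsTriangle
  simp only [Set.mem_ofPred_eq]
  rw [← pow_lt_pow_iff_left₀ (Real.rpow_nonneg (norm_nonneg _) _) (norm_nonneg z.2) hn.ne', h1]

theorem snd_ne_zero_of_mem_hartogsTriangle {m n : ℕ} (hn : 0 < n) {z : ℂ × ℂ}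
    (hz : z ∈ hartogsTriangle ((m : ℝ) / n)) : z.2 ≠ 0 := by
  rw [mem_hartogsTriangle_div_iff hn] at hz
  intro h0
  have := hz.1
  rw [h0, norm_zero, zero_pow hn.ne'] at this
  exact absurd this (not_lt.2 (by positivity))

theorem isOpen_hartogsTriangle_div {m n : ℕ} (hn : 0 < n) :
    IsOpen (hartogsTriangle ((m : ℝ) / n)) := by
  have : hartogsTriangle ((m : ℝ) / n) =
      {z : ℂ × ℂ | ‖z.1‖ ^ m < ‖z.2‖ ^ n} ∩ {z : ℂ × ℂ | ‖z.2‖ < 1} := by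
    ext z; exact mem_hartogsTriangle_div_iff hn
  rw [this]
  exact (isOpen_lt (by fun_prop) (by fun_prop)).inter (isOpen_lt (by fun_prop) (by fun_prop))

theorem mem_puncturedBidisc_iff {x : ℂ × ℂ} :
    x ∈ puncturedBidisc ↔ ‖x.1‖ < 1 ∧ ‖x.2‖ < 1 ∧ x.2 ≠ 0 := by
  simp [puncturedBidisc, Set.mem_prod]

theorem measurable_hartogsCover (m n : ℕ) : Measurable (hartogsCover m n) := by
  unfold hartogsCover; fun_prop

theorem differentiable_hartogsCover (m n : ℕ) : Differentiable ℂ (hartogsCover m n) := by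
  unfold hartogsCover; fun_prop

theorem hartogsCover_mem {m n : ℕ} (hm : 0 < m) (hn : 0 < n) {x : ℂ × ℂ}
    (hx : x ∈ puncturedBidisc) : hartogsCover m n x ∈ hartogsTriangle ((m : ℝ) / n) := by
  rw [mem_puncturedBidisc_iff] at hx
  obtain ⟨h1, h2, h3⟩ := hx
  have hp : 0 < ‖x.2‖ := norm_pos_iff.2 h3
  rw [mem_hartogsTriangle_div_iff hn]
  simp only [hartogsCover, norm_mul, norm_pow]
  refine ⟨?_, pow_lt_one₀ hp.le h2 hm.ne'⟩
  rw [mul_pow, ← pow_mul, ← pow_mul, mul_comm m n]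
  exact mul_lt_of_lt_one_left (by positivity) (pow_lt_one₀ (norm_nonneg _) h1 hm.ne')

theorem exists_hartogsCover_eq {m n : ℕ} (hm : 0 < m) (hn : 0 < n) {z : ℂ × ℂ}
    (hz : z ∈ hartogsTriangle ((m : ℝ) / n)) :
    ∃ x ∈ puncturedBidisc, hartogsCover m n x = z := by
  have hz0 := snd_ne_zero_of_mem_hartogsTriangle hn hz
  rw [mem_hartogsTriangle_div_iff hn] at hz
  obtain ⟨τ, hτ⟩ := IsAlgClosed.exists_pow_nat_eq z.2 hm
  have hτ0 : τ ≠ 0 := by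
    rintro rfl
    rw [zero_pow hm.ne'] at hτ
    exact hz0 hτ.symm
  have hp : 0 < ‖τ‖ := norm_pos_iff.2 hτ0
  refine ⟨(z.1 / τ ^ n, τ), mem_puncturedBidisc_iff.2 ⟨?_, ?_, hτ0⟩, ?_⟩
  · simp only [norm_div, norm_pow]
    rw [div_lt_one (by positivity), ← pow_lt_pow_iff_left₀ (norm_nonneg _) (by positivity) hm.ne',
      ← pow_mul, mul_comm n m, pow_mul, ← norm_pow τ m, hτ]
    exact hz.1
  · have h2 := hz.2
    rw [← hτ, norm_pow] at h2
    exact (pow_lt_one_iff_of_nonneg hp.le hm.ne').1 h2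
  · simp only [hartogsCover, hτ]
    rw [div_mul_cancel₀ _ (pow_ne_zero n hτ0)]

theorem lintegral_weightedDisc (m n : ℕ) {g : ℂ → ℝ≥0∞} :
    ∫⁻ τ, g τ ∂weightedDisc m n = ∫⁻ τ in Metric.ball (0 : ℂ) 1 \ {0},
      ENNReal.ofReal (m * ‖τ‖ ^ (2 * (m + n - 1))) * g τ := by
  unfold weightedDisc
  rw [lintegral_withDensity_eq_lintegral_mul_non_measurable _ (by fun_prop)]
  · rfl
  · exact .of_forall fun τ => ENNReal.ofReal_lt_top

/-- Integrating over `v` and `τ` in turn: `v ↦ v τ^n` has Jacobian `|τ|^{2n}`, and the power map in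
`τ` pushes the density `m |τ|^{2(m-1)}` forward to Lebesgue measure. -/
theorem map_hartogsCover {m n : ℕ} (hm : 0 < m) (hn : 0 < n) :
    Measure.map (hartogsCover m n) (bidiscMeasure m n) =
      volume.restrict (hartogsTriangle ((m : ℝ) / n)) := by
  have hΩ := (isOpen_hartogsTriangle_div (m := m) hn).measurableSet
  refine Measure.ext_of_lintegral _ fun g hg => ?_
  rw [lintegral_map hg (measurable_hartogsCover m n), bidiscMeasure,
    lintegral_prod_symm' (fun x => g (hartogsCover m n x))
      (hg.comp (measurable_hartogsCover m n)), lintegral_weightedDisc]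
  set G : ℂ → ℝ≥0∞ := fun t => ∫⁻ w, (hartogsTriangle ((m : ℝ) / n)).indicator g (w, t) with hG
  have hGm : Measurable G := (hg.indicator hΩ).lintegral_prod_left'
  have hR : ∫⁻ z in hartogsTriangle ((m : ℝ) / n), g z = ∫⁻ t, G t := by
    rw [← lintegral_indicator hΩ, Measure.volume_eq_prod,
      lintegral_prod_symm' _ (hg.indicator hΩ)]
  rw [hR, ← lintegral_pow_mul hm hGm, ← lintegral_indicator measurableSet_puncturedDisc]
  refine lintegral_congr fun τ => ?_
  by_cases hτ : τ ∈ Metric.ball (0 : ℂ) 1 \ {0}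
  · rw [Set.indicator_of_mem hτ]
    have hτ0 : τ ≠ 0 := hτ.2
    have hp : 0 < ‖τ‖ := norm_pos_iff.2 hτ0
    have hτ1 : ‖τ‖ < 1 := mem_ball_zero_iff.1 hτ.1
    have hGv : G (τ ^ m) = ∫⁻ w in Metric.ball (0 : ℂ) ‖τ ^ n‖, g (w, τ ^ m) := by
      rw [← lintegral_indicator Metric.isOpen_ball.measurableSet]
      refine lintegral_congr fun w => ?_
      have hiff : (w, τ ^ m) ∈ hartogsTriangle ((m : ℝ) / n) ↔
          w ∈ Metric.ball (0 : ℂ) ‖τ ^ n‖ := by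
        rw [mem_hartogsTriangle_div_iff hn, mem_ball_zero_iff,
          ← pow_lt_pow_iff_left₀ (norm_nonneg w) (norm_nonneg _) hm.ne']
        simp only [norm_pow, ← pow_mul]
        rw [mul_comm m n]
        exact and_iff_left (pow_lt_one₀ hp.le hτ1 hm.ne')
      by_cases hw : w ∈ Metric.ball (0 : ℂ) ‖τ ^ n‖
      · rw [Set.indicator_of_mem hw, Set.indicator_of_mem (hiff.2 hw)]
      · rw [Set.indicator_of_notMem hw, Set.indicator_of_notMem (fun h => hw (hiff.1 h))]
    rw [hGv, ← setLIntegral_disc_comp_mul (pow_ne_zero n hτ0)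
        (g := fun w => g (w, τ ^ m)) (hg.comp (by fun_prop)),
      ← mul_assoc, ← ENNReal.ofReal_mul (by positivity)]
    simp only [hartogsCover]
    congr 2
    rw [norm_pow, mul_assoc, ← pow_mul, ← pow_add]
    congr 2
    omega
  · rw [Set.indicator_of_notMem hτ]
    have : G (τ ^ m) = 0 := by
      refine (lintegral_congr fun w => Set.indicator_of_notMem (fun h => hτ ?_) g).trans
        lintegral_zero
      have h0 := snd_ne_zero_of_mem_hartogsTriangle hn h
      rw [mem_hartogsTriangle_div_iff hn] at h
      refine ⟨mem_ball_zero_iff.2 ?_, fun h1 => h0 ?_⟩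
      · have h2 := h.2
        rw [norm_pow] at h2
        exact (pow_lt_one_iff_of_nonneg (norm_nonneg _) hm.ne').1 h2
      · rw [Set.mem_singleton_iff] at h1
        simp [h1, hm.ne']
    rw [this, mul_zero]

/-! ### The Schur test and holomorphic parameter integrals -/

/-- The **Schur test**: a positive kernel with a weight `h` such that `∫ k(x,y) h(y)^q ≤ C h(x)^q`
and `∫ k(x,y) h(x)^p ≤ C h(y)^p` defines a bounded operator on `L^p`. -/
theorem lintegral_rpow_le_of_schur {α : Type*} [MeasurableSpace α] {μ : Measure α} [SFinite μ]
    {k : α → α → ℝ≥0∞} (hk : Measurable (Function.uncurry k)) {h : α → ℝ≥0∞} (hh : Measurable h)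
    (hpos : ∀ᵐ x ∂μ, h x ≠ 0 ∧ h x ≠ ⊤) {p q : ℝ} (hpq : p.HolderConjugate q) {C : ℝ≥0}
    (h1 : ∀ᵐ x ∂μ, ∫⁻ y, k x y * h y ^ q ∂μ ≤ C * h x ^ q)
    (h2 : ∀ᵐ y ∂μ, ∫⁻ x, k x y * h x ^ p ∂μ ≤ C * h y ^ p)
    {g : α → ℝ≥0∞} (hg : AEMeasurable g μ) :
    ∫⁻ x, (∫⁻ y, k x y * g y ∂μ) ^ p ∂μ ≤ (C : ℝ≥0∞) ^ p * ∫⁻ x, g x ^ p ∂μ := by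
  wlog hgm : Measurable g generalizing g
  · have hae := hg.ae_eq_mk
    have e1 : ∀ x, ∫⁻ y, k x y * g y ∂μ = ∫⁻ y, k x y * hg.mk g y ∂μ := fun x =>
      lintegral_congr_ae (by filter_upwards [hae] with y hy; rw [hy])
    have e2 : ∫⁻ x, g x ^ p ∂μ = ∫⁻ x, hg.mk g x ^ p ∂μ :=
      lintegral_congr_ae (by filter_upwards [hae] with y hy; rw [hy])
    simp only [e1, e2]
    exact this hg.measurable_mk.aemeasurable hg.measurable_mk
  have hp := hpq.pos
  have hq := hpq.symm.pos
  have hkm : ∀ x, Measurable (k x) := fun x => hk.of_uncurry_left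
  -- Hölder with `k g = (k^{1/q} h) (k^{1/p} h⁻¹ g)`
  have hstep : ∀ᵐ x ∂μ, (∫⁻ y, k x y * g y ∂μ) ^ p ≤
      (C : ℝ≥0∞) ^ (p / q) * ∫⁻ y, h x ^ p * (k x y * ((h y)⁻¹ * g y) ^ p) ∂μ := by
    filter_upwards [h1, hpos] with x hx hx0
    have hhold := ENNReal.lintegral_mul_le_Lp_mul_Lq μ hpq.symm
      (f := fun y => k x y ^ (1 / q) * h y) (g := fun y => k x y ^ (1 / p) * ((h y)⁻¹ * g y))
      (by have := hkm x; fun_prop) (by have := hkm x; fun_prop)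
    have hL : ∫⁻ y, k x y * g y ∂μ =
        ∫⁻ y, ((fun y => k x y ^ (1 / q) * h y) *
          fun y => k x y ^ (1 / p) * ((h y)⁻¹ * g y)) y ∂μ := by
      refine lintegral_congr_ae ?_
      filter_upwards [hpos] with y hy
      simp only [Pi.mul_apply]
      have e1 : k x y ^ (1 / q) * k x y ^ (1 / p) = k x y := by
        rw [← ENNReal.rpow_add_of_nonneg _ _ (by positivity) (by positivity)]
        have : 1 / q + 1 / p = 1 := by
          have := hpq.symm.inv_add_inv_eq_one
          simpa using this
        rw [this, ENNReal.rpow_one]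
      calc k x y * g y = (k x y ^ (1 / q) * k x y ^ (1 / p)) * ((h y * (h y)⁻¹) * g y) := by
            rw [e1, ENNReal.mul_inv_cancel hy.1 hy.2, one_mul]
        _ = _ := by ring
    have e1 : ∀ y, (k x y ^ (1 / q) * h y) ^ q = k x y * h y ^ q := by
      intro y
      rw [ENNReal.mul_rpow_of_nonneg _ _ hq.le, ← ENNReal.rpow_mul, one_div,
        inv_mul_cancel₀ hq.ne', ENNReal.rpow_one]
    have e2 : ∀ y, (k x y ^ (1 / p) * ((h y)⁻¹ * g y)) ^ p = k x y * ((h y)⁻¹ * g y) ^ p := by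
      intro y
      rw [ENNReal.mul_rpow_of_nonneg _ _ hp.le, ← ENNReal.rpow_mul, one_div,
        inv_mul_cancel₀ hp.ne', ENNReal.rpow_one]
    simp only [e1, e2] at hhold
    rw [← hL] at hhold
    have hm : Measurable fun y => k x y * ((h y)⁻¹ * g y) ^ p := by have := hkm x; fun_prop
    rw [lintegral_const_mul _ hm]
    calc (∫⁻ y, k x y * g y ∂μ) ^ p
        ≤ ((∫⁻ y, k x y * h y ^ q ∂μ) ^ (1 / q) *
            (∫⁻ y, k x y * ((h y)⁻¹ * g y) ^ p ∂μ) ^ (1 / p)) ^ p := by gcongr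
      _ = (∫⁻ y, k x y * h y ^ q ∂μ) ^ (p / q) * ∫⁻ y, k x y * ((h y)⁻¹ * g y) ^ p ∂μ := by
          rw [ENNReal.mul_rpow_of_nonneg _ _ hp.le, ← ENNReal.rpow_mul, ← ENNReal.rpow_mul,
            one_div_mul_cancel hp.ne', ENNReal.rpow_one]
          congr 2
          ring
      _ ≤ (C * h x ^ q) ^ (p / q) * ∫⁻ y, k x y * ((h y)⁻¹ * g y) ^ p ∂μ := by
          gcongr
      _ = _ := by
          rw [ENNReal.mul_rpow_of_nonneg _ _ (by positivity), ← ENNReal.rpow_mul,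
            mul_div_cancel₀ _ hq.ne', mul_assoc]
  have hF : Measurable (Function.uncurry fun x y => h x ^ p * (k x y * ((h y)⁻¹ * g y) ^ p)) := by
    have : Measurable fun z : α × α => h z.1 ^ p * (k z.1 z.2 * ((h z.2)⁻¹ * g z.2) ^ p) := by
      have h3 : Measurable fun z : α × α => k z.1 z.2 := hk
      fun_prop
    exact this
  calc ∫⁻ x, (∫⁻ y, k x y * g y ∂μ) ^ p ∂μ
      ≤ ∫⁻ x, (C : ℝ≥0∞) ^ (p / q) * ∫⁻ y, h x ^ p * (k x y * ((h y)⁻¹ * g y) ^ p) ∂μ ∂μ :=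
        lintegral_mono_ae hstep
    _ = (C : ℝ≥0∞) ^ (p / q) *
          ∫⁻ y, ∫⁻ x, h x ^ p * (k x y * ((h y)⁻¹ * g y) ^ p) ∂μ ∂μ := by
        rw [lintegral_const_mul' _ _ (ENNReal.rpow_ne_top_of_nonneg (by positivity)
          ENNReal.coe_ne_top), lintegral_lintegral_swap hF.aemeasurable]
    _ ≤ (C : ℝ≥0∞) ^ (p / q) * ∫⁻ y, C * g y ^ p ∂μ := by
        refine mul_le_mul_right (lintegral_mono_ae ?_) _
        filter_upwards [h2, hpos] with y hy hy0
        have hkm' : Measurable fun x => k x y := hk.of_uncurry_right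
        have e3 : ∀ x, h x ^ p * (k x y * ((h y)⁻¹ * g y) ^ p) =
            ((h y)⁻¹ * g y) ^ p * (k x y * h x ^ p) := fun x => by ring
        simp only [e3]
        rw [lintegral_const_mul _ (by fun_prop)]
        calc ((h y)⁻¹ * g y) ^ p * ∫⁻ x, k x y * h x ^ p ∂μ
            ≤ ((h y)⁻¹ * g y) ^ p * (C * h y ^ p) := by gcongr
          _ = C * ((h y)⁻¹ * h y * g y) ^ p := by
              rw [mul_comm (C : ℝ≥0∞), ← mul_assoc, ← ENNReal.mul_rpow_of_nonneg _ _ hp.le,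
                mul_comm]
              congr 2
              ring
          _ = C * g y ^ p := by rw [ENNReal.inv_mul_cancel hy0.1 hy0.2, one_mul]
    _ = _ := by
        rw [lintegral_const_mul _ (by fun_prop), ← mul_assoc]
        congr 1
        nth_rw 2 [← ENNReal.rpow_one (C : ℝ≥0∞)]
        rw [← ENNReal.rpow_add_of_nonneg _ _ (by positivity) zero_le_one]
        congr 1
        have h5 := hpq.mul_eq_add
        field_simp
        linarith

/-- A functional on `ℂ²` is determined by its values on the two coordinate vectors, so a family of
them is measurable as soon as these values are. -/
theorem aestronglyMeasurable_clm_prod {α : Type*} [MeasurableSpace α] {μ : Measure α}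
    {T : α → (ℂ × ℂ) →L[ℂ] ℂ} (h1 : AEStronglyMeasurable (fun a => T a (1, 0)) μ)
    (h2 : AEStronglyMeasurable (fun a => T a (0, 1)) μ) : AEStronglyMeasurable T μ := by
  have : T = fun a => T a (1, 0) • ContinuousLinearMap.fst ℂ ℂ ℂ +
      T a (0, 1) • ContinuousLinearMap.snd ℂ ℂ ℂ := by
    funext a
    ext <;> simp
  rw [this]
  exact (h1.smul_const _).add (h2.smul_const _)

/-- A locally dominated integral of functions holomorphic in a parameter is holomorphic in the
parameter; the derivatives are dominated by the Cauchy estimates. -/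
theorem differentiableOn_integral_of_locally_dominated {α : Type*} [MeasurableSpace α]
    {μ : Measure α} {Ω : Set (ℂ × ℂ)} (hΩ : IsOpen Ω) {F : ℂ × ℂ → α → ℂ}
    (hm : ∀ z ∈ Ω, AEStronglyMeasurable (F z) μ)
    (hd : ∀ᵐ a ∂μ, DifferentiableOn ℂ (fun z => F z a) Ω)
    (hb : ∀ z ∈ Ω, ∃ U ∈ nhds z, ∃ b : α → ℝ, Integrable b μ ∧ ∀ᵐ a ∂μ, ∀ u ∈ U, ‖F u a‖ ≤ b a) :
    DifferentiableOn ℂ (fun z => ∫ a, F z a ∂μ) Ω := by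
  intro z hz
  obtain ⟨U, hU, b, hbi, hbb⟩ := hb z hz
  obtain ⟨ε, hε, hεU⟩ := Metric.mem_nhds_iff.1 (Filter.inter_mem hU (hΩ.mem_nhds hz))
  have hzU : z ∈ U := mem_of_mem_nhds hU
  have hmem : ∀ u ∈ Metric.ball z (ε / 2), Metric.ball u (ε / 2) ⊆ U ∩ Ω := fun u hu =>
    (Metric.ball_subset_ball' (by rw [Metric.mem_ball] at hu; linarith)).trans hεU
  have hdiff : ∀ᵐ a ∂μ, ∀ u ∈ Metric.ball z (ε / 2),
      HasFDerivAt (fun y => F y a) (fderiv ℂ (fun y => F y a) u) u := by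
    filter_upwards [hd] with a ha u hu
    refine (ha.differentiableAt (hΩ.mem_nhds ?_)).hasFDerivAt
    exact (hmem u hu (Metric.mem_ball_self (by positivity))).2
  have hz0 : z ∈ Metric.ball z (ε / 2) := Metric.mem_ball_self (by positivity)
  have hder : ∀ v : ℂ × ℂ,
      AEStronglyMeasurable (fun a => fderiv ℂ (fun y => F y a) z v) μ := by
    intro v
    -- the directional derivative is the limit of difference quotients along `t = c / (k + 1)`
    obtain ⟨δ, hδ, hδΩ⟩ : ∃ δ > 0, ∀ t : ℝ, |t| < δ → z + (t : ℂ) • v ∈ Ω := by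
      have hc : ContinuousAt (fun t : ℝ => z + (t : ℂ) • v) 0 := by fun_prop
      have := hc.preimage_mem_nhds (t := Ω) (by simpa using hΩ.mem_nhds hz)
      obtain ⟨δ, hδ, h⟩ := Metric.mem_nhds_iff.1 this
      exact ⟨δ, hδ, fun t ht => h (by simpa using ht)⟩
    set t : ℕ → ℝ := fun k => (δ / 2) / (k + 1) with ht
    have htpos : ∀ k, 0 < t k := fun k => by positivity
    have htlt : ∀ k, |t k| < δ := by
      intro k
      rw [abs_of_pos (htpos k), ht]
      have : (δ / 2) / ((k : ℝ) + 1) ≤ δ / 2 := div_le_self (by positivity) (by simp)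
      simp only
      linarith
    have hlim0 : Filter.Tendsto t Filter.atTop (nhds 0) := by
      have := (tendsto_one_div_add_atTop_nhds_zero_nat (𝕜 := ℝ)).const_mul (δ / 2)
      simpa [ht, div_eq_mul_inv] using this
    refine aestronglyMeasurable_of_tendsto_ae Filter.atTop
      (f := fun k a => ((t k : ℂ))⁻¹ • (F (z + (t k : ℂ) • v) a - F z a)) (fun k => ?_) ?_
    · exact AEStronglyMeasurable.const_smul ((hm _ (hδΩ _ (htlt k))).sub (hm z hz)) ((t k : ℂ))⁻¹
    · filter_upwards [hdiff] with a ha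
      have h1 := (ha z hz0).hasLineDerivAt v
      rw [hasLineDerivAt_iff_tendsto_slope_zero] at h1
      refine h1.comp ?_
      rw [tendsto_nhdsWithin_iff]
      refine ⟨?_, .of_forall fun k => ?_⟩
      · have := (Complex.continuous_ofReal.tendsto 0).comp hlim0
        simpa [Function.comp_def] using this
      · have := (htpos k).ne'
        simpa using this
  refine (hasFDerivAt_integral_of_dominated_of_fderiv_le (s := Metric.ball z (ε / 2))
    (F' := fun u a => fderiv ℂ (fun y => F y a) u) (bound := fun a => 2 * b a / (ε / 2))
    (Metric.ball_mem_nhds z (by positivity)) ?_ ?_ ?_ ?_ ?_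
    hdiff).differentiableAt.differentiableWithinAt
  · filter_upwards [hΩ.mem_nhds hz] with u hu using hm u hu
  · refine hbi.mono' (hm z hz) ?_
    filter_upwards [hbb] with a ha using ha z hzU
  · exact aestronglyMeasurable_clm_prod (hder _) (hder _)
  · filter_upwards [hd, hbb] with a ha hba u hu
    refine Complex.norm_fderiv_le_div_of_mapsTo_ball
      (ha.mono fun y hy => (hmem u hu hy).2) ?_ (by positivity)
    intro y hy
    rw [Metric.mem_closedBall, dist_eq_norm]
    have e1 := hba y (hmem u hu hy).1
    have e2 := hba u (hmem u hu (Metric.mem_ball_self (by positivity))).1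
    exact (norm_sub_le _ _).trans (by linarith)
  · exact (hbi.const_mul 2).div_const _

/-! ### The kernel -/

/-- The kernel of the bidisc transported to the Hartogs triangle, before summation over the
sheets of the covering, as a function of `a = v * conj v'` and `b = τ * conj τ'`. -/
noncomputable def sheetKernel (m n : ℕ) (a b : ℂ) : ℂ :=
  1 / (1 - a) ^ 2 * (1 / (1 - b) ^ 2 * (1 / b ^ (m + n - 1)))

noncomputable instance fintypeRootsOfUnityComplex (m : ℕ) [NeZero m] :
    Fintype (rootsOfUnity m ℂ) := Fintype.ofFinite _

/-- The sum of `sheetKernel` over the `m`-th roots `ζ * β` of `β ^ m`. The factor `1 / π ^ 2`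
normalises the two disc kernels; one factor `1 / m` comes from the density `m |τ|^{2(m+n-1)}`, the
other from averaging over the sheets. -/
noncomputable def sheetSum (m n : ℕ) [NeZero m] (s β : ℂ) : ℂ :=
  1 / (Real.pi ^ 2 * m ^ 2) *
    ∑ ζ : rootsOfUnity m ℂ, sheetKernel m n (s / ((ζ : ℂˣ) * β) ^ n) ((ζ : ℂˣ) * β)

/-- The Bergman kernel of the Hartogs triangle as a function of `s = z₁ * conj w₁` and
`t = z₂ * conj w₂`: the sum of `sheetKernel` over all `m`-th roots of `t`. The principal root of `t`
serves as a base point only, the sum does not depend on it. -/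
noncomputable def hartogsProfile (m n : ℕ) [NeZero m] (q : ℂ × ℂ) : ℂ :=
  sheetSum m n q.1 (q.2 ^ ((m : ℂ)⁻¹))

/-- The pair `(z₁ * conj w₁, z₂ * conj w₂)`. -/
def mulConj (z w : ℂ × ℂ) : ℂ × ℂ := (z.1 * starRingEnd ℂ w.1, z.2 * starRingEnd ℂ w.2)

/-- The Bergman kernel of the Hartogs triangle of exponent `m / n`. -/
noncomputable def hartogsKernel (m n : ℕ) [NeZero m] (z w : ℂ × ℂ) : ℂ :=
  hartogsProfile m n (mulConj z w)

/-- The deck transformation of `hartogsCover m n` given by an `m`-th root of unity. -/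
noncomputable def deck (m n : ℕ) (ζ : rootsOfUnity m ℂ) (x : ℂ × ℂ) : ℂ × ℂ :=
  (x.1 / ((ζ : ℂˣ) : ℂ) ^ n, (ζ : ℂˣ) * x.2)

/-- The Bergman kernel of the Hartogs triangle pulled back to the punctured bidisc: the sum
over the deck transformations of the kernel of a single sheet. -/
noncomputable def liftedKernel (m n : ℕ) [NeZero m] (x y : ℂ × ℂ) : ℂ :=
  1 / (Real.pi ^ 2 * m ^ 2) * ∑ ζ : rootsOfUnity m ℂ,
    sheetKernel m n (mulConj (deck m n ζ x) y).1 (mulConj (deck m n ζ x) y).2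

theorem rootsOfUnity_coe_pow {m : ℕ} (ζ : rootsOfUnity m ℂ) : (((ζ : ℂˣ) : ℂ)) ^ m = 1 := by
  have := (mem_rootsOfUnity' m (ζ : ℂˣ)).1 ζ.2
  exact this

theorem norm_rootsOfUnity_coe {m : ℕ} (hm : m ≠ 0) (ζ : rootsOfUnity m ℂ) :
    ‖((ζ : ℂˣ) : ℂ)‖ = 1 :=
  Complex.norm_eq_one_of_pow_eq_one (rootsOfUnity_coe_pow ζ) hm

theorem conj_sheetKernel {m n : ℕ} (a b : ℂ) :
    starRingEnd ℂ (sheetKernel m n a b) =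
      sheetKernel m n (starRingEnd ℂ a) (starRingEnd ℂ b) := by
  simp [sheetKernel]

theorem hartogsCover_deck {m n : ℕ} (ζ : rootsOfUnity m ℂ) (x : ℂ × ℂ) :
    hartogsCover m n (deck m n ζ x) = hartogsCover m n x := by
  have hζ : ((ζ : ℂˣ) : ℂ) ≠ 0 := Units.ne_zero _
  simp only [hartogsCover, deck, mul_pow, rootsOfUnity_coe_pow, one_mul]
  congr 1
  field_simp

theorem mulConj_mem {m n : ℕ} (hn : 0 < n) {z w : ℂ × ℂ} (hz : z ∈ hartogsTriangle ((m : ℝ) / n))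
    (hw : w ∈ hartogsTriangle ((m : ℝ) / n)) : mulConj z w ∈ hartogsTriangle ((m : ℝ) / n) := by
  rw [mem_hartogsTriangle_div_iff hn] at hz hw ⊢
  simp only [mulConj, norm_mul, Complex.norm_conj, mul_pow]
  exact ⟨mul_lt_mul'' hz.1 hw.1 (by positivity) (by positivity),
    mul_lt_one_of_nonneg_of_lt_one_left (norm_nonneg _) hz.2 hw.2.le⟩

theorem differentiableAt_sheetKernel {m n : ℕ} {q : ℂ × ℂ} (h : q ∈ puncturedBidisc) :
    DifferentiableAt ℂ (fun q : ℂ × ℂ => sheetKernel m n q.1 q.2) q := by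
  rw [mem_puncturedBidisc_iff] at h
  have h1 : (1 - q.1) ^ 2 ≠ 0 := by
    refine pow_ne_zero 2 fun h0 => ?_
    rw [sub_eq_zero] at h0
    rw [← h0, norm_one] at h
    exact lt_irrefl _ h.1
  have h2 : (1 - q.2) ^ 2 ≠ 0 := by
    refine pow_ne_zero 2 fun h0 => ?_
    rw [sub_eq_zero] at h0
    rw [← h0, norm_one] at h
    exact lt_irrefl _ h.2.1
  have h3 : q.2 ^ (m + n - 1) ≠ 0 := pow_ne_zero _ h.2.2
  unfold sheetKernel
  fun_prop (disch := assumption)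

theorem norm_sheetKernel_mulConj_le {m n : ℕ} {x y : ℂ × ℂ} (hx : x ∈ puncturedBidisc)
    (hy : y ∈ puncturedBidisc) :
    ‖sheetKernel m n (mulConj x y).1 (mulConj x y).2‖ ≤
      1 / (1 - ‖x.1‖) ^ 2 * (1 / (1 - ‖x.2‖) ^ 2 *
        (1 / (‖x.2‖ ^ (m + n - 1) * ‖y.2‖ ^ (m + n - 1)))) := by
  rw [mem_puncturedBidisc_iff] at hx hy
  have h1 := norm_discBergman_le hx.1 hy.1.le
  have h2 := norm_discBergman_le hx.2.1 hy.2.1.le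
  have e3 : ‖1 / (x.2 * starRingEnd ℂ y.2) ^ (m + n - 1)‖ =
      1 / (‖x.2‖ ^ (m + n - 1) * ‖y.2‖ ^ (m + n - 1)) := by
    simp [mul_pow, mul_comm]
  simp only [sheetKernel, mulConj]
  rw [norm_mul, norm_mul, e3]
  gcongr

section

variable {m n : ℕ} [NeZero m]

theorem sheetSum_mul_rootsOfUnity (s β : ℂ) (η : rootsOfUnity m ℂ) :
    sheetSum m n s ((η : ℂˣ) * β) = sheetSum m n s β := by
  unfold sheetSum
  congr 1
  refine Fintype.sum_equiv (Equiv.mulRight η) _ _ fun ζ => ?_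
  simp [mul_assoc]

theorem sheetSum_eq_of_pow_eq {s β β' : ℂ} (h : β ^ m = β' ^ m) :
    sheetSum m n s β = sheetSum m n s β' := by
  by_cases h0 : β' = 0
  · have : β = 0 := by
      rw [h0, zero_pow (NeZero.ne m)] at h
      exact (pow_eq_zero_iff (NeZero.ne m)).1 h
    rw [this, h0]
  · have h1 : (β / β') ^ m = 1 := by
      rw [div_pow, h, div_self (pow_ne_zero m h0)]
    set η : rootsOfUnity m ℂ := rootsOfUnity.mkOfPowEq (β / β') h1 with hη
    have h2 : ((η : ℂˣ) : ℂ) * β' = β := by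
      rw [hη, rootsOfUnity.coe_mkOfPowEq, div_mul_cancel₀ _ h0]
    rw [← h2, sheetSum_mul_rootsOfUnity]

/-- The profile may be computed from any `m`-th root, in particular from local holomorphic branches
of the root. -/
theorem hartogsProfile_eq_sheetSum {q : ℂ × ℂ} {β : ℂ} (h : β ^ m = q.2) :
    hartogsProfile m n q = sheetSum m n q.1 β := by
  unfold hartogsProfile
  refine sheetSum_eq_of_pow_eq ?_
  rw [Complex.cpow_nat_inv_pow _ (NeZero.ne m), h]

theorem conj_sheetSum (s β : ℂ) :
    starRingEnd ℂ (sheetSum m n s β) = sheetSum m n (starRingEnd ℂ s) (starRingEnd ℂ β) := by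
  unfold sheetSum
  rw [map_mul, map_sum]
  congr 1
  · simp
  · refine Fintype.sum_equiv (Equiv.inv _) _ _ fun ζ => ?_
    rw [conj_sheetKernel]
    have : starRingEnd ℂ ((ζ : ℂˣ) : ℂ) = (((Equiv.inv (rootsOfUnity m ℂ) ζ : ℂˣ)) : ℂ) := by
      simp only [Equiv.inv_apply, InvMemClass.coe_inv, Units.val_inv_eq_inv_val]
      rw [Complex.inv_def, Complex.normSq_eq_norm_sq, norm_rootsOfUnity_coe (NeZero.ne m) ζ]
      simp
    simp [this]

theorem conj_hartogsProfile (q : ℂ × ℂ) :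
    starRingEnd ℂ (hartogsProfile m n q) =
      hartogsProfile m n (starRingEnd ℂ q.1, starRingEnd ℂ q.2) := by
  have h := Complex.cpow_nat_inv_pow q.2 (NeZero.ne m)
  rw [hartogsProfile, conj_sheetSum, hartogsProfile_eq_sheetSum
    (β := starRingEnd ℂ (q.2 ^ ((m : ℂ)⁻¹)))]
  rw [← map_pow, h]

theorem conj_hartogsKernel (z w : ℂ × ℂ) :
    starRingEnd ℂ (hartogsKernel m n z w) = hartogsKernel m n w z := by
  rw [hartogsKernel, conj_hartogsProfile, hartogsKernel]
  congr 1
  simp [mulConj, mul_comm]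

theorem hartogsKernel_hartogsCover {x y : ℂ × ℂ} (hx : x ∈ puncturedBidisc)
    (hy : y ∈ puncturedBidisc) :
    hartogsKernel m n (hartogsCover m n x) (hartogsCover m n y) = liftedKernel m n x y := by
  rw [mem_puncturedBidisc_iff] at hx hy
  have hx0 := hx.2.2
  have hy0 : starRingEnd ℂ y.2 ≠ 0 := by simpa using hy.2.2
  rw [hartogsKernel, hartogsProfile_eq_sheetSum (β := x.2 * starRingEnd ℂ y.2)]
  · unfold sheetSum liftedKernel
    congr 1
    refine Finset.sum_congr rfl fun ζ _ => ?_
    have hζ : ((ζ : ℂˣ) : ℂ) ≠ 0 := Units.ne_zero _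
    congr 1
    · simp only [mulConj, hartogsCover, deck, map_mul, map_pow, mul_pow]
      field_simp
    · simp only [mulConj, deck]
      ring
  · simp only [mulConj, hartogsCover, map_pow]
    ring

theorem deck_mem (ζ : rootsOfUnity m ℂ) {x : ℂ × ℂ} (hx : x ∈ puncturedBidisc) :
    deck m n ζ x ∈ puncturedBidisc := by
  rw [mem_puncturedBidisc_iff] at hx ⊢
  have h1 := norm_rootsOfUnity_coe (NeZero.ne m) ζ
  have hζ : ((ζ : ℂˣ) : ℂ) ≠ 0 := Units.ne_zero _
  simp only [deck, norm_div, norm_mul, norm_pow, h1, one_pow, div_one, one_mul]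
  exact ⟨hx.1, hx.2.1, mul_ne_zero hζ hx.2.2⟩

theorem norm_deck_fst (ζ : rootsOfUnity m ℂ) (x : ℂ × ℂ) : ‖(deck m n ζ x).1‖ = ‖x.1‖ := by
  simp [deck, norm_rootsOfUnity_coe (NeZero.ne m) ζ]

theorem norm_deck_snd (ζ : rootsOfUnity m ℂ) (x : ℂ × ℂ) : ‖(deck m n ζ x).2‖ = ‖x.2‖ := by
  simp [deck, norm_rootsOfUnity_coe (NeZero.ne m) ζ]

theorem differentiableOn_hartogsProfile (hn : 0 < n) :
    DifferentiableOn ℂ (hartogsProfile m n) (hartogsTriangle ((m : ℝ) / n)) := by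
  have hm := NeZero.pos m
  intro q hq
  refine DifferentiableAt.differentiableWithinAt ?_
  obtain ⟨x, hx, hxq⟩ := exists_hartogsCover_eq hm hn hq
  have hq2 : q.2 = x.2 ^ m := by rw [← hxq]; rfl
  have hq1 : q.1 = x.1 * x.2 ^ n := by rw [← hxq]; rfl
  have hx' := mem_puncturedBidisc_iff.1 hx
  have hq0 : q.2 ≠ 0 := by rw [hq2]; exact pow_ne_zero m hx'.2.2
  -- the branch of the `m`-th root near `q.2` with value `x.2` there
  set β : ℂ → ℂ := fun t => x.2 * (t / q.2) ^ ((m : ℂ)⁻¹) with hβ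
  have hβq : β q.2 = x.2 := by simp [hβ, div_self hq0]
  have hprof : hartogsProfile m n = fun u => sheetSum m n u.1 (β u.2) := by
    funext u
    refine hartogsProfile_eq_sheetSum ?_
    rw [hβ]
    simp only [mul_pow]
    rw [Complex.cpow_nat_inv_pow _ (NeZero.ne m), ← hq2, mul_div_cancel₀ _ hq0]
  have hβd : DifferentiableAt ℂ (fun u : ℂ × ℂ => β u.2) q := by
    have h1 : DifferentiableAt ℂ (fun u : ℂ × ℂ => u.2 / q.2) q := by fun_prop
    refine (DifferentiableAt.cpow h1 (differentiableAt_const _) ?_).const_mul _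
    rw [div_self hq0]
    exact Complex.one_mem_slitPlane
  clear_value β
  rw [hprof]
  unfold sheetSum
  refine DifferentiableAt.const_mul (DifferentiableAt.fun_sum fun ζ _ => ?_) _
  have hζ : ((ζ : ℂˣ) : ℂ) ≠ 0 := Units.ne_zero _
  have hpt : (q.1 / (((ζ : ℂˣ) : ℂ) * β q.2) ^ n, ((ζ : ℂˣ) : ℂ) * β q.2) = deck m n ζ x := by
    rw [hβq, hq1]
    have := hx'.2.2
    simp only [deck, mul_pow]
    congr 1
    field_simp
  have hmem := deck_mem (n := n) ζ hx
  rw [← hpt] at hmem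
  have hpow : (((ζ : ℂˣ) : ℂ) * β q.2) ^ n ≠ 0 := by
    rw [hβq]; exact pow_ne_zero n (mul_ne_zero hζ hx'.2.2)
  have hsn : DifferentiableAt ℂ (fun u : ℂ × ℂ => (((ζ : ℂˣ) : ℂ) * β u.2) ^ n) q :=
    (hβd.const_mul _).fun_pow n
  have hfst : DifferentiableAt ℂ (fun u : ℂ × ℂ => u.1 * ((((ζ : ℂˣ) : ℂ) * β u.2) ^ n)⁻¹) q :=
    differentiableAt_fst.fun_mul (hsn.fun_inv hpow)
  simp only [← div_eq_mul_inv] at hfst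
  have hcomp := DifferentiableAt.comp q
    (f := fun u : ℂ × ℂ =>
      (u.1 / (((ζ : ℂˣ) : ℂ) * β u.2) ^ n, ((ζ : ℂˣ) : ℂ) * β u.2))
    (differentiableAt_sheetKernel (m := m) (n := n) hmem)
    (hfst.prodMk (hβd.const_mul _))
  exact hcomp

theorem differentiableOn_hartogsKernel (hn : 0 < n) {w : ℂ × ℂ}
    (hw : w ∈ hartogsTriangle ((m : ℝ) / n)) :
    DifferentiableOn ℂ (fun z => hartogsKernel m n z w) (hartogsTriangle ((m : ℝ) / n)) := by
  refine (differentiableOn_hartogsProfile hn).comp (f := fun z => mulConj z w) ?_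
    fun z hz => mulConj_mem hn hz hw
  unfold mulConj
  fun_prop

theorem continuousOn_hartogsKernel (hn : 0 < n) {z : ℂ × ℂ}
    (hz : z ∈ hartogsTriangle ((m : ℝ) / n)) :
    ContinuousOn (hartogsKernel m n z) (hartogsTriangle ((m : ℝ) / n)) := by
  have h := Complex.continuous_conj.comp_continuousOn
    (differentiableOn_hartogsKernel hn hz).continuousOn
  refine h.congr fun w _ => ?_
  simp [conj_hartogsKernel]

/-- The factor depending on `z` in the bound for the kernel. With `z = Φ(v, τ)`, it is the bound for
the two disc kernels times `|τ|^{-(m+n-1)}`; only its continuity matters. -/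
noncomputable def kernelBound (m n : ℕ) (z : ℂ × ℂ) : ℝ :=
  1 / (Real.pi ^ 2 * m) * (1 / (1 - ‖z.1‖ / (‖z.2‖ ^ ((m : ℝ)⁻¹)) ^ n) ^ 2 *
    (1 / (1 - ‖z.2‖ ^ ((m : ℝ)⁻¹)) ^ 2 * (1 / (‖z.2‖ ^ ((m : ℝ)⁻¹)) ^ (m + n - 1))))

/-- The function `|w₂|^{-(m+n-1)/m}`, which dominates the kernel locally uniformly in `z`; on the
covering space it is `|τ|^{-(m+n-1)}`. -/
noncomputable def kernelMajorant (m n : ℕ) (w : ℂ × ℂ) : ℝ :=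
  1 / (‖w.2‖ ^ ((m : ℝ)⁻¹)) ^ (m + n - 1)

theorem norm_snd_hartogsCover_rpow (x : ℂ × ℂ) :
    ‖(hartogsCover m n x).2‖ ^ ((m : ℝ)⁻¹) = ‖x.2‖ := by
  simp only [hartogsCover, norm_pow]
  exact Real.pow_rpow_inv_natCast (norm_nonneg _) (NeZero.ne m)

theorem kernelBound_hartogsCover {x : ℂ × ℂ} (hx : x ∈ puncturedBidisc) :
    kernelBound m n (hartogsCover m n x) = 1 / (Real.pi ^ 2 * m) * (1 / (1 - ‖x.1‖) ^ 2 *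
      (1 / (1 - ‖x.2‖) ^ 2 * (1 / ‖x.2‖ ^ (m + n - 1)))) := by
  have h0 : ‖x.2‖ ≠ 0 := norm_ne_zero_iff.2 (mem_puncturedBidisc_iff.1 hx).2.2
  rw [kernelBound, norm_snd_hartogsCover_rpow]
  simp only [hartogsCover, norm_mul, norm_pow]
  rw [mul_div_cancel_right₀ _ (pow_ne_zero n h0)]

theorem norm_hartogsKernel_le (hn : 0 < n) {z w : ℂ × ℂ}
    (hz : z ∈ hartogsTriangle ((m : ℝ) / n)) (hw : w ∈ hartogsTriangle ((m : ℝ) / n)) :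
    ‖hartogsKernel m n z w‖ ≤ kernelBound m n z * kernelMajorant m n w := by
  have hm := NeZero.pos m
  have hmR : (0 : ℝ) < m := by exact_mod_cast hm
  obtain ⟨x, hx, rfl⟩ := exists_hartogsCover_eq hm hn hz
  obtain ⟨y, hy, rfl⟩ := exists_hartogsCover_eq hm hn hw
  rw [hartogsKernel_hartogsCover hx hy, kernelBound_hartogsCover hx, kernelMajorant,
    norm_snd_hartogsCover_rpow, liftedKernel, norm_mul]
  have hcard : Fintype.card (rootsOfUnity m ℂ) = m := by
    rw [← Nat.card_eq_fintype_card]; exact Complex.card_rootsOfUnity m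
  have hsum : ‖∑ ζ : rootsOfUnity m ℂ,
      sheetKernel m n (mulConj (deck m n ζ x) y).1 (mulConj (deck m n ζ x) y).2‖ ≤
      m * (1 / (1 - ‖x.1‖) ^ 2 * (1 / (1 - ‖x.2‖) ^ 2 *
        (1 / (‖x.2‖ ^ (m + n - 1) * ‖y.2‖ ^ (m + n - 1))))) := by
    refine (norm_sum_le _ _).trans ?_
    have hle := Finset.sum_le_card_nsmul (Finset.univ : Finset (rootsOfUnity m ℂ))
      (fun ζ => ‖sheetKernel m n (mulConj (deck m n ζ x) y).1 (mulConj (deck m n ζ x) y).2‖)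
      (1 / (1 - ‖x.1‖) ^ 2 * (1 / (1 - ‖x.2‖) ^ 2 *
        (1 / (‖x.2‖ ^ (m + n - 1) * ‖y.2‖ ^ (m + n - 1))))) fun ζ _ => by
          have h := norm_sheetKernel_mulConj_le (m := m) (n := n) (deck_mem (n := n) ζ hx) hy
          rwa [norm_deck_fst, norm_deck_snd] at h
    rwa [Finset.card_univ, hcard, nsmul_eq_mul] at hle
  have hc : ‖(1 / (Real.pi ^ 2 * m ^ 2) : ℂ)‖ = 1 / (Real.pi ^ 2 * m ^ 2) := by
    simp
  rw [hc]
  calc 1 / (Real.pi ^ 2 * (m : ℝ) ^ 2) * _ ≤ 1 / (Real.pi ^ 2 * (m : ℝ) ^ 2) *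
        (m * (1 / (1 - ‖x.1‖) ^ 2 * (1 / (1 - ‖x.2‖) ^ 2 *
          (1 / (‖x.2‖ ^ (m + n - 1) * ‖y.2‖ ^ (m + n - 1)))))) := by gcongr
    _ = _ := by
      simp only [one_div, mul_inv]
      field_simp

theorem continuousOn_kernelBound (hn : 0 < n) :
    ContinuousOn (kernelBound m n) (hartogsTriangle ((m : ℝ) / n)) := by
  have hm := NeZero.pos m
  intro z hz
  refine ContinuousAt.continuousWithinAt ?_
  have hz0 := snd_ne_zero_of_mem_hartogsTriangle hn hz
  obtain ⟨x, hx, rfl⟩ := exists_hartogsCover_eq hm hn hz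
  have hx' := mem_puncturedBidisc_iff.1 hx
  have hr := norm_snd_hartogsCover_rpow (m := m) (n := n) x
  have hp : 0 < ‖x.2‖ := norm_pos_iff.2 hx'.2.2
  have h2 : ContinuousAt (fun z : ℂ × ℂ => ‖z.2‖ ^ ((m : ℝ)⁻¹)) (hartogsCover m n x) :=
    ContinuousAt.rpow_const (by fun_prop) (Or.inl (norm_ne_zero_iff.2 hz0))
  have h1 : ContinuousAt (fun z : ℂ × ℂ => ‖z.1‖) (hartogsCover m n x) := by fun_prop
  have e1 : ((‖(hartogsCover m n x).2‖ ^ ((m : ℝ)⁻¹)) ^ n) ≠ 0 := by rw [hr]; positivity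
  have e2 : (1 - ‖(hartogsCover m n x).1‖ / (‖(hartogsCover m n x).2‖ ^ ((m : ℝ)⁻¹)) ^ n) ^ 2 ≠
      0 := by
    rw [hr]
    simp only [hartogsCover, norm_mul, norm_pow]
    rw [mul_div_cancel_right₀ _ (by positivity)]
    exact pow_ne_zero 2 (by linarith [hx'.1])
  have e3 : (1 - ‖(hartogsCover m n x).2‖ ^ ((m : ℝ)⁻¹)) ^ 2 ≠ 0 := by
    rw [hr]
    exact pow_ne_zero 2 (by linarith [hx'.2.1])
  have e4 : (‖(hartogsCover m n x).2‖ ^ ((m : ℝ)⁻¹)) ^ (m + n - 1) ≠ 0 := by rw [hr]; positivity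
  unfold kernelBound
  exact continuousAt_const.mul ((continuousAt_const.div ((continuousAt_const.sub
    (h1.div (h2.pow n) e1)).pow 2) e2).mul ((continuousAt_const.div ((continuousAt_const.sub
      h2).pow 2) e3).mul (continuousAt_const.div (h2.pow _) e4)))

end

/-! ### Integration over the covering space and the reproducing property -/

section

variable {m n : ℕ}

theorem measurePreserving_hartogsCover (hm : 0 < m) (hn : 0 < n) :
    MeasurePreserving (hartogsCover m n) (bidiscMeasure m n)
      (volume.restrict (hartogsTriangle ((m : ℝ) / n))) :=
  ⟨measurable_hartogsCover m n, map_hartogsCover hm hn⟩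

theorem hartogsTriangle_div_subset_ball (hm : 0 < m) (hn : 0 < n) :
    hartogsTriangle ((m : ℝ) / n) ⊆ Metric.ball 0 1 := by
  intro z hz
  rw [mem_hartogsTriangle_div_iff hn] at hz
  have h1 : ‖z.1‖ ^ m < 1 := hz.1.trans_le (pow_le_one₀ (norm_nonneg _) hz.2.le)
  rw [mem_ball_zero_iff, Prod.norm_def]
  exact max_lt ((pow_lt_one_iff_of_nonneg (norm_nonneg _) hm.ne').1 h1) hz.2

theorem isFiniteMeasure_hartogsTriangle (hm : 0 < m) (hn : 0 < n) :
    IsFiniteMeasure (volume.restrict (hartogsTriangle ((m : ℝ) / n))) :=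
  ⟨by
    rw [Measure.restrict_apply MeasurableSet.univ, Set.univ_inter]
    exact (measure_mono (hartogsTriangle_div_subset_ball hm hn)).trans_lt measure_ball_lt_top⟩

theorem ae_weightedDisc_mem : ∀ᵐ τ ∂weightedDisc m n, τ ∈ Metric.ball (0 : ℂ) 1 \ {0} :=
  (withDensity_absolutelyContinuous _ _).ae_le (ae_restrict_mem measurableSet_puncturedDisc)

theorem ae_bidiscMeasure_mem : ∀ᵐ x ∂bidiscMeasure m n, x ∈ puncturedBidisc := by
  have h1 : ∀ᵐ x ∂bidiscMeasure m n, x.1 ∈ Metric.ball (0 : ℂ) 1 :=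
    Measure.quasiMeasurePreserving_fst.ae (ae_restrict_mem Metric.isOpen_ball.measurableSet)
  have h2 : ∀ᵐ x ∂bidiscMeasure m n, x.2 ∈ Metric.ball (0 : ℂ) 1 \ {0} :=
    Measure.quasiMeasurePreserving_snd.ae ae_weightedDisc_mem
  filter_upwards [h1, h2] with x hx1 hx2 using ⟨hx1, hx2⟩

theorem integral_weightedDisc (g : ℂ → ℂ) :
    ∫ τ, g τ ∂weightedDisc m n =
      ∫ τ in Metric.ball (0 : ℂ) 1, ((m * ‖τ‖ ^ (2 * (m + n - 1)) : ℝ) : ℂ) * g τ := by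
  unfold weightedDisc
  rw [integral_withDensity_eq_integral_toReal_smul (by fun_prop)
    (.of_forall fun τ => ENNReal.ofReal_lt_top), setIntegral_congr_set puncturedDisc_ae_eq]
  refine integral_congr_ae (.of_forall fun τ => ?_)
  simp only
  rw [ENNReal.toReal_ofReal (by positivity), Complex.real_smul]

theorem integrable_weightedDisc_iff {g : ℂ → ℝ} :
    Integrable g (weightedDisc m n) ↔
      IntegrableOn (fun τ => (m * ‖τ‖ ^ (2 * (m + n - 1)) : ℝ) * g τ) (Metric.ball 0 1) := by
  unfold weightedDisc
  rw [integrable_withDensity_iff_integrable_smul' (by fun_prop)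
    (.of_forall fun τ => ENNReal.ofReal_lt_top), IntegrableOn,
    ← Measure.restrict_congr_set puncturedDisc_ae_eq]
  refine integrable_congr (.of_forall fun τ => ?_)
  simp only
  rw [ENNReal.toReal_ofReal (by positivity), smul_eq_mul]

theorem integrable_of_integrable_sq {α : Type*} [MeasurableSpace α] {μ : Measure α}
    [IsFiniteMeasure μ] {h : α → ℂ} (hm : AEStronglyMeasurable h μ)
    (hi : Integrable (fun w => h w ^ 2) μ) : Integrable h μ := by
  refine Integrable.mono' ((integrable_const (1 : ℝ)).add hi.norm) hm (.of_forall fun w => ?_)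
  simp only [Pi.add_apply, norm_pow]
  nlinarith [sq_nonneg (‖h w‖ - 1)]

theorem setLIntegral_puncturedDisc (g : ℂ → ℝ≥0∞) :
    ∫⁻ τ in Metric.ball (0 : ℂ) 1 \ {0}, g τ = ∫⁻ τ in Metric.ball (0 : ℂ) 1, g τ :=
  setLIntegral_congr puncturedDisc_ae_eq

theorem lintegral_weightedDisc_rpow (s : ℝ) :
    ∫⁻ τ, ENNReal.ofReal (‖τ‖ ^ s) ∂weightedDisc m n = m *
      ∫⁻ τ in Metric.ball (0 : ℂ) 1,
        ENNReal.ofReal (‖τ‖ ^ (2 * ((m + n - 1 : ℕ) : ℝ) + s)) := by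
  rw [lintegral_weightedDisc, ← setLIntegral_puncturedDisc,
    ← lintegral_const_mul' _ _ (ENNReal.natCast_ne_top m)]
  refine setLIntegral_congr_fun measurableSet_puncturedDisc fun τ hτ => ?_
  have hp : 0 < ‖τ‖ := norm_pos_iff.2 hτ.2
  rw [Real.rpow_add hp, ← ENNReal.ofReal_natCast, ← ENNReal.ofReal_mul (by positivity),
    ← ENNReal.ofReal_mul (by positivity), ← mul_assoc]
  congr 3
  rw [← Real.rpow_natCast]
  push_cast
  rfl

theorem lintegral_weightedDisc_rpow_lt_top_iff (hm : 0 < m) {s : ℝ} :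
    ∫⁻ τ, ENNReal.ofReal (‖τ‖ ^ s) ∂weightedDisc m n < ⊤ ↔
      -2 < 2 * ((m + n - 1 : ℕ) : ℝ) + s := by
  rw [lintegral_weightedDisc_rpow, ← setLIntegral_disc_rpow_lt_top_iff]
  have h0 : (m : ℝ≥0∞) ≠ 0 := by exact_mod_cast hm.ne'
  constructor
  · intro h
    by_contra hc
    rw [not_lt, top_le_iff] at hc
    rw [hc, ENNReal.mul_top h0] at h
    exact lt_irrefl _ h
  · intro h
    exact ENNReal.mul_lt_top (ENNReal.natCast_lt_top m) h

theorem memLp_inv_norm_snd_pow (hm : 0 < m) {q : ℝ} (hq : 0 < q)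
    (h : q * ((m + n - 1 : ℕ) : ℝ) < 2 * ((m + n - 1 : ℕ) : ℝ) + 2) :
    MemLp (fun y : ℂ × ℂ => (‖y.2‖ ^ (m + n - 1))⁻¹) (ENNReal.ofReal q) (bidiscMeasure m n) := by
  refine ⟨Measurable.aestronglyMeasurable (by fun_prop), ?_⟩
  rw [eLpNorm_lt_top_iff_lintegral_rpow_enorm_lt_top (by simpa using hq) ENNReal.ofReal_ne_top,
    ENNReal.toReal_ofReal hq.le]
  have e : ∀ y : ℂ × ℂ, ‖(‖y.2‖ ^ (m + n - 1))⁻¹‖ₑ ^ q =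
      ENNReal.ofReal (‖y.2‖ ^ (-(q * ((m + n - 1 : ℕ) : ℝ)))) := by
    intro y
    rw [← ofReal_norm, Real.norm_of_nonneg (by positivity),
      ENNReal.ofReal_rpow_of_nonneg (by positivity) hq.le, Real.rpow_neg (norm_nonneg _),
      Real.inv_rpow (by positivity), mul_comm q, Real.rpow_mul (norm_nonneg _), Real.rpow_natCast]
  simp only [e]
  rw [bidiscMeasure, lintegral_prod_symm' _ (by fun_prop)]
  simp only [lintegral_const]
  rw [lintegral_mul_const _ (by fun_prop)]
  refine ENNReal.mul_lt_top ((lintegral_weightedDisc_rpow_lt_top_iff hm).2 (by linarith)) ?_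
  rw [Measure.restrict_apply MeasurableSet.univ, Set.univ_inter]
  exact measure_ball_lt_top

theorem measurable_sheetKernel_mulConj :
    Measurable fun z : (ℂ × ℂ) × (ℂ × ℂ) =>
      sheetKernel m n (mulConj z.1 z.2).1 (mulConj z.1 z.2).2 := by
  have := Complex.continuous_conj.measurable
  unfold sheetKernel mulConj
  fun_prop

theorem memLp_sheetKernel_mulConj (hm : 0 < m) {q : ℝ} (hq : 0 < q)
    (h : q * ((m + n - 1 : ℕ) : ℝ) < 2 * ((m + n - 1 : ℕ) : ℝ) + 2) {x : ℂ × ℂ}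
    (hx : x ∈ puncturedBidisc) :
    MemLp (fun y => sheetKernel m n (mulConj x y).1 (mulConj x y).2) (ENNReal.ofReal q)
      (bidiscMeasure m n) := by
  refine (memLp_inv_norm_snd_pow hm hq h).of_le_mul
    (c := 1 / (1 - ‖x.1‖) ^ 2 * (1 / (1 - ‖x.2‖) ^ 2 * (1 / ‖x.2‖ ^ (m + n - 1))))
    (measurable_sheetKernel_mulConj.comp
      (measurable_const.prodMk measurable_id)).aestronglyMeasurable ?_
  filter_upwards [ae_bidiscMeasure_mem] with y hy
  refine (norm_sheetKernel_mulConj_le hx hy).trans (le_of_eq ?_)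
  rw [Real.norm_of_nonneg (by positivity)]
  simp only [one_div, mul_inv]
  ring

/-- The reproducing property, lifted to the bidisc: for `h` in the Bergman space of the Hartogs
triangle, `τ^(m+n-1) h(v τ^n, τ^m)` is square integrable on the punctured bidisc, so the kernels of
the two discs reproduce it. -/
theorem integral_sheetKernel_mul_comp (hm : 0 < m) (hn : 0 < n) {h : ℂ × ℂ → ℂ}
    (hh : MemBergman (hartogsTriangle ((m : ℝ) / n)) 2 h) {x : ℂ × ℂ} (hx : x ∈ puncturedBidisc) :
    ∫ y, sheetKernel m n (mulConj x y).1 (mulConj x y).2 * h (hartogsCover m n y)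
      ∂bidiscMeasure m n = Real.pi ^ 2 * m * h (hartogsCover m n x) := by
  set L := m + n - 1 with hL
  have hx' := mem_puncturedBidisc_iff.1 hx
  set g : ℂ × ℂ → ℂ := fun y => h (hartogsCover m n y) with hg
  have hgL : MemLp g 2 (bidiscMeasure m n) :=
    hh.2.comp_measurePreserving (measurePreserving_hartogsCover hm hn)
  have hgd : DifferentiableOn ℂ g puncturedBidisc :=
    hh.1.comp (differentiable_hartogsCover m n).differentiableOn fun y hy =>
      hartogsCover_mem hm hn hy
  have hgi : Integrable (fun y => g y ^ 2) (bidiscMeasure m n) := by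
    exact (hgL.integrable_mul hgL).congr (.of_forall fun y => (sq (g y)).symm)
  have hv : ∀ τ ∈ Metric.ball (0 : ℂ) 1 \ {0},
      DifferentiableOn ℂ (fun v => g (v, τ)) (Metric.ball 0 1) := fun τ hτ =>
    hgd.comp (f := fun v : ℂ => (v, τ)) (by fun_prop) fun v hv => ⟨hv, hτ⟩
  have hτd : DifferentiableOn ℂ (fun τ => g (x.1, τ)) (Metric.ball 0 1 \ {0}) :=
    hgd.comp (f := fun τ : ℂ => (x.1, τ)) (by fun_prop) fun τ hτ =>
      ⟨mem_ball_zero_iff.2 hx'.1, hτ⟩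
  have hfin : IsFiniteMeasure (volume.restrict (Metric.ball (0 : ℂ) 1)) :=
    ⟨by rw [Measure.restrict_apply MeasurableSet.univ, Set.univ_inter]; exact measure_ball_lt_top⟩
  have hslice : ∀ᵐ τ ∂weightedDisc m n,
      IntegrableOn (fun v => g (v, τ) ^ 2) (Metric.ball 0 1) := hgi.prod_left_ae
  have hint : Integrable (fun y => sheetKernel m n (mulConj x y).1 (mulConj x y).2 * g y)
      (bidiscMeasure m n) := by
    have hk := memLp_sheetKernel_mulConj (m := m) (n := n) hm (q := 2) (by norm_num)
      (by linarith) hx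
    rw [ENNReal.ofReal_ofNat] at hk
    exact hk.integrable_mul hgL
  rw [bidiscMeasure, integral_prod_symm _ hint]
  -- the integral over the first disc, for almost every `τ`
  have hinner : ∀ᵐ τ ∂weightedDisc m n, ∫ v in Metric.ball (0 : ℂ) 1,
      sheetKernel m n (mulConj x (v, τ)).1 (mulConj x (v, τ)).2 * g (v, τ) =
      1 / (1 - x.2 * starRingEnd ℂ τ) ^ 2 * (1 / (x.2 * starRingEnd ℂ τ) ^ L) *
        (Real.pi * g (x.1, τ)) := by
    filter_upwards [ae_weightedDisc_mem, hslice] with τ hτ hs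
    have hi := integrable_of_integrable_sq
      ((hv τ hτ).continuousOn.aestronglyMeasurable Metric.isOpen_ball.measurableSet) hs
    rw [← setIntegral_disc_mul_bergman (hv τ hτ) hi hx'.1, ← integral_const_mul]
    refine integral_congr_ae (.of_forall fun v => ?_)
    simp only [sheetKernel, mulConj, ← hL]
    ring
  rw [integral_congr_ae hinner, integral_weightedDisc]
  -- the remaining integrand is the disc kernel times `τ^L g(x.1, τ)`
  have hHd : DifferentiableOn ℂ (fun τ => τ ^ L * g (x.1, τ)) (Metric.ball 0 1 \ {0}) :=
    (differentiable_pow L).differentiableOn.mul hτd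
  have hHi : IntegrableOn (fun τ => (τ ^ L * g (x.1, τ)) ^ 2) (Metric.ball 0 1) := by
    have h1 := (hgi.integral_norm_prod_right).const_mul (1 / (1 - ‖x.1‖) ^ 2)
    rw [integrable_weightedDisc_iff] at h1
    replace h1 := h1.mono_set (Set.sdiff_subset (t := {0}))
    rw [IntegrableOn, ← Measure.restrict_congr_set puncturedDisc_ae_eq]
    refine h1.mono' ((hHd.pow 2).continuousOn.aestronglyMeasurable measurableSet_puncturedDisc) ?_
    have hs2 : ∀ᵐ τ ∂volume.restrict (Metric.ball (0 : ℂ) 1 \ {0}),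
        IntegrableOn (fun v => g (v, τ) ^ 2) (Metric.ball 0 1) := by
      have := hslice
      unfold weightedDisc at this
      rw [ae_withDensity_iff (by fun_prop)] at this
      filter_upwards [this, ae_restrict_mem measurableSet_puncturedDisc] with τ h2 hτ
      refine h2 ?_
      have hp : 0 < ‖τ‖ := norm_pos_iff.2 hτ.2
      have hmR : (0 : ℝ) < m := by exact_mod_cast hm
      rw [ne_eq, ENNReal.ofReal_eq_zero, not_le]
      positivity
    filter_upwards [hs2, ae_restrict_mem measurableSet_puncturedDisc] with τ h2 hτ
    have h3 := norm_le_setIntegral_disc ((hv τ hτ).pow 2) h2 hx'.1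
    have hmR : (1 : ℝ) ≤ m := by exact_mod_cast hm
    have hp : 0 ≤ ‖τ‖ ^ (2 * L) := by positivity
    simp only [Pi.pow_apply] at h3
    rw [mul_pow, norm_mul, ← pow_mul, norm_pow, mul_comm L 2]
    refine mul_le_mul ?_ h3 (norm_nonneg _) (by positivity)
    nlinarith
  have hfinal := setIntegral_puncturedDisc_mul_bergman hHd hHi hx'.2.1 hx'.2.2
  have hxL : x.2 ^ L ≠ 0 := pow_ne_zero L hx'.2.2
  have hgx : h (hartogsCover m n x) = g (x.1, x.2) := rfl
  rw [hgx]
  have hcalc : ∫ τ in Metric.ball (0 : ℂ) 1, ((m * ‖τ‖ ^ (2 * L) : ℝ) : ℂ) *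
      (1 / (1 - x.2 * starRingEnd ℂ τ) ^ 2 * (1 / (x.2 * starRingEnd ℂ τ) ^ L) *
        (Real.pi * g (x.1, τ))) =
      (Real.pi * m / x.2 ^ L) * ∫ τ in Metric.ball (0 : ℂ) 1,
        τ ^ L * g (x.1, τ) * (1 / (1 - x.2 * starRingEnd ℂ τ) ^ 2) := by
    rw [← integral_const_mul, ← setIntegral_congr_set puncturedDisc_ae_eq,
      ← setIntegral_congr_set puncturedDisc_ae_eq]
    refine setIntegral_congr_fun measurableSet_puncturedDisc fun τ hτ => ?_
    have hτ0 : starRingEnd ℂ τ ≠ 0 := by simpa using hτ.2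
    have hnorm : ((‖τ‖ ^ (2 * L) : ℝ) : ℂ) = τ ^ L * starRingEnd ℂ τ ^ L := by
      rw [pow_mul, ← Complex.normSq_eq_norm_sq, ← mul_pow, Complex.mul_conj]
      push_cast
      rfl
    rw [Complex.ofReal_mul, hnorm, mul_pow, Complex.ofReal_natCast]
    have hτL : starRingEnd ℂ τ ^ L ≠ 0 := pow_ne_zero L hτ0
    generalize 1 / (1 - x.2 * starRingEnd ℂ τ) ^ 2 = A
    field_simp
  rw [hcalc, hfinal]
  field_simp

end

/-! ### Schur estimates on the bidisc -/

section

variable {m n : ℕ}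

/-- The weight in the Schur test on the punctured bidisc. -/
noncomputable def schurWeight (α ε : ℝ) (x : ℂ × ℂ) : ℝ≥0∞ :=
  ENNReal.ofReal ((1 - ‖x.1‖ ^ 2) ^ (-ε)) *
    ENNReal.ofReal (‖x.2‖ ^ (-α) * (1 - ‖x.2‖ ^ 2) ^ (-ε))

theorem measurable_schurWeight (α ε : ℝ) : Measurable (schurWeight α ε) := by
  unfold schurWeight; fun_prop

theorem schurWeight_ne {α ε : ℝ} {x : ℂ × ℂ} (hx : x ∈ puncturedBidisc) :
    schurWeight α ε x ≠ 0 ∧ schurWeight α ε x ≠ ⊤ := by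
  rw [mem_puncturedBidisc_iff] at hx
  have h1 : 0 < 1 - ‖x.1‖ ^ 2 := by nlinarith [norm_nonneg x.1, hx.1]
  have h2 : 0 < 1 - ‖x.2‖ ^ 2 := by nlinarith [norm_nonneg x.2, hx.2.1]
  have h3 : 0 < ‖x.2‖ := norm_pos_iff.2 hx.2.2
  refine ⟨mul_ne_zero ?_ ?_, ENNReal.mul_ne_top ENNReal.ofReal_ne_top ENNReal.ofReal_ne_top⟩
  · rw [ne_eq, ENNReal.ofReal_eq_zero, not_le]; positivity
  · rw [ne_eq, ENNReal.ofReal_eq_zero, not_le]; positivity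

theorem schurWeight_rpow {α ε q : ℝ} (hq : 0 ≤ q) {x : ℂ × ℂ} (hx : x ∈ puncturedBidisc) :
    schurWeight α ε x ^ q = schurWeight (α * q) (ε * q) x := by
  rw [mem_puncturedBidisc_iff] at hx
  have h1 : 0 < 1 - ‖x.1‖ ^ 2 := by nlinarith [norm_nonneg x.1, hx.1]
  have h2 : 0 < 1 - ‖x.2‖ ^ 2 := by nlinarith [norm_nonneg x.2, hx.2.1]
  have h3 : 0 < ‖x.2‖ := norm_pos_iff.2 hx.2.2
  unfold schurWeight
  rw [ENNReal.mul_rpow_of_nonneg _ _ hq, ENNReal.ofReal_rpow_of_nonneg (by positivity) hq,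
    ENNReal.ofReal_rpow_of_nonneg (by positivity) hq,
    Real.mul_rpow (by positivity) (by positivity), ← Real.rpow_mul h1.le, ← Real.rpow_mul h2.le,
    ← Real.rpow_mul h3.le, neg_mul, neg_mul]

theorem schurWeight_deck [NeZero m] (α ε : ℝ) (ζ : rootsOfUnity m ℂ) (x : ℂ × ℂ) :
    schurWeight α ε (deck m n ζ x) = schurWeight α ε x := by
  unfold schurWeight
  rw [norm_deck_fst, norm_deck_snd]

theorem enorm_sheetKernel_mulConj {x y : ℂ × ℂ} :
    ‖sheetKernel m n (mulConj x y).1 (mulConj x y).2‖ₑ =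
      ENNReal.ofReal (1 / ‖1 - x.1 * starRingEnd ℂ y.1‖ ^ 2) *
        ENNReal.ofReal (1 / ‖1 - x.2 * starRingEnd ℂ y.2‖ ^ 2 *
          (1 / (‖x.2‖ ^ (m + n - 1) * ‖y.2‖ ^ (m + n - 1)))) := by
  rw [← ENNReal.ofReal_mul (by positivity), ← ofReal_norm]
  simp [sheetKernel, mulConj, mul_pow]

theorem exists_lintegral_sheetKernel_schurWeight_le {α ε : ℝ} (h0 : 0 < ε) (h1 : ε < 1)
    (hα : ((m + n - 1 : ℕ) : ℝ) ≤ α) (hα2 : α < ((m + n - 1 : ℕ) : ℝ) + 2) :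
    ∃ C : ℝ≥0, ∀ x ∈ puncturedBidisc,
      ∫⁻ y, ‖sheetKernel m n (mulConj x y).1 (mulConj x y).2‖ₑ * schurWeight α ε y
        ∂bidiscMeasure m n ≤ C * schurWeight α ε x := by
  set L := m + n - 1 with hL
  obtain ⟨C₁, hC₁⟩ := exists_setLIntegral_disc_forelliRudin_le h0 h1 (β := 0) (by norm_num)
  obtain ⟨C₂, hC₂⟩ := exists_setLIntegral_disc_forelliRudin_le h0 h1 (β := α - L) (by linarith)
  refine ⟨m * C₁ * C₂, fun x hx => ?_⟩
  obtain ⟨hx1, hx2, hx0⟩ := mem_puncturedBidisc_iff.1 hx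
  have hxp : 0 < ‖x.2‖ := norm_pos_iff.2 hx0
  have hconj := Complex.continuous_conj.measurable
  set F : ℂ → ℝ≥0∞ := fun v => ENNReal.ofReal (1 / ‖1 - x.1 * starRingEnd ℂ v‖ ^ 2) *
    ENNReal.ofReal ((1 - ‖v‖ ^ 2) ^ (-ε)) with hF
  set G : ℂ → ℝ≥0∞ := fun τ => ENNReal.ofReal (1 / ‖1 - x.2 * starRingEnd ℂ τ‖ ^ 2 *
    (1 / (‖x.2‖ ^ L * ‖τ‖ ^ L))) * ENNReal.ofReal (‖τ‖ ^ (-α) * (1 - ‖τ‖ ^ 2) ^ (-ε)) with hG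
  have hFm : Measurable F := by fun_prop
  have hGm : Measurable G := by fun_prop
  have e1 : ∫⁻ y, ‖sheetKernel m n (mulConj x y).1 (mulConj x y).2‖ₑ * schurWeight α ε y
      ∂bidiscMeasure m n = (∫⁻ v in Metric.ball (0 : ℂ) 1, F v) * ∫⁻ τ, G τ ∂weightedDisc m n := by
    rw [bidiscMeasure, ← lintegral_prod_mul hFm.aemeasurable hGm.aemeasurable]
    refine lintegral_congr fun y => ?_
    rw [enorm_sheetKernel_mulConj, schurWeight, hF, hG]
    ring
  have e2 : ∫⁻ v in Metric.ball (0 : ℂ) 1, F v ≤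
      C₁ * ENNReal.ofReal ((1 - ‖x.1‖ ^ 2) ^ (-ε)) := by
    refine le_trans (le_of_eq (lintegral_congr fun v => ?_)) (hC₁ x.1 hx1)
    rw [hF]
    simp only
    rw [← ENNReal.ofReal_mul (by positivity)]
    congr 1
    rw [neg_zero, Real.rpow_zero]
    ring
  have e3 : ∫⁻ τ, G τ ∂weightedDisc m n ≤
      m * C₂ * ENNReal.ofReal (‖x.2‖ ^ (-α) * (1 - ‖x.2‖ ^ 2) ^ (-ε)) := by
    have hx2' : 0 < 1 - ‖x.2‖ ^ 2 := by nlinarith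
    rw [lintegral_weightedDisc]
    have e4 : ∀ τ ∈ Metric.ball (0 : ℂ) 1 \ {0},
        ENNReal.ofReal (m * ‖τ‖ ^ (2 * L)) * G τ = ENNReal.ofReal (m * (1 / ‖x.2‖ ^ L)) *
          ENNReal.ofReal (‖τ‖ ^ (-(α - L)) * (1 - ‖τ‖ ^ 2) ^ (-ε) *
            (1 / ‖1 - x.2 * starRingEnd ℂ τ‖ ^ 2)) := by
      intro τ hτ
      have hp : 0 < ‖τ‖ := norm_pos_iff.2 hτ.2
      rw [hG]
      simp only
      rw [← ENNReal.ofReal_mul (by positivity), ← ENNReal.ofReal_mul (by positivity),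
        ← ENNReal.ofReal_mul (by positivity)]
      congr 1
      rw [neg_sub, sub_eq_add_neg (L : ℝ) α, Real.rpow_add hp, Real.rpow_natCast, two_mul, pow_add]
      generalize (1 - ‖τ‖ ^ 2) ^ (-ε) = A
      generalize ‖τ‖ ^ (-α) = B
      generalize 1 / ‖1 - x.2 * starRingEnd ℂ τ‖ ^ 2 = D
      field_simp
    rw [setLIntegral_congr_fun measurableSet_puncturedDisc e4,
      lintegral_const_mul' _ _ ENNReal.ofReal_ne_top, setLIntegral_puncturedDisc]
    calc _ ≤ ENNReal.ofReal (m * (1 / ‖x.2‖ ^ L)) *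
          (C₂ * ENNReal.ofReal ((1 - ‖x.2‖ ^ 2) ^ (-ε))) := by
            gcongr
            exact hC₂ x.2 hx2
      _ ≤ ENNReal.ofReal (m * ‖x.2‖ ^ (-α)) *
          (C₂ * ENNReal.ofReal ((1 - ‖x.2‖ ^ 2) ^ (-ε))) := by
            gcongr
            rw [one_div, ← Real.rpow_natCast, ← Real.rpow_neg hxp.le]
            exact Real.rpow_le_rpow_of_exponent_ge hxp hx2.le (by linarith)
      _ = _ := by
            rw [ENNReal.ofReal_mul (by positivity), ENNReal.ofReal_mul (by positivity),
              ENNReal.ofReal_natCast]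
            ring
  rw [e1]
  refine (mul_le_mul' e2 e3).trans (le_of_eq ?_)
  rw [schurWeight]
  push_cast
  ring

theorem measurable_liftedKernel [NeZero m] : Measurable (Function.uncurry (liftedKernel m n)) := by
  have hsum : Measurable fun z : (ℂ × ℂ) × (ℂ × ℂ) => ∑ ζ : rootsOfUnity m ℂ,
      sheetKernel m n (mulConj (deck m n ζ z.1) z.2).1 (mulConj (deck m n ζ z.1) z.2).2 := by
    refine Finset.measurable_fun_sum _ fun ζ _ => ?_
    have hd : Measurable (deck m n ζ) := by unfold deck; fun_prop
    have hp : Measurable fun z : (ℂ × ℂ) × (ℂ × ℂ) => (deck m n ζ z.1, z.2) :=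
      (hd.comp measurable_fst).prodMk measurable_snd
    have hc := Measurable.comp (g := fun z : (ℂ × ℂ) × (ℂ × ℂ) =>
      sheetKernel m n (mulConj z.1 z.2).1 (mulConj z.1 z.2).2) measurable_sheetKernel_mulConj hp
    simpa only [Function.comp_def] using hc
  have hc := hsum.const_mul (1 / (Real.pi ^ 2 * m ^ 2) : ℂ)
  simpa only [Function.uncurry_def, liftedKernel] using hc

theorem conj_liftedKernel [NeZero m] {x y : ℂ × ℂ} (hx : x ∈ puncturedBidisc)
    (hy : y ∈ puncturedBidisc) :
    starRingEnd ℂ (liftedKernel m n x y) = liftedKernel m n y x := by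
  rw [← hartogsKernel_hartogsCover hx hy, ← hartogsKernel_hartogsCover hy hx, conj_hartogsKernel]

theorem exists_lintegral_liftedKernel_schurWeight_le [NeZero m] {α ε : ℝ} (h0 : 0 < ε) (h1 : ε < 1)
    (hα : ((m + n - 1 : ℕ) : ℝ) ≤ α) (hα2 : α < ((m + n - 1 : ℕ) : ℝ) + 2) :
    ∃ C : ℝ≥0, ∀ x ∈ puncturedBidisc,
      ∫⁻ y, ‖liftedKernel m n x y‖ₑ * schurWeight α ε y ∂bidiscMeasure m n ≤
        C * schurWeight α ε x := by
  obtain ⟨C, hC⟩ := exists_lintegral_sheetKernel_schurWeight_le (m := m) (n := n) h0 h1 hα hα2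
  refine ⟨‖(1 / (Real.pi ^ 2 * m ^ 2) : ℂ)‖₊ * (Fintype.card (rootsOfUnity m ℂ) * C),
    fun x hx => ?_⟩
  have hmeas : ∀ ζ : rootsOfUnity m ℂ, Measurable fun y =>
      ‖sheetKernel m n (mulConj (deck m n ζ x) y).1 (mulConj (deck m n ζ x) y).2‖ₑ *
        schurWeight α ε y := fun ζ =>
    (measurable_sheetKernel_mulConj.comp (measurable_const.prodMk measurable_id)).enorm.mul
      (measurable_schurWeight α ε)
  calc ∫⁻ y, ‖liftedKernel m n x y‖ₑ * schurWeight α ε y ∂bidiscMeasure m n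
      ≤ ∫⁻ y, ‖(1 / (Real.pi ^ 2 * m ^ 2) : ℂ)‖ₑ * ∑ ζ : rootsOfUnity m ℂ,
          ‖sheetKernel m n (mulConj (deck m n ζ x) y).1 (mulConj (deck m n ζ x) y).2‖ₑ *
            schurWeight α ε y ∂bidiscMeasure m n := by
        refine lintegral_mono fun y => ?_
        rw [liftedKernel, enorm_mul, mul_assoc, ← Finset.sum_mul]
        gcongr
        exact enorm_sum_le _ _
    _ = ‖(1 / (Real.pi ^ 2 * m ^ 2) : ℂ)‖ₑ * ∑ ζ : rootsOfUnity m ℂ, ∫⁻ y,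
          ‖sheetKernel m n (mulConj (deck m n ζ x) y).1 (mulConj (deck m n ζ x) y).2‖ₑ *
            schurWeight α ε y ∂bidiscMeasure m n := by
        rw [lintegral_const_mul' _ _ enorm_ne_top, lintegral_finsetSum _ fun ζ _ => hmeas ζ]
    _ ≤ ‖(1 / (Real.pi ^ 2 * m ^ 2) : ℂ)‖ₑ * ∑ ζ : rootsOfUnity m ℂ, C * schurWeight α ε x := by
        gcongr with ζ
        have := hC _ (deck_mem (n := n) ζ hx)
        rwa [schurWeight_deck] at this
    _ = _ := by
        rw [Finset.sum_const, Finset.card_univ, nsmul_eq_mul]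
        push_cast
        rw [enorm_eq_nnnorm]
        ring

/-- The lifted kernel defines a bounded operator on `L^p` in the range of the theorem. The exponent
`max (L/p) (L/q)` of the weight at `τ = 0` is chosen such that its multiples by `p` and by `q` lie
in `[L, L + 2)`, where `L = m + n - 1`. -/
theorem exists_lintegral_liftedKernel_rpow_le [NeZero m] {p q : ℝ} (hpq : p.HolderConjugate q)
    (hL1 : p * ((m + n - 1 : ℕ) : ℝ) < 2 * ((m + n - 1 : ℕ) : ℝ) + 2)
    (hL2 : q * ((m + n - 1 : ℕ) : ℝ) < 2 * ((m + n - 1 : ℕ) : ℝ) + 2) :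
    ∃ C : ℝ≥0, ∀ g : ℂ × ℂ → ℝ≥0∞, AEMeasurable g (bidiscMeasure m n) →
      ∫⁻ x, (∫⁻ y, ‖liftedKernel m n x y‖ₑ * g y ∂bidiscMeasure m n) ^ p ∂bidiscMeasure m n ≤
        (C : ℝ≥0∞) ^ p * ∫⁻ x, g x ^ p ∂bidiscMeasure m n := by
  set L : ℝ := ((m + n - 1 : ℕ) : ℝ) with hL
  have hL0 : 0 ≤ L := Nat.cast_nonneg _
  have hp := hpq.pos
  have hq := hpq.symm.pos
  have hp1 := hpq.lt
  have hq1 := hpq.symm.lt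
  have hmul := hpq.mul_eq_add
  set α := max (L / p) (L / q) with hα
  set ε := 1 / (p * q) with hε
  have hεq : ε * q = 1 / p := by rw [hε]; field_simp
  have hεp : ε * p = 1 / q := by rw [hε]; field_simp
  have hαq : α * q = max (L * (q - 1)) L := by
    rw [hα, max_mul_of_nonneg _ _ hq.le, div_mul_cancel₀ _ hq.ne']
    congr 1
    field_simp
    linear_combination (-L) * hmul
  have hαp : α * p = max L (L * (p - 1)) := by
    rw [hα, max_mul_of_nonneg _ _ hp.le, div_mul_cancel₀ _ hp.ne']
    congr 1
    field_simp
    linear_combination (-L) * hmul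
  have hinv : ∀ r : ℝ, 1 < r → 0 < 1 / r ∧ 1 / r < 1 := fun r hr =>
    ⟨by positivity, (div_lt_one (by linarith)).2 hr⟩
  obtain ⟨C₁, hC₁⟩ := exists_lintegral_liftedKernel_schurWeight_le (m := m) (n := n)
    (α := α * q) (ε := ε * q)
    (by rw [hεq]; exact (hinv p hp1).1) (by rw [hεq]; exact (hinv p hp1).2)
    (by rw [hαq]; exact le_max_right _ _) (by rw [hαq]; exact max_lt (by linarith) (by linarith))
  obtain ⟨C₂, hC₂⟩ := exists_lintegral_liftedKernel_schurWeight_le (m := m) (n := n)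
    (α := α * p) (ε := ε * p)
    (by rw [hεp]; exact (hinv q hq1).1) (by rw [hεp]; exact (hinv q hq1).2)
    (by rw [hαp]; exact le_max_left _ _) (by rw [hαp]; exact max_lt (by linarith) (by linarith))
  refine ⟨max C₁ C₂, fun g hg => ?_⟩
  refine lintegral_rpow_le_of_schur (h := schurWeight α ε) (k := fun x y => ‖liftedKernel m n x y‖ₑ)
    measurable_liftedKernel.enorm (measurable_schurWeight α ε) ?_ hpq ?_ ?_ hg
  · filter_upwards [ae_bidiscMeasure_mem] with x hx using schurWeight_ne hx
  · filter_upwards [ae_bidiscMeasure_mem] with x hx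
    rw [schurWeight_rpow hq.le hx]
    calc _ = ∫⁻ y, ‖liftedKernel m n x y‖ₑ * schurWeight (α * q) (ε * q) y ∂bidiscMeasure m n := by
          refine lintegral_congr_ae ?_
          filter_upwards [ae_bidiscMeasure_mem] with y hy
          rw [schurWeight_rpow hq.le hy]
      _ ≤ C₁ * schurWeight (α * q) (ε * q) x := hC₁ x hx
      _ ≤ _ := by gcongr; exact le_max_left _ _
  · filter_upwards [ae_bidiscMeasure_mem] with y hy
    rw [schurWeight_rpow hp.le hy]
    calc _ = ∫⁻ x, ‖liftedKernel m n y x‖ₑ * schurWeight (α * p) (ε * p) x ∂bidiscMeasure m n := by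
          refine lintegral_congr_ae ?_
          filter_upwards [ae_bidiscMeasure_mem] with x hx
          rw [schurWeight_rpow hp.le hx, ← conj_liftedKernel hy hx]
          congr 1
          exact RCLike.enorm_conj _
      _ ≤ C₂ * schurWeight (α * p) (ε * p) y := hC₂ y hy
      _ ≤ _ := by gcongr; exact le_max_right _ _

end

/-! ### The integral operator on the Hartogs triangle -/

section

variable {m n : ℕ} [NeZero m]

theorem memLp_kernelMajorant (hn : 0 < n) {q : ℝ} (hq : 0 < q)
    (h : q * ((m + n - 1 : ℕ) : ℝ) < 2 * ((m + n - 1 : ℕ) : ℝ) + 2) :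
    MemLp (kernelMajorant m n) (ENNReal.ofReal q)
      (volume.restrict (hartogsTriangle ((m : ℝ) / n))) := by
  have hm := NeZero.pos m
  have hmeas : Measurable (kernelMajorant m n) := by unfold kernelMajorant; fun_prop
  rw [← map_hartogsCover hm hn, memLp_map_measure_iff hmeas.aestronglyMeasurable
    (measurable_hartogsCover m n).aemeasurable]
  refine (memLp_inv_norm_snd_pow hm hq h).ae_eq (.of_forall fun y => ?_)
  simp only [Function.comp_def, kernelMajorant, norm_snd_hartogsCover_rpow, one_div]

theorem aestronglyMeasurable_hartogsKernel (hn : 0 < n) {z : ℂ × ℂ}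
    (hz : z ∈ hartogsTriangle ((m : ℝ) / n)) :
    AEStronglyMeasurable (hartogsKernel m n z)
      (volume.restrict (hartogsTriangle ((m : ℝ) / n))) :=
  (continuousOn_hartogsKernel hn hz).aestronglyMeasurable
    (isOpen_hartogsTriangle_div hn).measurableSet

theorem memLp_hartogsKernel (hn : 0 < n) {q : ℝ} (hq : 0 < q)
    (h : q * ((m + n - 1 : ℕ) : ℝ) < 2 * ((m + n - 1 : ℕ) : ℝ) + 2) {z : ℂ × ℂ}
    (hz : z ∈ hartogsTriangle ((m : ℝ) / n)) :
    MemLp (hartogsKernel m n z) (ENNReal.ofReal q)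
      (volume.restrict (hartogsTriangle ((m : ℝ) / n))) := by
  refine (memLp_kernelMajorant hn hq h).of_le_mul (c := kernelBound m n z)
    (aestronglyMeasurable_hartogsKernel hn hz) ?_
  filter_upwards [ae_restrict_mem (isOpen_hartogsTriangle_div hn).measurableSet] with w hw
  refine (norm_hartogsKernel_le hn hz hw).trans (le_of_eq ?_)
  rw [Real.norm_of_nonneg]
  unfold kernelMajorant
  positivity

/-- The integral operator with kernel `hartogsKernel m n`. -/
noncomputable def hartogsOperator (m n : ℕ) [NeZero m] (f : ℂ × ℂ → ℂ) (z : ℂ × ℂ) : ℂ :=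
  ∫ w in hartogsTriangle ((m : ℝ) / n), hartogsKernel m n z w * f w

theorem differentiableOn_hartogsOperator (hn : 0 < n) {f : ℂ × ℂ → ℂ}
    (hf : AEStronglyMeasurable f (volume.restrict (hartogsTriangle ((m : ℝ) / n))))
    (hi : IntegrableOn (fun w => kernelMajorant m n w * ‖f w‖) (hartogsTriangle ((m : ℝ) / n))) :
    DifferentiableOn ℂ (hartogsOperator m n f) (hartogsTriangle ((m : ℝ) / n)) := by
  have hΩ := isOpen_hartogsTriangle_div (m := m) hn
  refine differentiableOn_integral_of_locally_dominated hΩ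
    (fun z hz => (aestronglyMeasurable_hartogsKernel hn hz).mul hf) ?_ ?_
  · filter_upwards [ae_restrict_mem hΩ.measurableSet] with w hw
    exact (differentiableOn_hartogsKernel hn hw).mul_const _
  · intro z hz
    have hc : ContinuousAt (kernelBound m n) z :=
      (continuousOn_kernelBound hn).continuousAt (hΩ.mem_nhds hz)
    refine ⟨{u | kernelBound m n u < kernelBound m n z + 1} ∩ hartogsTriangle ((m : ℝ) / n),
      Filter.inter_mem (hc.eventually_lt continuousAt_const (by linarith)) (hΩ.mem_nhds hz),
      fun w => (kernelBound m n z + 1) * (kernelMajorant m n w * ‖f w‖), hi.const_mul _, ?_⟩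
    filter_upwards [ae_restrict_mem hΩ.measurableSet] with w hw u hu
    have hM : 0 ≤ kernelMajorant m n w := by unfold kernelMajorant; positivity
    have hu1 : kernelBound m n u < kernelBound m n z + 1 := hu.1
    rw [norm_mul, ← mul_assoc]
    gcongr
    exact (norm_hartogsKernel_le hn hu.2 hw).trans (by gcongr)

theorem enorm_hartogsOperator_hartogsCover_le (hn : 0 < n) {f : ℂ × ℂ → ℂ}
    (hf : AEStronglyMeasurable f (volume.restrict (hartogsTriangle ((m : ℝ) / n)))) {x : ℂ × ℂ}
    (hx : x ∈ puncturedBidisc) :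
    ‖hartogsOperator m n f (hartogsCover m n x)‖ₑ ≤
      ∫⁻ y, ‖liftedKernel m n x y‖ₑ * ‖f (hartogsCover m n y)‖ₑ ∂bidiscMeasure m n := by
  have hm := NeZero.pos m
  have hz := hartogsCover_mem hm hn hx
  refine (enorm_integral_le_lintegral_enorm _).trans (le_of_eq ?_)
  have hae := ((aestronglyMeasurable_hartogsKernel hn hz).mul hf).enorm
  rw [← map_hartogsCover hm hn] at hae ⊢
  have h1 := lintegral_map' hae (measurable_hartogsCover m n).aemeasurable
  simp only [Pi.mul_apply] at h1
  rw [h1]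
  refine lintegral_congr_ae ?_
  filter_upwards [ae_bidiscMeasure_mem] with y hy
  rw [enorm_mul, hartogsKernel_hartogsCover hx hy]

/-- The lower bound on `p` is the upper bound for the conjugate exponent. -/
theorem lt_of_holderConjugate {p q L : ℝ} (hpq : p.HolderConjugate q)
    (h : 2 * L + 2 < p * (L + 2)) : q * L < 2 * L + 2 := by
  have hq1 : 0 < q - 1 := by linarith [hpq.symm.lt]
  have hmul := hpq.mul_eq_add
  have h1 : (2 * L + 2) * (q - 1) < p * (L + 2) * (q - 1) := by gcongr
  have h2 : p * (L + 2) * (q - 1) = (L + 2) * q := by linear_combination (L + 2) * hmul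
  linarith

/-- For `p` in the range of the theorem the operator is bounded on `L^p`, with absolutely convergent
integrals and holomorphic values. -/
theorem exists_hartogsOperator_bound (hn : 0 < n) {p : ℝ} (hp : 1 < p)
    (hlo : 2 * ((m + n - 1 : ℕ) : ℝ) + 2 < p * (((m + n - 1 : ℕ) : ℝ) + 2))
    (hhi : p * ((m + n - 1 : ℕ) : ℝ) < 2 * ((m + n - 1 : ℕ) : ℝ) + 2) :
    ∃ C : ℝ≥0, ∀ f : ℂ × ℂ → ℂ,
      MemLp f (ENNReal.ofReal p) (volume.restrict (hartogsTriangle ((m : ℝ) / n))) →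
      (∀ z ∈ hartogsTriangle ((m : ℝ) / n),
        IntegrableOn (fun w => hartogsKernel m n z w * f w) (hartogsTriangle ((m : ℝ) / n))) ∧
      MemBergman (hartogsTriangle ((m : ℝ) / n)) (ENNReal.ofReal p) (hartogsOperator m n f) ∧
      eLpNorm (hartogsOperator m n f) (ENNReal.ofReal p)
          (volume.restrict (hartogsTriangle ((m : ℝ) / n))) ≤
        C * eLpNorm f (ENNReal.ofReal p) (volume.restrict (hartogsTriangle ((m : ℝ) / n))) := by
  have hm := NeZero.pos m
  have hp0 : 0 < p := by linarith
  have hpq : p.HolderConjugate p.conjExponent := Real.HolderConjugate.conjExponent hp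
  set q := p.conjExponent with hq
  have hqL := lt_of_holderConjugate hpq hlo
  have hΩ := isOpen_hartogsTriangle_div (m := m) hn
  obtain ⟨C, hC⟩ := exists_lintegral_liftedKernel_rpow_le (m := m) (n := n) hpq hhi hqL
  refine ⟨C, fun f hf => ?_⟩
  have hconj : ENNReal.HolderConjugate (ENNReal.ofReal q) (ENNReal.ofReal p) :=
    hpq.symm.ennrealOfReal
  have hint : ∀ z ∈ hartogsTriangle ((m : ℝ) / n),
      IntegrableOn (fun w => hartogsKernel m n z w * f w) (hartogsTriangle ((m : ℝ) / n)) :=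
    fun z hz => (memLp_hartogsKernel hn hpq.symm.pos hqL hz).integrable_mul hf
  have hhol := differentiableOn_hartogsOperator hn hf.1
    ((memLp_kernelMajorant hn hpq.symm.pos hqL).integrable_mul hf.norm)
  have hmeas : AEStronglyMeasurable (hartogsOperator m n f)
      (volume.restrict (hartogsTriangle ((m : ℝ) / n))) :=
    hhol.continuousOn.aestronglyMeasurable hΩ.measurableSet
  have hΦ := measurePreserving_hartogsCover hm hn
  have hnorm : eLpNorm (hartogsOperator m n f) (ENNReal.ofReal p)
      (volume.restrict (hartogsTriangle ((m : ℝ) / n))) ≤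
      C * eLpNorm f (ENNReal.ofReal p) (volume.restrict (hartogsTriangle ((m : ℝ) / n))) := by
    have hp1 : ENNReal.ofReal p ≠ 0 := by simpa using hp0
    rw [← eLpNorm_comp_measurePreserving hmeas hΦ, ← eLpNorm_comp_measurePreserving hf.1 hΦ,
      eLpNorm_eq_lintegral_rpow_enorm_toReal hp1 ENNReal.ofReal_ne_top,
      eLpNorm_eq_lintegral_rpow_enorm_toReal hp1 ENNReal.ofReal_ne_top,
      ENNReal.toReal_ofReal hp0.le]
    have hg : AEMeasurable (fun y => ‖f (hartogsCover m n y)‖ₑ) (bidiscMeasure m n) :=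
      (hf.1.comp_measurePreserving hΦ).enorm
    have h1 : ∫⁻ x, ‖(hartogsOperator m n f ∘ hartogsCover m n) x‖ₑ ^ p ∂bidiscMeasure m n ≤
        (C : ℝ≥0∞) ^ p * ∫⁻ x, ‖(f ∘ hartogsCover m n) x‖ₑ ^ p ∂bidiscMeasure m n := by
      refine (lintegral_mono_ae ?_).trans (hC _ hg)
      filter_upwards [ae_bidiscMeasure_mem] with x hx
      exact ENNReal.rpow_le_rpow (enorm_hartogsOperator_hartogsCover_le hn hf.1 hx) hp0.le
    calc _ ≤ ((C : ℝ≥0∞) ^ p *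
          ∫⁻ x, ‖(f ∘ hartogsCover m n) x‖ₑ ^ p ∂bidiscMeasure m n) ^ (1 / p) := by gcongr
      _ = _ := by
        rw [ENNReal.mul_rpow_of_nonneg _ _ (by positivity), ← ENNReal.rpow_mul,
          mul_one_div_cancel hp0.ne', ENNReal.rpow_one]
  exact ⟨hint, ⟨hhol, hmeas, hnorm.trans_lt (ENNReal.mul_lt_top ENNReal.coe_lt_top hf.2)⟩, hnorm⟩

/-! ### The kernel represents the Bergman projection -/

theorem card_rootsOfUnity_complex : (Fintype.card (rootsOfUnity m ℂ) : ℂ) = m := by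
  rw [← Nat.card_eq_fintype_card, Complex.card_rootsOfUnity m]

theorem integral_liftedKernel_mul_comp (hn : 0 < n) {h : ℂ × ℂ → ℂ}
    (hh : MemBergman (hartogsTriangle ((m : ℝ) / n)) 2 h) {x : ℂ × ℂ} (hx : x ∈ puncturedBidisc) :
    ∫ y, liftedKernel m n x y * h (hartogsCover m n y) ∂bidiscMeasure m n =
      h (hartogsCover m n x) := by
  have hm := NeZero.pos m
  have hmC : (m : ℂ) ≠ 0 := by exact_mod_cast hm.ne'
  have hπ : (Real.pi : ℂ) ≠ 0 := by exact_mod_cast Real.pi_ne_zero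
  have hhL : MemLp (fun y => h (hartogsCover m n y)) 2 (bidiscMeasure m n) :=
    hh.2.comp_measurePreserving (measurePreserving_hartogsCover hm hn)
  have hi : ∀ ζ : rootsOfUnity m ℂ, Integrable (fun y =>
      sheetKernel m n (mulConj (deck m n ζ x) y).1 (mulConj (deck m n ζ x) y).2 *
        h (hartogsCover m n y)) (bidiscMeasure m n) := by
    intro ζ
    have hk := memLp_sheetKernel_mulConj (m := m) (n := n) hm (q := 2) (by norm_num) (by linarith)
      (deck_mem (n := n) ζ hx)
    rw [ENNReal.ofReal_ofNat] at hk
    exact hk.integrable_mul hhL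
  have e : ∀ y, liftedKernel m n x y * h (hartogsCover m n y) =
      1 / (Real.pi ^ 2 * m ^ 2) * ∑ ζ : rootsOfUnity m ℂ,
        sheetKernel m n (mulConj (deck m n ζ x) y).1 (mulConj (deck m n ζ x) y).2 *
          h (hartogsCover m n y) := by
    intro y
    rw [liftedKernel, mul_assoc, Finset.sum_mul]
  simp only [e]
  rw [integral_const_mul, integral_finsetSum _ fun ζ _ => hi ζ]
  have e2 : ∀ ζ : rootsOfUnity m ℂ, ∫ y, sheetKernel m n (mulConj (deck m n ζ x) y).1
      (mulConj (deck m n ζ x) y).2 * h (hartogsCover m n y) ∂bidiscMeasure m n =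
      Real.pi ^ 2 * m * h (hartogsCover m n x) := by
    intro ζ
    rw [integral_sheetKernel_mul_comp hm hn hh (deck_mem ζ hx), hartogsCover_deck]
  simp only [e2]
  rw [Finset.sum_const, Finset.card_univ, nsmul_eq_mul, card_rootsOfUnity_complex]
  field_simp

theorem hartogsOperator_hartogsCover (hn : 0 < n) {f : ℂ × ℂ → ℂ}
    (hf : AEStronglyMeasurable f (volume.restrict (hartogsTriangle ((m : ℝ) / n)))) {x : ℂ × ℂ}
    (hx : x ∈ puncturedBidisc) :
    hartogsOperator m n f (hartogsCover m n x) =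
      ∫ y, liftedKernel m n x y * f (hartogsCover m n y) ∂bidiscMeasure m n := by
  have hm := NeZero.pos m
  have hz := hartogsCover_mem hm hn hx
  have hae := (aestronglyMeasurable_hartogsKernel hn hz).mul hf
  unfold hartogsOperator
  rw [← map_hartogsCover hm hn] at hae ⊢
  have h1 := integral_map (measurable_hartogsCover m n).aemeasurable hae
  simp only [Pi.mul_apply] at h1
  rw [h1]
  refine integral_congr_ae ?_
  filter_upwards [ae_bidiscMeasure_mem] with y hy
  rw [hartogsKernel_hartogsCover hx hy]

/-- Symmetry of the operator against the Bergman space; Fubini is justified by the Schur bound for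
`p = 2`. -/
theorem integral_hartogsOperator_mul_conj (hn : 0 < n) {f h : ℂ × ℂ → ℂ}
    (hf : MemLp f 2 (volume.restrict (hartogsTriangle ((m : ℝ) / n))))
    (hh : MemBergman (hartogsTriangle ((m : ℝ) / n)) 2 h)
    (hPf : MemLp (hartogsOperator m n f) 2 (volume.restrict (hartogsTriangle ((m : ℝ) / n)))) :
    ∫ z in hartogsTriangle ((m : ℝ) / n), hartogsOperator m n f z * starRingEnd ℂ (h z) =
      ∫ z in hartogsTriangle ((m : ℝ) / n), f z * starRingEnd ℂ (h z) := by
  have hm := NeZero.pos m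
  have hΦ := measurePreserving_hartogsCover hm hn
  have hhs : MemLp (fun z => starRingEnd ℂ (h z)) 2
      (volume.restrict (hartogsTriangle ((m : ℝ) / n))) := hh.2.star
  set F : ℂ × ℂ → ℂ := fun y => f (hartogsCover m n y) with hF
  set H : ℂ × ℂ → ℂ := fun y => h (hartogsCover m n y) with hH
  have hFL : MemLp F 2 (bidiscMeasure m n) := hf.comp_measurePreserving hΦ
  have hHL : MemLp H 2 (bidiscMeasure m n) := hh.2.comp_measurePreserving hΦ
  have hlift : ∀ g : ℂ × ℂ → ℂ, MemLp g 2 (volume.restrict (hartogsTriangle ((m : ℝ) / n))) →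
      ∫ z in hartogsTriangle ((m : ℝ) / n), g z * starRingEnd ℂ (h z) =
        ∫ x, g (hartogsCover m n x) * starRingEnd ℂ (H x) ∂bidiscMeasure m n := by
    intro g hg
    have hae := hg.1.mul hhs.1
    rw [← map_hartogsCover hm hn] at hae ⊢
    exact integral_map (measurable_hartogsCover m n).aemeasurable hae
  rw [hlift _ hPf, hlift _ hf]
  have hL0 : (0 : ℝ) ≤ ((m + n - 1 : ℕ) : ℝ) := Nat.cast_nonneg _
  obtain ⟨C, hC⟩ := exists_lintegral_liftedKernel_rpow_le (m := m) (n := n)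
    (Real.HolderConjugate.two_two) (by linarith) (by linarith)
  have hsq : ∀ g : ℂ × ℂ → ℂ, MemLp g 2 (bidiscMeasure m n) →
      ∫⁻ x, ‖g x‖ₑ ^ (2 : ℝ) ∂bidiscMeasure m n < ⊤ := by
    intro g hg
    have := hg.2
    rw [eLpNorm_lt_top_iff_lintegral_rpow_enorm_lt_top (by norm_num) (by norm_num)] at this
    simpa using this
  have hint : Integrable (Function.uncurry fun x y =>
      liftedKernel m n x y * F y * starRingEnd ℂ (H x))
      ((bidiscMeasure m n).prod (bidiscMeasure m n)) := by
    have hmeas : AEStronglyMeasurable (Function.uncurry fun x y =>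
        liftedKernel m n x y * F y * starRingEnd ℂ (H x))
        ((bidiscMeasure m n).prod (bidiscMeasure m n)) :=
      (measurable_liftedKernel.aestronglyMeasurable.mul hFL.1.comp_snd).mul
        (RCLike.continuous_conj.comp_aestronglyMeasurable hHL.1).comp_fst
    refine ⟨hmeas, ?_⟩
    rw [hasFiniteIntegral_iff_enorm, lintegral_prod _ hmeas.enorm]
    have e : ∀ x, ∫⁻ y, ‖Function.uncurry (fun x y =>
        liftedKernel m n x y * F y * starRingEnd ℂ (H x)) (x, y)‖ₑ ∂bidiscMeasure m n =
        (∫⁻ y, ‖liftedKernel m n x y‖ₑ * ‖F y‖ₑ ∂bidiscMeasure m n) * ‖H x‖ₑ := by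
      intro x
      rw [← lintegral_mul_const' _ _ enorm_ne_top]
      refine lintegral_congr fun y => ?_
      simp only [Function.uncurry_apply_pair, enorm_mul]
      congr 1
      exact RCLike.enorm_conj _
    simp only [e]
    have hT : AEMeasurable (fun x => ∫⁻ y, ‖liftedKernel m n x y‖ₑ * ‖F y‖ₑ ∂bidiscMeasure m n)
        (bidiscMeasure m n) :=
      (measurable_liftedKernel.enorm.aemeasurable.mul
        hFL.1.enorm.comp_snd).lintegral_prod_right'
    refine (ENNReal.lintegral_mul_le_Lp_mul_Lq _ Real.HolderConjugate.two_two hT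
      hHL.1.enorm).trans_lt ?_
    refine ENNReal.mul_lt_top (ENNReal.rpow_lt_top_of_nonneg (by norm_num) ?_)
      (ENNReal.rpow_lt_top_of_nonneg (by norm_num) (hsq H hHL).ne)
    exact ((hC _ hFL.1.enorm).trans_lt (ENNReal.mul_lt_top
      (ENNReal.rpow_lt_top_of_nonneg (by norm_num) ENNReal.coe_ne_top) (hsq F hFL))).ne
  calc ∫ x, hartogsOperator m n f (hartogsCover m n x) * starRingEnd ℂ (H x) ∂bidiscMeasure m n
      = ∫ x, ∫ y, liftedKernel m n x y * F y * starRingEnd ℂ (H x) ∂bidiscMeasure m n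
          ∂bidiscMeasure m n := by
        refine integral_congr_ae ?_
        filter_upwards [ae_bidiscMeasure_mem] with x hx
        rw [hartogsOperator_hartogsCover hn hf.1 hx, ← integral_mul_const]
    _ = ∫ y, ∫ x, liftedKernel m n x y * F y * starRingEnd ℂ (H x) ∂bidiscMeasure m n
          ∂bidiscMeasure m n := integral_integral_swap hint
    _ = _ := by
        refine integral_congr_ae ?_
        filter_upwards [ae_bidiscMeasure_mem] with y hy
        have hrep : H y = ∫ x, liftedKernel m n y x * H x ∂bidiscMeasure m n :=
          (integral_liftedKernel_mul_comp hn hh hy).symm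
        rw [hrep, ← integral_conj, ← integral_const_mul]
        refine integral_congr_ae ?_
        filter_upwards [ae_bidiscMeasure_mem] with x hx
        rw [map_mul, conj_liftedKernel hy hx]
        ring

theorem isBergmanKernel_hartogsKernel (hn : 0 < n) :
    IsBergmanKernel (hartogsTriangle ((m : ℝ) / n)) (hartogsKernel m n) := by
  have hm := NeZero.pos m
  have hL : (1 : ℝ) ≤ ((m + n - 1 : ℕ) : ℝ) := by
    have : 1 ≤ m + n - 1 := by omega
    exact_mod_cast this
  refine ⟨fun z hz => ⟨?_, ?_⟩, fun f hf => ?_⟩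
  · simp only [conj_hartogsKernel]
    exact differentiableOn_hartogsKernel hn hz
  · have := memLp_hartogsKernel hn (q := 2) (by norm_num) (by linarith) hz
    rw [ENNReal.ofReal_ofNat] at this
    exact this.star
  · obtain ⟨C, hC⟩ := exists_hartogsOperator_bound (m := m) hn (p := 2) (by norm_num)
      (by linarith) (by linarith)
    rw [ENNReal.ofReal_ofNat] at hC
    obtain ⟨-, hPf, -⟩ := hC f hf
    refine ⟨hPf, fun h hh => ?_⟩
    have hhs : MemLp (fun z => starRingEnd ℂ (h z)) 2
      (volume.restrict (hartogsTriangle ((m : ℝ) / n))) := hh.2.star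
    have e := integral_hartogsOperator_mul_conj hn hf hh hPf.2
    have h1 := integral_sub (hf.integrable_mul hhs) (hPf.2.integrable_mul hhs)
    simp only [Pi.mul_apply] at h1
    rw [e, sub_self] at h1
    rw [← h1]
    refine integral_congr_ae (.of_forall fun w => ?_)
    exact sub_mul _ _ _

theorem bergmanKernel_eq_hartogsKernel (hn : 0 < n) {z w : ℂ × ℂ}
    (hz : z ∈ hartogsTriangle ((m : ℝ) / n)) (hw : w ∈ hartogsTriangle ((m : ℝ) / n)) :
    bergmanKernel (hartogsTriangle ((m : ℝ) / n)) z w = hartogsKernel m n z w := by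
  have hex : ∃ K, IsBergmanKernel (hartogsTriangle ((m : ℝ) / n)) K :=
    ⟨_, isBergmanKernel_hartogsKernel hn⟩
  rw [bergmanKernel, dif_pos hex]
  exact hex.choose_spec.unique (isOpen_hartogsTriangle_div hn)
    (isBergmanKernel_hartogsKernel hn) hz hw

theorem bergmanProjection_eq_hartogsOperator (hn : 0 < n) (f : ℂ × ℂ → ℂ) {z : ℂ × ℂ}
    (hz : z ∈ hartogsTriangle ((m : ℝ) / n)) :
    bergmanProjection (hartogsTriangle ((m : ℝ) / n)) f z = hartogsOperator m n f z := by
  refine setIntegral_congr_fun (isOpen_hartogsTriangle_div hn).measurableSet fun w hw => ?_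
  simp only [bergmanKernel_eq_hartogsKernel hn hz hw]

theorem bergmanProjectionBounded_iff (hn : 0 < n) {p : ℝ≥0∞} :
    BergmanProjectionBounded (hartogsTriangle ((m : ℝ) / n)) p ↔
    ∃ C : ℝ≥0, ∀ f : ℂ × ℂ → ℂ,
      MemLp f p (volume.restrict (hartogsTriangle ((m : ℝ) / n))) →
      (∀ z ∈ hartogsTriangle ((m : ℝ) / n),
        IntegrableOn (fun w => hartogsKernel m n z w * f w) (hartogsTriangle ((m : ℝ) / n))) ∧
      MemBergman (hartogsTriangle ((m : ℝ) / n)) p (hartogsOperator m n f) ∧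
      eLpNorm (hartogsOperator m n f) p (volume.restrict (hartogsTriangle ((m : ℝ) / n))) ≤
        C * eLpNorm f p (volume.restrict (hartogsTriangle ((m : ℝ) / n))) := by
  have hΩ := (isOpen_hartogsTriangle_div (m := m) hn).measurableSet
  unfold BergmanProjectionBounded
  refine exists_congr fun C => forall_congr' fun f => imp_congr_right fun _ => ?_
  have hae : bergmanProjection (hartogsTriangle ((m : ℝ) / n)) f
      =ᵐ[volume.restrict (hartogsTriangle ((m : ℝ) / n))] hartogsOperator m n f := by
    filter_upwards [ae_restrict_mem hΩ] with z hz
    exact bergmanProjection_eq_hartogsOperator hn f hz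
  refine and_congr (forall₂_congr fun z hz => ?_) (and_congr (and_congr ?_ ?_) ?_)
  · exact integrableOn_congr_fun (fun w hw => by
      simp only [bergmanKernel_eq_hartogsKernel hn hz hw]) hΩ
  · exact differentiableOn_congr fun z hz => bergmanProjection_eq_hartogsOperator hn f hz
  · exact memLp_congr_ae hae
  · rw [eLpNorm_congr_ae hae]

end

/-! ### Test functions outside the range -/

theorem setLIntegral_disc_rpow_eq {t : ℝ} (ht : -2 < t) :
    ∫⁻ w in Metric.ball (0 : ℂ) 1, ENNReal.ofReal (‖w‖ ^ t) =
      ENNReal.ofReal (2 * Real.pi / (t + 2)) := by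
  have hint : IntegrableOn (fun r : ℝ => r ^ (t + 1)) (Set.Ioo 0 1) :=
    (intervalIntegral.integrableOn_Ioo_rpow_iff one_pos).2 (by linarith)
  have hval : ∫ r in Set.Ioo (0 : ℝ) 1, r ^ (t + 1) = 1 / (t + 2) := by
    rw [← integral_Ioc_eq_integral_Ioo, ← intervalIntegral.integral_of_le zero_le_one,
      integral_rpow (Or.inl (by linarith)), Real.one_rpow, Real.zero_rpow (by linarith), sub_zero]
    congr 1
    ring
  rw [setLIntegral_disc_rpow, ← ofReal_integral_eq_lintegral_ofReal hint, hval,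
    ← ENNReal.ofReal_mul (by positivity), mul_one_div]
  filter_upwards [ae_restrict_mem measurableSet_Ioo] with r hr using Real.rpow_nonneg hr.1.le _

theorem integrableOn_disc_rpow {t : ℝ} (ht : -2 < t) :
    IntegrableOn (fun w : ℂ => ‖w‖ ^ t) (Metric.ball 0 1) := by
  rw [IntegrableOn, ← lintegral_ofReal_ne_top_iff_integrable
    (Measurable.aestronglyMeasurable (by fun_prop))
    (.of_forall fun w => Real.rpow_nonneg (norm_nonneg w) t)]
  exact (setLIntegral_disc_rpow_lt_top_iff.2 ht).ne

theorem setIntegral_disc_rpow {t : ℝ} (ht : -2 < t) :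
    ∫ w in Metric.ball (0 : ℂ) 1, ‖w‖ ^ t = 2 * Real.pi / (t + 2) := by
  rw [integral_eq_lintegral_of_nonneg_ae
    (.of_forall fun w => Real.rpow_nonneg (norm_nonneg w) t)
    (Measurable.aestronglyMeasurable (by fun_prop)), setLIntegral_disc_rpow_eq ht,
    ENNReal.toReal_ofReal]
  exact div_nonneg (by positivity) (by linarith)

/-- The Bergman kernel of the disc integrates radial functions as the constant `1` does, since
`h = 1` is reproduced on each circle. -/
theorem setIntegral_disc_rpow_mul_bergman {t : ℝ} (ht : -2 < t) {z : ℂ} (hz : ‖z‖ < 1) :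
    ∫ w in Metric.ball (0 : ℂ) 1, ((‖w‖ ^ t : ℝ) : ℂ) * (1 / (1 - z * starRingEnd ℂ w) ^ 2) =
      ((2 * Real.pi / (t + 2) : ℝ) : ℂ) := by
  have hi : IntegrableOn (fun w : ℂ => ((‖w‖ ^ t : ℝ) : ℂ)) (Metric.ball 0 1) :=
    (integrableOn_disc_rpow ht).ofReal
  have hc : ContinuousOn (fun w : ℂ => ((‖w‖ ^ t : ℝ) : ℂ)) (Metric.ball 0 1 \ {0}) := by
    refine Complex.continuous_ofReal.comp_continuousOn ?_
    exact continuous_norm.continuousOn.rpow_const fun w hw => Or.inl (norm_ne_zero_iff.2 hw.2)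
  have hk : ContinuousOn (fun w : ℂ => 1 / (1 - z * starRingEnd ℂ w) ^ 2)
      (Metric.ball 0 1 \ {0}) := by
    refine continuousOn_const.div ?_ fun w hw =>
      pow_ne_zero 2 (one_sub_mul_conj_ne_zero hz (mem_ball_zero_iff.1 hw.1).le)
    exact ((continuous_const.sub (continuous_const.mul Complex.continuous_conj)).pow 2).continuousOn
  have hck : ContinuousOn (fun w : ℂ => ((‖w‖ ^ t : ℝ) : ℂ) *
      (1 / (1 - z * starRingEnd ℂ w) ^ 2)) (Metric.ball 0 1 \ {0}) := hc.mul hk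
  rw [← setIntegral_disc_rpow ht, ← integral_complex_ofReal,
    setIntegral_disc_eq_integral_circleMap hck
      (integrable_mul_discBergman ae_norm_le_one_disc hi hz),
    setIntegral_disc_eq_integral_circleMap hc hi]
  refine setIntegral_congr_fun measurableSet_Ioo fun r hr => ?_
  have h1 := intervalIntegral_circleMap_mul_bergman (h := fun _ => 1)
    (differentiableOn_const _) hz hr.1 hr.2
  simp only [one_mul, deriv_const, mul_zero, add_zero, mul_one] at h1
  simp only [norm_circleMap_zero_of_nonneg hr.1.le]
  rw [intervalIntegral.integral_const_mul, h1, intervalIntegral.integral_const]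
  simp [mul_comm]

section

variable {m n : ℕ}

/-- The monomial `z₁^a / z₂^b` with the additional radial factor `|z₂|^{(s - 2) / m}`, which is
`|τ|^{s - 2}` on the covering space. For `s = 2` it is the monomial itself. -/
noncomputable def radialMonomial (m a b : ℕ) (s : ℝ) (w : ℂ × ℂ) : ℂ :=
  w.1 ^ a / w.2 ^ b * (((‖w.2‖ ^ ((m : ℝ)⁻¹)) ^ (s - 2) : ℝ) : ℂ)

theorem measurable_radialMonomial (m a b : ℕ) (s : ℝ) : Measurable (radialMonomial m a b s) := by
  unfold radialMonomial; fun_prop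

theorem integral_weightedDisc_mul_radial {s : ℝ} (hs : 0 < s) {z : ℂ} (hz : ‖z‖ < 1) :
    Integrable (fun τ : ℂ => 1 / (1 - z * starRingEnd ℂ τ) ^ 2 *
      (1 / (z * starRingEnd ℂ τ) ^ (m + n - 1)) *
        (1 / τ ^ (m + n - 1) * ((‖τ‖ ^ (s - 2) : ℝ) : ℂ))) (weightedDisc m n) ∧
    ∫ τ : ℂ, 1 / (1 - z * starRingEnd ℂ τ) ^ 2 *
      (1 / (z * starRingEnd ℂ τ) ^ (m + n - 1)) *
        (1 / τ ^ (m + n - 1) * ((‖τ‖ ^ (s - 2) : ℝ) : ℂ)) ∂weightedDisc m n =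
      (m / z ^ (m + n - 1)) * ((2 * Real.pi / s : ℝ) : ℂ) := by
  have hconj := Complex.continuous_conj.measurable
  obtain ⟨G, hG⟩ : ∃ G : ℂ → ℂ, G = fun τ => 1 / (1 - z * starRingEnd ℂ τ) ^ 2 *
    (1 / (z * starRingEnd ℂ τ) ^ (m + n - 1)) *
      (1 / τ ^ (m + n - 1) * ((‖τ‖ ^ (s - 2) : ℝ) : ℂ)) := ⟨_, rfl⟩
  have hGm : Measurable G := by
    rw [hG]
    generalize m + n - 1 = L
    refine Measurable.mul (Measurable.mul ?_ ?_) (Measurable.mul ?_ ?_)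
    · exact measurable_const.div ((measurable_const.sub (measurable_const.mul hconj)).pow_const 2)
    · exact measurable_const.div ((measurable_const.mul hconj).pow_const L)
    · exact measurable_const.div (measurable_id.pow_const L)
    · exact Complex.measurable_ofReal.comp (measurable_norm.pow_const (s - 2))
  -- the density `m |τ|^(2(m+n-1))` cancels `(conj τ * τ)^(m+n-1)`
  have hcancel : ∀ τ ∈ Metric.ball (0 : ℂ) 1 \ {0},
      ((m * ‖τ‖ ^ (2 * (m + n - 1)) : ℝ) : ℂ) * G τ =
      (m / z ^ (m + n - 1)) *
        (((‖τ‖ ^ (s - 2) : ℝ) : ℂ) * (1 / (1 - z * starRingEnd ℂ τ) ^ 2)) := by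
    intro τ hτ
    have hτ1 : τ ≠ 0 := hτ.2
    have hτ0 : starRingEnd ℂ τ ≠ 0 := by simpa using hτ.2
    rw [hG]
    generalize m + n - 1 = L
    have hnorm : ((‖τ‖ ^ (2 * L) : ℝ) : ℂ) = τ ^ L * starRingEnd ℂ τ ^ L := by
      rw [pow_mul, ← Complex.normSq_eq_norm_sq, ← mul_pow, Complex.mul_conj]
      push_cast
      rfl
    beta_reduce
    rw [Complex.ofReal_mul, hnorm, mul_pow, Complex.ofReal_natCast]
    have hτL : starRingEnd ℂ τ ^ L ≠ 0 := pow_ne_zero L hτ0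
    generalize 1 / (1 - z * starRingEnd ℂ τ) ^ 2 = A
    field_simp
  have hs2 : -2 < s - 2 := by linarith
  rw [← hG]
  constructor
  · have h1 : IntegrableOn (fun τ : ℂ => (m / z ^ (m + n - 1)) * (((‖τ‖ ^ (s - 2) : ℝ) : ℂ) *
        (1 / (1 - z * starRingEnd ℂ τ) ^ 2))) (Metric.ball 0 1 \ {0}) :=
      ((integrable_mul_discBergman ae_norm_le_one_disc (integrableOn_disc_rpow hs2).ofReal
        hz).const_mul _).mono_measure (Measure.restrict_mono Set.sdiff_subset le_rfl)
    rw [← integrable_norm_iff hGm.aestronglyMeasurable, integrable_weightedDisc_iff, IntegrableOn,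
      ← Measure.restrict_congr_set puncturedDisc_ae_eq]
    refine h1.norm.congr ?_
    filter_upwards [ae_restrict_mem measurableSet_puncturedDisc] with τ hτ
    rw [← hcancel τ hτ, norm_mul, Complex.norm_real, Real.norm_of_nonneg (by positivity)]
  · rw [integral_weightedDisc, ← setIntegral_congr_set puncturedDisc_ae_eq,
      setIntegral_congr_fun measurableSet_puncturedDisc hcancel,
      setIntegral_congr_set puncturedDisc_ae_eq, integral_const_mul,
      setIntegral_disc_rpow_mul_bergman hs2 hz, sub_add_cancel]

theorem integral_sheetKernel_mul_radialMonomial (a : ℕ) {s : ℝ} (hs : 0 < s) {x : ℂ × ℂ}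
    (hx : x ∈ puncturedBidisc) :
    Integrable (fun y => sheetKernel m n (mulConj x y).1 (mulConj x y).2 *
      (y.1 ^ a * (1 / y.2 ^ (m + n - 1) * ((‖y.2‖ ^ (s - 2) : ℝ) : ℂ)))) (bidiscMeasure m n) ∧
    ∫ y, sheetKernel m n (mulConj x y).1 (mulConj x y).2 *
      (y.1 ^ a * (1 / y.2 ^ (m + n - 1) * ((‖y.2‖ ^ (s - 2) : ℝ) : ℂ))) ∂bidiscMeasure m n =
      2 * Real.pi ^ 2 * m / s * (x.1 ^ a / x.2 ^ (m + n - 1)) := by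
  obtain ⟨hx1, hx2, -⟩ := mem_puncturedBidisc_iff.1 hx
  have hpi : IntegrableOn (fun v : ℂ => v ^ a) (Metric.ball 0 1) := by
    have : IntegrableOn (fun v : ℂ => v ^ a) (Metric.closedBall 0 1) :=
      (continuous_pow a).continuousOn.integrableOn_compact (isCompact_closedBall 0 1)
    exact this.mono_set Metric.ball_subset_closedBall
  have hFi : IntegrableOn (fun v : ℂ => v ^ a * (1 / (1 - x.1 * starRingEnd ℂ v) ^ 2))
      (Metric.ball 0 1) :=
    integrable_mul_discBergman ae_norm_le_one_disc hpi hx1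
  have hFv : ∫ v in Metric.ball (0 : ℂ) 1, v ^ a * (1 / (1 - x.1 * starRingEnd ℂ v) ^ 2) =
      Real.pi * x.1 ^ a :=
    setIntegral_disc_mul_bergman (differentiable_pow a).differentiableOn hpi hx1
  obtain ⟨hGi, hGv⟩ := integral_weightedDisc_mul_radial (m := m) (n := n) hs hx2
  have hprod : ∀ y : ℂ × ℂ, sheetKernel m n (mulConj x y).1 (mulConj x y).2 *
      (y.1 ^ a * (1 / y.2 ^ (m + n - 1) * ((‖y.2‖ ^ (s - 2) : ℝ) : ℂ))) =
      y.1 ^ a * (1 / (1 - x.1 * starRingEnd ℂ y.1) ^ 2) *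
        (1 / (1 - x.2 * starRingEnd ℂ y.2) ^ 2 * (1 / (x.2 * starRingEnd ℂ y.2) ^ (m + n - 1)) *
          (1 / y.2 ^ (m + n - 1) * ((‖y.2‖ ^ (s - 2) : ℝ) : ℂ))) := by
    intro y
    simp only [sheetKernel, mulConj]
    generalize 1 / (1 - x.1 * starRingEnd ℂ y.1) ^ 2 = A
    generalize 1 / (1 - x.2 * starRingEnd ℂ y.2) ^ 2 = B
    generalize 1 / (x.2 * starRingEnd ℂ y.2) ^ (m + n - 1) = D
    generalize 1 / y.2 ^ (m + n - 1) = E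
    ring
  simp only [hprod, bidiscMeasure]
  refine ⟨hFi.mul_prod hGi, ?_⟩
  rw [integral_prod_mul (fun v : ℂ => v ^ a * (1 / (1 - x.1 * starRingEnd ℂ v) ^ 2))
    (fun τ : ℂ => 1 / (1 - x.2 * starRingEnd ℂ τ) ^ 2 *
      (1 / (x.2 * starRingEnd ℂ τ) ^ (m + n - 1)) *
        (1 / τ ^ (m + n - 1) * ((‖τ‖ ^ (s - 2) : ℝ) : ℂ))), hFv, hGv]
  push_cast
  ring

variable [NeZero m]

theorem radialMonomial_hartogsCover {a b : ℕ} (hab : n * a + (m + n - 1) = m * b) (s : ℝ)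
    {x : ℂ × ℂ} (hx : x ∈ puncturedBidisc) :
    radialMonomial m a b s (hartogsCover m n x) =
      x.1 ^ a * (1 / x.2 ^ (m + n - 1) * ((‖x.2‖ ^ (s - 2) : ℝ) : ℂ)) := by
  have h0 := (mem_puncturedBidisc_iff.1 hx).2.2
  have h1 : (hartogsCover m n x).2 = x.2 ^ m := rfl
  have h2 : (hartogsCover m n x).1 = x.1 * x.2 ^ n := rfl
  rw [radialMonomial, norm_snd_hartogsCover_rpow, h1, h2, ← mul_assoc]
  congr 1
  rw [mul_pow, ← pow_mul, ← pow_mul, ← hab, pow_add]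
  field_simp

/-- The operator maps the radially weighted monomial to a multiple of the monomial itself, because
the latter has the lowest homogeneity among the square integrable monomials. -/
theorem hartogsOperator_radialMonomial (hn : 0 < n) {a b : ℕ}
    (hab : n * a + (m + n - 1) = m * b) {s : ℝ} (hs : 0 < s) {x : ℂ × ℂ}
    (hx : x ∈ puncturedBidisc) :
    hartogsOperator m n (radialMonomial m a b s) (hartogsCover m n x) =
      2 / s * radialMonomial m a b 2 (hartogsCover m n x) := by
  have hm := NeZero.pos m
  have hmC : (m : ℂ) ≠ 0 := by exact_mod_cast hm.ne'
  have hπ : (Real.pi : ℂ) ≠ 0 := by exact_mod_cast Real.pi_ne_zero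
  rw [hartogsOperator_hartogsCover hn (measurable_radialMonomial m a b s).aestronglyMeasurable hx,
    radialMonomial_hartogsCover hab 2 hx]
  have e : ∀ᵐ y ∂bidiscMeasure m n, liftedKernel m n x y *
      radialMonomial m a b s (hartogsCover m n y) =
      1 / (Real.pi ^ 2 * m ^ 2) * ∑ ζ : rootsOfUnity m ℂ,
        sheetKernel m n (mulConj (deck m n ζ x) y).1 (mulConj (deck m n ζ x) y).2 *
          (y.1 ^ a * (1 / y.2 ^ (m + n - 1) * ((‖y.2‖ ^ (s - 2) : ℝ) : ℂ))) := by
    filter_upwards [ae_bidiscMeasure_mem] with y hy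
    rw [radialMonomial_hartogsCover hab s hy, liftedKernel, mul_assoc, Finset.sum_mul]
  rw [integral_congr_ae e, integral_const_mul, integral_finsetSum _ fun ζ _ =>
    (integral_sheetKernel_mul_radialMonomial a hs (deck_mem ζ hx)).1]
  have e2 : ∀ ζ : rootsOfUnity m ℂ, (deck m n ζ x).1 ^ a / (deck m n ζ x).2 ^ (m + n - 1) =
      x.1 ^ a / x.2 ^ (m + n - 1) := by
    intro ζ
    have hζ : ((ζ : ℂˣ) : ℂ) ≠ 0 := Units.ne_zero _
    have hζ1 : (((ζ : ℂˣ) : ℂ) ^ n) ^ a * ((ζ : ℂˣ) : ℂ) ^ (m + n - 1) = 1 := by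
      rw [← pow_mul, ← pow_add, hab, pow_mul, rootsOfUnity_coe_pow, one_pow]
    simp only [deck, div_pow, mul_pow]
    rw [div_div, ← mul_assoc, hζ1, one_mul]
  have e3 : ∀ ζ : rootsOfUnity m ℂ, ∫ y, sheetKernel m n (mulConj (deck m n ζ x) y).1
      (mulConj (deck m n ζ x) y).2 *
        (y.1 ^ a * (1 / y.2 ^ (m + n - 1) * ((‖y.2‖ ^ (s - 2) : ℝ) : ℂ))) ∂bidiscMeasure m n =
      2 * Real.pi ^ 2 * m / s * (x.1 ^ a / x.2 ^ (m + n - 1)) := by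
    intro ζ
    rw [(integral_sheetKernel_mul_radialMonomial a hs (deck_mem ζ hx)).2, e2]
  simp only [e3]
  rw [Finset.sum_const, Finset.card_univ, nsmul_eq_mul, card_rootsOfUnity_complex, sub_self,
    Real.rpow_zero]
  have hsC : (s : ℂ) ≠ 0 := by exact_mod_cast hs.ne'
  push_cast
  field_simp

theorem lintegral_radialMonomial (hn : 0 < n) {a b : ℕ} (hab : n * a + (m + n - 1) = m * b)
    {p : ℝ} (hp : 0 < p) (s : ℝ) :
    ∫⁻ w in hartogsTriangle ((m : ℝ) / n), ‖radialMonomial m a b s w‖ₑ ^ p =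
      ENNReal.ofReal (2 * Real.pi / (a * p + 2)) * (m * ∫⁻ τ in Metric.ball (0 : ℂ) 1,
        ENNReal.ofReal (‖τ‖ ^ (2 * ((m + n - 1 : ℕ) : ℝ) + (s - 2 - (m + n - 1 : ℕ)) * p))) := by
  have hm := NeZero.pos m
  have hmeas : Measurable fun w => ‖radialMonomial m a b s w‖ₑ ^ p := by
    have := measurable_radialMonomial m a b s
    fun_prop
  rw [← map_hartogsCover hm hn, lintegral_map hmeas (measurable_hartogsCover m n)]
  have e : ∀ᵐ y ∂bidiscMeasure m n, ‖radialMonomial m a b s (hartogsCover m n y)‖ₑ ^ p =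
      ENNReal.ofReal (‖y.1‖ ^ (a * p)) *
        ENNReal.ofReal (‖y.2‖ ^ ((s - 2 - (m + n - 1 : ℕ)) * p)) := by
    filter_upwards [ae_bidiscMeasure_mem] with y hy
    have hy0 : 0 < ‖y.2‖ := norm_pos_iff.2 (mem_puncturedBidisc_iff.1 hy).2.2
    rw [radialMonomial_hartogsCover hab s hy, ← ENNReal.ofReal_mul (by positivity), ← ofReal_norm,
      ENNReal.ofReal_rpow_of_nonneg (norm_nonneg _) hp.le]
    congr 1
    simp only [norm_mul, norm_pow, norm_div, norm_one, Complex.norm_real, Real.norm_eq_abs]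
    rw [abs_of_nonneg (by positivity), Real.mul_rpow (by positivity) (by positivity),
      ← Real.rpow_natCast, ← Real.rpow_mul (norm_nonneg _), one_div, ← Real.rpow_natCast,
      ← Real.rpow_neg hy0.le, ← Real.rpow_add hy0, ← Real.rpow_mul hy0.le]
    congr 3
    ring
  rw [lintegral_congr_ae e, bidiscMeasure, lintegral_prod_mul
      (f := fun v : ℂ => ENNReal.ofReal (‖v‖ ^ (a * p)))
      (g := fun τ : ℂ => ENNReal.ofReal (‖τ‖ ^ ((s - 2 - (m + n - 1 : ℕ)) * p)))
      (Measurable.aemeasurable (by fun_prop)) (Measurable.aemeasurable (by fun_prop)),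
    setLIntegral_disc_rpow_eq, lintegral_weightedDisc_rpow]
  have : 0 ≤ (a : ℝ) * p := by positivity
  linarith

theorem exists_mul_add_eq_mul (hmn : Nat.Coprime m n) (k : ℕ) :
    ∃ a b : ℕ, n * a + k = m * b := by
  set a := (-(k : ZMod m) * (n : ZMod m)⁻¹).val with ha
  have hdvd : m ∣ n * a + k := by
    rw [← ZMod.natCast_eq_zero_iff]
    push_cast
    rw [ha, ZMod.natCast_zmod_val]
    have h := ZMod.coe_mul_inv_eq_one n hmn.symm
    linear_combination (-(k : ZMod m)) * h
  obtain ⟨b, hb⟩ := hdvd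
  exact ⟨a, b, hb⟩

theorem hartogsOperator_radialMonomial_ae (hn : 0 < n) {a b : ℕ}
    (hab : n * a + (m + n - 1) = m * b) {s : ℝ} (hs : 0 < s) :
    hartogsOperator m n (radialMonomial m a b s)
      =ᵐ[volume.restrict (hartogsTriangle ((m : ℝ) / n))]
        (2 / s : ℂ) • radialMonomial m a b 2 := by
  have hm := NeZero.pos m
  filter_upwards [ae_restrict_mem (isOpen_hartogsTriangle_div hn).measurableSet] with z hz
  obtain ⟨x, hx, rfl⟩ := exists_hartogsCover_eq hm hn hz
  rw [hartogsOperator_radialMonomial hn hab hs hx]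
  rfl

theorem memLp_radialMonomial_iff (hn : 0 < n) {a b : ℕ} (hab : n * a + (m + n - 1) = m * b)
    {p : ℝ} (hp : 0 < p) (s : ℝ) :
    MemLp (radialMonomial m a b s) (ENNReal.ofReal p)
      (volume.restrict (hartogsTriangle ((m : ℝ) / n))) ↔
      -2 < 2 * ((m + n - 1 : ℕ) : ℝ) + (s - 2 - (m + n - 1 : ℕ)) * p := by
  have hm := NeZero.pos m
  have h0 : (m : ℝ≥0∞) ≠ 0 := by exact_mod_cast hm.ne'
  have hA : 0 < 2 * Real.pi / (a * p + 2) := by positivity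
  rw [MemLp, and_iff_right (measurable_radialMonomial m a b s).aestronglyMeasurable,
    eLpNorm_lt_top_iff_lintegral_rpow_enorm_lt_top (by simpa using hp) ENNReal.ofReal_ne_top,
    ENNReal.toReal_ofReal hp.le, lintegral_radialMonomial hn hab hp,
    ← setLIntegral_disc_rpow_lt_top_iff]
  constructor
  · intro h
    by_contra hc
    rw [not_lt, top_le_iff] at hc
    rw [hc, ENNReal.mul_top h0, ENNReal.mul_top (by simpa using hA)] at h
    exact lt_irrefl _ h
  · intro h
    exact ENNReal.mul_lt_top ENNReal.ofReal_lt_top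
      (ENNReal.mul_lt_top (ENNReal.natCast_lt_top m) h)

/-- The upper bound on `p`: a multiple of the monomial of lowest homogeneity is the projection of a
bounded function, so it has to be in `L^p`. -/
theorem lt_of_bergmanProjectionBounded (hn : 0 < n) (hmn : Nat.Coprime m n) {p : ℝ} (hp : 0 < p)
    (hB : BergmanProjectionBounded (hartogsTriangle ((m : ℝ) / n)) (ENNReal.ofReal p)) :
    p * ((m + n - 1 : ℕ) : ℝ) < 2 * ((m + n - 1 : ℕ) : ℝ) + 2 := by
  obtain ⟨a, b, hab⟩ := exists_mul_add_eq_mul (m := m) hmn (m + n - 1)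
  obtain ⟨C, hC⟩ := (bergmanProjectionBounded_iff (m := m) hn).1 hB
  set L : ℝ := ((m + n - 1 : ℕ) : ℝ) with hL
  have hL0 : 0 ≤ L := Nat.cast_nonneg _
  -- for `s = L + 2` the weighted monomial is bounded
  have hs : 0 < L + 2 := by linarith
  have hf := (memLp_radialMonomial_iff (m := m) hn hab hp (L + 2)).2 (by rw [← hL]; nlinarith)
  obtain ⟨-, hPf, -⟩ := hC _ hf
  have h1 := (memLp_congr_ae (hartogsOperator_radialMonomial_ae hn hab hs)).1 hPf.2
  have h2 := h1.const_smul ((2 / ((L + 2 : ℝ) : ℂ))⁻¹)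
  have hne : (2 / ((L + 2 : ℝ) : ℂ)) ≠ 0 := by
    have : ((L + 2 : ℝ) : ℂ) ≠ 0 := by exact_mod_cast hs.ne'
    exact div_ne_zero two_ne_zero this
  rw [inv_smul_smul₀ hne, memLp_radialMonomial_iff hn hab hp, ← hL] at h2
  linarith

/-- The lower bound on `p`: as `s → 0`, the norms of the weighted monomials in `L^r`, `r` the
endpoint, are of order `s^{-1/r}`, those of their projections of order `1/s`. -/
theorem lt_mul_of_bergmanProjectionBounded (hn : 0 < n) (hmn : Nat.Coprime m n) {p : ℝ}
    (hp : 0 < p)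
    (hB : BergmanProjectionBounded (hartogsTriangle ((m : ℝ) / n)) (ENNReal.ofReal p)) :
    2 * ((m + n - 1 : ℕ) : ℝ) + 2 < p * (((m + n - 1 : ℕ) : ℝ) + 2) := by
  have hm := NeZero.pos m
  obtain ⟨a, b, hab⟩ := exists_mul_add_eq_mul (m := m) hmn (m + n - 1)
  obtain ⟨C, hC⟩ := (bergmanProjectionBounded_iff (m := m) hn).1 hB
  have hfin := isFiniteMeasure_hartogsTriangle hm hn
  set ν := volume.restrict (hartogsTriangle ((m : ℝ) / n)) with hν
  set L : ℝ := ((m + n - 1 : ℕ) : ℝ) with hL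
  have hL1 : 1 ≤ L := by
    have : 1 ≤ m + n - 1 := by omega
    rw [hL]
    exact_mod_cast this
  by_contra hcon
  rw [not_lt] at hcon
  -- the endpoint exponent `r = (2L + 2) / (L + 2)`
  set r := (2 * L + 2) / (L + 2) with hr
  have hL2 : 0 < L + 2 := by linarith
  have hrL : r * (L + 2) = 2 * L + 2 := div_mul_cancel₀ _ hL2.ne'
  have hpr : p ≤ r := (le_div_iff₀ hL2).2 hcon
  have hr1 : 1 < r := (one_lt_div hL2).2 (by linarith)
  have hr0 : 0 < r := by linarith
  have hexp : ∀ s, 2 * L + (s - 2 - L) * r = s * r - 2 := fun s => by linear_combination -hrL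
  set E := eLpNorm (radialMonomial m a b 2) (ENNReal.ofReal p) ν with hE
  have hE0 : E ≠ 0 := by
    rw [hE, eLpNorm_eq_lintegral_rpow_enorm_toReal (by simpa using hp) ENNReal.ofReal_ne_top,
      ENNReal.toReal_ofReal hp.le, hν, lintegral_radialMonomial hn hab hp, ← hL,
      setLIntegral_disc_rpow_eq]
    · have h1 : 0 < 2 * Real.pi / (a * p + 2) := by positivity
      have h2 : 0 < 2 * L + (2 - 2 - L) * p + 2 := by nlinarith
      have h3 : (m : ℝ≥0∞) ≠ 0 := by exact_mod_cast hm.ne'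
      have h4 : 0 < 2 * Real.pi / (2 * L + (2 - 2 - L) * p + 2) := by positivity
      rw [ne_eq, ENNReal.rpow_eq_zero_iff_of_pos (by positivity)]
      refine mul_ne_zero ?_ (mul_ne_zero h3 ?_)
      · rw [ne_eq, ENNReal.ofReal_eq_zero, not_le]; exact h1
      · rw [ne_eq, ENNReal.ofReal_eq_zero, not_le]; exact h4
    · nlinarith
  -- comparison of the `L^p` and `L^r` norms on the finite measure space
  set B : ℝ≥0∞ := C * ν Set.univ ^ (1 / p - 1 / r) with hBdef
  have hBtop : B ≠ ⊤ := by
    refine ENNReal.mul_ne_top ENNReal.coe_ne_top (ENNReal.rpow_ne_top_of_nonneg ?_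
      (measure_ne_top ν _))
    rw [sub_nonneg]
    exact one_div_le_one_div_of_le hp hpr
  set D : ℝ := 2 * Real.pi / (a * r + 2) * (m * (2 * Real.pi / r)) with hD
  have hD0 : 0 ≤ D := by positivity
  have hineq : ∀ s : ℝ, 0 < s → E ≤ B * ENNReal.ofReal (s / 2 * (D / s) ^ (1 / r)) := by
    intro s hs
    have hfr : MemLp (radialMonomial m a b s) (ENNReal.ofReal r) ν := by
      rw [hν, memLp_radialMonomial_iff hn hab hr0, ← hL, hexp]
      nlinarith
    have hnr : eLpNorm (radialMonomial m a b s) (ENNReal.ofReal r) ν =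
        ENNReal.ofReal ((D / s) ^ (1 / r)) := by
      rw [eLpNorm_eq_lintegral_rpow_enorm_toReal (by simpa using hr0) ENNReal.ofReal_ne_top,
        ENNReal.toReal_ofReal hr0.le, hν, lintegral_radialMonomial hn hab hr0, ← hL, hexp,
        setLIntegral_disc_rpow_eq (by nlinarith), ← ENNReal.ofReal_rpow_of_nonneg (by positivity)
          (by positivity), ← ENNReal.ofReal_natCast, ← ENNReal.ofReal_mul (by positivity),
        ← ENNReal.ofReal_mul (by positivity)]
      congr 2
      rw [hD, sub_add_cancel]
      field_simp
    have hpr' : ENNReal.ofReal p ≤ ENNReal.ofReal r := ENNReal.ofReal_le_ofReal hpr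
    have hcmp := eLpNorm_le_eLpNorm_mul_rpow_measure_univ hpr' hfr.1
    rw [ENNReal.toReal_ofReal hp.le, ENNReal.toReal_ofReal hr0.le, hnr] at hcmp
    obtain ⟨-, -, hbd⟩ := hC _ (hfr.mono_exponent hpr')
    rw [eLpNorm_congr_ae (hartogsOperator_radialMonomial_ae hn hab hs), eLpNorm_const_smul,
      ← hE] at hbd
    have hnorm : ‖(2 / s : ℂ)‖ₑ = ENNReal.ofReal (2 / s) := by
      rw [← ofReal_norm]
      simp [abs_of_pos hs]
    rw [hnorm] at hbd
    calc E = ENNReal.ofReal (s / 2) * (ENNReal.ofReal (2 / s) * E) := by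
          rw [← mul_assoc, ← ENNReal.ofReal_mul (by positivity)]
          have : s / 2 * (2 / s) = 1 := by field_simp
          rw [this, ENNReal.ofReal_one, one_mul]
      _ ≤ ENNReal.ofReal (s / 2) * (C * (ENNReal.ofReal ((D / s) ^ (1 / r)) *
            ν Set.univ ^ (1 / p - 1 / r))) := by
          exact mul_le_mul_right (hbd.trans (mul_le_mul_right hcmp _)) _
      _ = _ := by
          rw [ENNReal.ofReal_mul (by positivity), hBdef]
          ring
  have hlim : Filter.Tendsto (fun s : ℝ => B * ENNReal.ofReal (s / 2 * (D / s) ^ (1 / r)))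
      (nhdsWithin 0 (Set.Ioi 0)) (nhds 0) := by
    have hθ : 0 < 1 - 1 / r := by
      rw [sub_pos]
      exact (div_lt_one hr0).2 hr1
    have h1 : Filter.Tendsto (fun s : ℝ => D ^ (1 / r) / 2 * s ^ (1 - 1 / r))
        (nhdsWithin 0 (Set.Ioi 0)) (nhds 0) := by
      have hc : ContinuousAt (fun s : ℝ => D ^ (1 / r) / 2 * s ^ (1 - 1 / r)) 0 :=
        continuousAt_const.mul (Real.continuousAt_rpow_const 0 _ (Or.inr hθ.le))
      have := hc.tendsto
      rw [Real.zero_rpow hθ.ne', mul_zero] at this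
      exact this.mono_left nhdsWithin_le_nhds
    have h2 : Filter.Tendsto (fun s : ℝ => s / 2 * (D / s) ^ (1 / r))
        (nhdsWithin 0 (Set.Ioi 0)) (nhds 0) := by
      refine h1.congr' ?_
      filter_upwards [self_mem_nhdsWithin] with s hs
      have hs0 : 0 < s := hs
      rw [Real.div_rpow hD0 hs0.le, Real.rpow_sub hs0, Real.rpow_one]
      ring
    have h3 := ENNReal.Tendsto.const_mul (ENNReal.tendsto_ofReal h2) (Or.inr hBtop)
    rwa [ENNReal.ofReal_zero, mul_zero] at h3
  have hle : E ≤ 0 := by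
    refine ge_of_tendsto hlim ?_
    filter_upwards [self_mem_nhdsWithin] with s hs using hineq s hs
  exact hE0 (le_antisymm hle zero_le)

end

theorem theorem1 (m n : ℕ) (hm : 0 < m) (hn : 0 < n) (hmn : Nat.Coprime m n)
    (p : ℝ) (hp : 0 < p) :
    BergmanProjectionBounded (hartogsTriangle ((m : ℝ) / (n : ℝ))) (ENNReal.ofReal p) ↔
      p ∈ Set.Ioo ((2 * (m : ℝ) + 2 * (n : ℝ)) / ((m : ℝ) + (n : ℝ) + 1))
        ((2 * (m : ℝ) + 2 * (n : ℝ)) / ((m : ℝ) + (n : ℝ) - 1)) := by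
  have : NeZero m := ⟨hm.ne'⟩
  have hmR : (1 : ℝ) ≤ m := by exact_mod_cast hm
  have hnR : (1 : ℝ) ≤ n := by exact_mod_cast hn
  have hL : ((m + n - 1 : ℕ) : ℝ) = m + n - 1 := by
    rw [Nat.cast_sub (by omega)]
    push_cast
    rfl
  rw [Set.mem_Ioo, div_lt_iff₀ (by linarith), lt_div_iff₀ (by linarith)]
  constructor
  · intro hB
    have h1 := lt_of_bergmanProjectionBounded hn hmn hp hB
    have h2 := lt_mul_of_bergmanProjectionBounded hn hmn hp hB
    rw [hL] at h1 h2
    constructor <;> linarith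
  · rintro ⟨h1, h2⟩
    have hp1 : 1 < p := by nlinarith
    rw [bergmanProjectionBounded_iff hn]
    exact exists_hartogsOperator_bound hn hp1 (by rw [hL]; linarith) (by rw [hL]; linarith)
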